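/- Let $H_0=L^2([0,\pi];\mathbb{C})$ and let $\Delta_0$ be the Dirichlet Laplacian on $[0,\pi]$, with eigenfunctions $e_k(t)=\sqrt{2/\pi}\,\sin(kt)$, $k\ge 1$. For $s\in\mathbb{R}$ let $\mathrm{H}_0^s$ be the domain of $(-\Delta_0)^{s/2}$, that is, the space of sine series $\sum_{k\ge1}u_ke_k$ with $\|u\|_{\mathrm{H}_0^s}^2=\sum_{k\ge1}k^{2s}|u_k|^2<\infty$ (for $s<0$ these are formal series: the completion of $H_0$ in this norm, dual to $\mathrm{H}_0^{-s}$). Fix $a\in\mathbb{R}$. Write $\delta_x'$ for the distribution $\varphi\mapsto-\varphi'(x)$, and set $$A f=f'(0)\,\delta_0'+f'(\pi)\,\delta_\pi'.$$ Let $\mathcal{L}_a f=\partial_t^4 f$, with domain the set of $f\in \mathrm{H}^4(0,\pi)$ such that $f(0)=f(\pi)=0$, $f''(0)=-af'(0)$ and $f''(\pi)=af'(\pi)$. Then the following hold. 1. For every $\varepsilon>0$, every element of $\mathrm{H}_0^{3/2+\varepsilon}$ is a $C^1$ function on $[0,\pi]$, and $A$ is a well-defined bounded linear operator from $\mathrm{H}_0^{3/2+\varepsilon}$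 to $\mathrm{H}_0^{-3/2-\varepsilon}$. 2. For $0<\varepsilon<1$ let $\tilde{\mathcal{L}}_a=\Delta_0^2+aA$ be the operator in $H_0$ whose domain is the set of $f\in \mathrm{H}_0^{3/2+\varepsilon}$ with $\Delta_0^2f+aAf\in H_0$. Then $\tilde{\mathcal{L}}_a=\mathcal{L}_a$ (same domain, same values), and $-\tilde{\mathcal{L}}_a=-\mathcal{L}_a$ is the generator of an analytic semigroup $S(\tau)=e^{-\tau\mathcal{L}_a}$ on $H_0$. 3. There is a real $\kappa$ for which $e^{-\kappa\tau}S(\tau)$ decays exponentially in operator norm. For every such $\kappa$ let $\mathcal{H}^\alpha$ be the interpolation spaces of $\mathcal{L}_a$: for $\alpha\ge0$ the domain of $(\kappa+\mathcal{L}_a)^\alpha$ with norm $\|(\kappa+\mathcal{L}_a)^\alpha f\|_{H_0}$, and for $\alpha<0$ the completion of $H_0$ in the norm $\|(\kappa+\mathcal{L}_a)^\alpha f\|_{H_0}$, where for $\beta>0$ the operator $(\kappa+\mathcal{L}_a)^{-\beta}=\Gamma(\beta)^{-1}\int_0^\infty \tau^{\beta-1}e^{-\kappa\tau}S(\tau)\,d\tau$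 is injective, and $(\kappa+\mathcal{L}_a)^{\beta}$ is its inverse. Then $\mathcal{H}^\alpha=\mathrm{H}_0^{4\alpha}$, with equivalent norms, for every $\alpha\in(-\tfrac58,\tfrac58)$; for $\alpha<0$ this means that the identity of $H_0$ extends to an isomorphism from $\mathcal{H}^\alpha$ onto $\mathrm{H}_0^{4\alpha}$. -/

import Mathlib

open MeasureTheory Filter Topology Set
open scoped ContDiff

noncomputable section

namespace InterpFourth

/-! ### Strongly continuous and analytic semigroups on a complex Banach space -/

section Semigroup

variable {X : Type*} [NormedAddCommGroup X] [NormedSpace ℂ X]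

/-- `S : [0, ∞) → B(X)` is a strongly continuous semigroup (the values of `S` at negative times
play no role). -/
structure IsC0Semigroup (S : ℝ → X →L[ℂ] X) : Prop where
  zero : S 0 = 1
  add : ∀ s t : ℝ, 0 ≤ s → 0 ≤ t → S (s + t) = S s * S t
  cont : ∀ x : X, ContinuousOn (fun t => S t x) (Ici 0)

/-- The open sector of half-opening `θ` around the positive real axis. -/
def sector (θ : ℝ) : Set ℂ := {z | z ≠ 0 ∧ |z.arg| < θ}

/-- `S` is an analytic semigroup: it is strongly continuous and extends, for some `θ > 0`, to a
holomorphic family on the sector of half-opening `θ` which satisfies the semigroup law there and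
converges strongly to the identity as `z → 0` within the sector. -/
structure IsAnalyticSemigroup (S : ℝ → X →L[ℂ] X) : Prop extends IsC0Semigroup S where
  exists_extension : ∃ θ : ℝ, 0 < θ ∧ θ ≤ Real.pi / 2 ∧ ∃ Sc : ℂ → X →L[ℂ] X,
    (∀ t : ℝ, 0 < t → Sc (t : ℂ) = S t) ∧
    DifferentiableOn ℂ Sc (sector θ) ∧
    (∀ z ∈ sector θ, ∀ w ∈ sector θ, Sc (z + w) = Sc z * Sc w) ∧
    ∀ x : X, Tendsto (fun z => Sc z x) (𝓝[sector θ] 0) (𝓝 x)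

/-- The graph of the infinitesimal generator of `S`. Unbounded operators are described by their
graphs throughout. -/
def generator (S : ℝ → X →L[ℂ] X) : Set (X × X) :=
  {p | Tendsto (fun t : ℝ => t⁻¹ • (S t p.1 - p.1)) (𝓝[>] 0) (𝓝 p.2)}

/-- The graph of `-L`, where `L` is the operator with the given graph. -/
def negOp (L : Set (X × X)) : Set (X × X) := {p | (p.1, -p.2) ∈ L}

/-- `exp (-κ t) S t` decays exponentially. If `-L` is the generator of `S`, then `κ + L` has
fractional powers. -/
def IsAdmissibleShift (S : ℝ → X →L[ℂ] X) (κ : ℝ) : Prop :=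
  ∃ M δ : ℝ, 0 < δ ∧ ∀ t : ℝ, 0 ≤ t → ‖S t‖ ≤ M * Real.exp ((κ - δ) * t)

/-- For `α ≥ 0` and an admissible shift `κ`, the bounded operator `(κ + L) ^ (-α)`, where `-L` is
the generator of `S`:
`(κ + L) ^ (-α) = Γ(α)⁻¹ ∫₀^∞ t ^ (α - 1) exp (-κ t) S(t) dt` if `α > 0`, and the identity if
`α = 0`. -/
def negPow (S : ℝ → X →L[ℂ] X) (κ α : ℝ) : X →L[ℂ] X :=
  if α = 0 then 1
  else (Real.Gamma α)⁻¹ • ∫ t in Ioi (0 : ℝ), (t ^ (α - 1) * Real.exp (-(κ * t))) • S t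

/-- For `α ≥ 0`, the interpolation space of order `α` is the domain of `(κ + L) ^ α`, which is the
range of `(κ + L) ^ (-α)`. -/
def interpDomain (S : ℝ → X →L[ℂ] X) (κ α : ℝ) : Set X := range (negPow S κ α)

/-- The norm `‖(κ + L) ^ α y‖` of an element `y` of the interpolation space of order `α ≥ 0`: it is
`‖x‖` for the `x` with `(κ + L) ^ (-α) x = y`. -/
def interpNorm (S : ℝ → X →L[ℂ] X) (κ α : ℝ) (y : X) : ℝ :=
  sInf {r | ∃ x, negPow S κ α x = y ∧ r = ‖x‖}

/-- The space `X` with the norm `‖J x‖` instead of `‖x‖`. -/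
def NormedVia (_J : X →L[ℂ] X) : Type _ := X

instance (J : X →L[ℂ] X) : AddCommGroup (NormedVia J) := inferInstanceAs (AddCommGroup X)
instance (J : X →L[ℂ] X) : Module ℂ (NormedVia J) := inferInstanceAs (Module ℂ X)

/-- `J`, as a linear map on `NormedVia J`. -/
def NormedVia.toLin (J : X →L[ℂ] X) : NormedVia J →ₗ[ℂ] X := J.toLinearMap

instance (J : X →L[ℂ] X) : SeminormedAddCommGroup (NormedVia J) :=
  SeminormedAddCommGroup.induced (NormedVia J) X (NormedVia.toLin J)
instance (J : X →L[ℂ] X) : NormedSpace ℂ (NormedVia J) :=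
  NormedSpace.induced ℂ (NormedVia J) X (NormedVia.toLin J)

/-- `x`, as an element of `NormedVia J`. -/
def NormedVia.of (J : X →L[ℂ] X) (x : X) : NormedVia J := x

/-- For `β > 0`, the interpolation space of order `-β`: the completion of `X` under the norm
`‖(κ + L) ^ (-β) x‖`. -/
abbrev InterpNeg (S : ℝ → X →L[ℂ] X) (κ β : ℝ) : Type _ :=
  UniformSpace.Completion (NormedVia (negPow S κ β))

/-- The canonical map from `X` to the interpolation space of order `-β`. -/
def InterpNeg.of (S : ℝ → X →L[ℂ] X) (κ β : ℝ) (x : X) : InterpNeg S κ β :=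
  ((NormedVia.of (negPow S κ β) x : NormedVia (negPow S κ β)) :
    UniformSpace.Completion (NormedVia (negPow S κ β)))

end Semigroup

/-! ### The scale of spaces of the Dirichlet Laplacian on `[0, π]` -/

/-- The interval `[0, π]`. -/
abbrev I : Set ℝ := Icc 0 Real.pi

/-- Lebesgue measure on `[0, π]`. -/
abbrev μI : Measure ℝ := volume.restrict I

/-- The Hilbert space `L²([0, π])` of complex valued functions. -/
abbrev H₀ : Type := Lp ℂ 2 μI

/-- The normalized eigenfunctions `√(2/π) sin ((k + 1) t)`, `k = 0, 1, 2, …`, of the Dirichlet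
Laplacian; the eigenvalue is `-(k + 1)²`. -/
def sinBasis (k : ℕ) (t : ℝ) : ℝ := √(2 / Real.pi) * Real.sin ((k + 1) * t)

/-- The coefficients of `f ∈ L²([0, π])` in the sine basis. -/
def coeff (f : H₀) (k : ℕ) : ℂ := ∫ t, sinBasis k t • f t ∂μI

/-- The coefficient sequences `(u_k)` with `∑ (k + 1) ^ (2 s) |u_k|² < ∞`. -/
def dirSubmodule (s : ℝ) : Submodule ℂ (ℕ → ℂ) where
  carrier := {u | Memℓp (fun k : ℕ => ((k : ℝ) + 1) ^ s • u k) 2}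
  add_mem' {u v} hu hv := by
    have h := Memℓp.add hu hv
    have e : (fun k : ℕ => ((k : ℝ) + 1) ^ s • (u + v) k)
        = (fun k : ℕ => ((k : ℝ) + 1) ^ s • u k) + fun k : ℕ => ((k : ℝ) + 1) ^ s • v k := by
      funext k; simp [smul_add]
    simpa only [mem_ofPred_eq, e] using h
  zero_mem' := by
    have h : Memℓp (0 : ℕ → ℂ) 2 := zero_memℓp
    have e : (fun k : ℕ => ((k : ℝ) + 1) ^ s • (0 : ℕ → ℂ) k) = 0 := by funext k; simp
    simpa only [mem_ofPred_eq, e] using h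
  smul_mem' c u hu := by
    have h := Memℓp.const_smul hu c
    have e : (fun k : ℕ => ((k : ℝ) + 1) ^ s • (c • u) k)
        = c • fun k : ℕ => ((k : ℝ) + 1) ^ s • u k := by
      funext k; simp [mul_left_comm]
    simpa only [mem_ofPred_eq, e] using h

/-- The space `H₀^s` (any real `s`), the domain of `(-Δ₀) ^ (s/2)`, through the spectral
decomposition: formal sine series `∑ u_k sinBasis k` with `∑ (k + 1) ^ (2 s) |u_k|² < ∞`, given by
their coefficients. For `s ≥ 0` these are the sine series of certain functions in `L²([0, π])`;
for `s < 0` this is the completion of `L²([0, π])` under the norm of `H₀^s`, that is, the dual space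
of `H₀^(-s)`, with `u_k` the value of the functional `u` at `sinBasis k`. -/
def DirSob (s : ℝ) : Type := dirSubmodule s

instance (s : ℝ) : AddCommGroup (DirSob s) := inferInstanceAs (AddCommGroup (dirSubmodule s))
instance (s : ℝ) : Module ℂ (DirSob s) := inferInstanceAs (Module ℂ (dirSubmodule s))

/-- The coefficients of an element of `H₀^s`. -/
def DirSob.seq {s : ℝ} (u : DirSob s) : ℕ → ℂ := Subtype.val u

/-- The action of `(-Δ₀) ^ (s/2)` from `H₀^s` to `ℓ² ≅ L²([0, π])`. -/
def DirSob.toLp (s : ℝ) : DirSob s →ₗ[ℂ] lp (fun _ : ℕ => ℂ) 2 where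
  toFun u := ⟨fun k => ((k : ℝ) + 1) ^ s • u.seq k, u.2⟩
  map_add' u v := by
    ext k
    change ((k : ℝ) + 1) ^ s • (u.seq k + v.seq k) = _
    rw [smul_add]; rfl
  map_smul' c u := by
    ext k
    change ((k : ℝ) + 1) ^ s • (c • u.seq k) = c • (((k : ℝ) + 1) ^ s • u.seq k)
    rw [smul_comm]

theorem DirSob.toLp_injective (s : ℝ) : Function.Injective (DirSob.toLp s) := by
  intro u v h
  apply Subtype.ext
  funext k
  have hk : ((k : ℝ) + 1) ^ s • u.seq k = ((k : ℝ) + 1) ^ s • v.seq k :=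
    congrFun (congrArg Subtype.val h) k
  have hpos : ((k : ℝ) + 1) ^ s ≠ 0 := (Real.rpow_pos_of_pos (by positivity) s).ne'
  exact smul_right_injective ℂ hpos hk

/-- The norm of `H₀^s` is `(∑ (k + 1) ^ (2 s) |u_k|²) ^ (1/2)`. -/
instance (s : ℝ) : NormedAddCommGroup (DirSob s) :=
  NormedAddCommGroup.induced (DirSob s) (lp (fun _ : ℕ => ℂ) 2) (DirSob.toLp s)
    (DirSob.toLp_injective s)
instance (s : ℝ) : NormedSpace ℂ (DirSob s) :=
  NormedSpace.induced ℂ (DirSob s) (lp (fun _ : ℕ => ℂ) 2) (DirSob.toLp s)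

/-! ### The perturbed operator `Δ₀² + a A` -/

/-- `f ∈ L²([0, π])` has a representative that is `C¹` on `[0, π]`, with derivative `p` at `0` and
`q` at `π`. -/
def HasEndSlopes (f : H₀) (p q : ℂ) : Prop :=
  ∃ F : ℝ → ℂ, f =ᵐ[μI] F ∧ ContDiffOn ℝ 1 F I ∧
    derivWithin F I 0 = p ∧ derivWithin F I Real.pi = q

/-- The distribution `δ_x'`, that is `φ ↦ -φ'(x)`, given by its values at the sine basis. -/
def deltaDeriv (x : ℝ) (k : ℕ) : ℂ := ((-deriv (sinBasis k) x : ℝ) : ℂ)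

/-- The distribution `p δ₀' + q δ_π'`, which is `A f` if `p = f'(0)` and `q = f'(π)`. -/
def slopeDist (p q : ℂ) (k : ℕ) : ℂ := p * deltaDeriv 0 k + q * deltaDeriv Real.pi k

/-- The graph of `Δ₀² + a A` in `L²([0, π])`: the pairs `(f, g)` with `f` in `H₀^(3/2 + ε)` and
`Δ₀² f + a (f'(0) δ₀' + f'(π) δ_π') = g ∈ L²([0, π])`. -/
def perturbedOp (a ε : ℝ) : Set (H₀ × H₀) :=
  {fg | coeff fg.1 ∈ dirSubmodule (3 / 2 + ε) ∧ ∃ p q : ℂ, HasEndSlopes fg.1 p q ∧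
    ∀ k : ℕ, coeff fg.2 k = ((k : ℂ) + 1) ^ 4 * coeff fg.1 k + (a : ℂ) * slopeDist p q k}

/-! ### The operator `∂_t⁴` with boundary conditions -/

/-- `g` is the weak derivative of order `j` of `f` on `(0, π)`. -/
def IsWeakDeriv (j : ℕ) (f g : H₀) : Prop :=
  ∀ φ : ℝ → ℝ, ContDiff ℝ ∞ φ → HasCompactSupport φ → tsupport φ ⊆ Ioo 0 Real.pi →
    ∫ t, iteratedDeriv j φ t • f t ∂μI = (-1 : ℂ) ^ j * ∫ t, φ t • g t ∂μI

/-- The Sobolev space `H⁴(0, π)`: all weak derivatives up to order four are in `L²`. -/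
def MemH4 (f : H₀) : Prop := ∀ j ≤ 4, ∃ g : H₀, IsWeakDeriv j f g

/-- The boundary conditions `f(0) = f(π) = 0`, `f''(0) = -a f'(0)`, `f''(π) = a f'(π)`, for the
representative of `f` that is `C²` on `[0, π]`. -/
def SatisfiesBC (a : ℝ) (f : H₀) : Prop :=
  ∃ F : ℝ → ℂ, f =ᵐ[μI] F ∧ ContDiffOn ℝ 2 F I ∧ F 0 = 0 ∧ F Real.pi = 0 ∧
    iteratedDerivWithin 2 F I 0 = -(a : ℂ) * derivWithin F I 0 ∧
    iteratedDerivWithin 2 F I Real.pi = (a : ℂ) * derivWithin F I Real.pi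

/-- The graph of the operator `ℒ_a = ∂_t⁴` in `L²([0, π])`, with domain the functions in `H⁴` that
satisfy the boundary conditions. -/
def fourthOp (a : ℝ) : Set (H₀ × H₀) :=
  {fg | MemH4 fg.1 ∧ SatisfiesBC a fg.1 ∧ IsWeakDeriv 4 fg.1 fg.2}

end InterpFourth

end

open MeasureTheory Filter Topology Set
open scoped ContDiff

noncomputable section

namespace InterpFourth

universe u v

/-! ### Multiplication operators in a Hilbert basis -/

section Diagonal

/-! In the sine basis the square of the Dirichlet Laplacian is multiplication by `d(k) = (k + 1)^4`.
The slopes of the basis functions at `0` and `π` differ only by the sign `(-1)^(k+1)`, so the two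
slope functionals recombine into sums over odd and over even frequencies: `a A = -β ∑ᵢ pᵢ ⟨pᵢ, ·⟩`
with `β = 4a/π` and `pᵢ` equal to `k + 1` on one parity class (`slopeDist_eq_parFreq`). The `pᵢ` are
not square-summable, but `Qᵢ(κ) = ∑ pᵢ² / (κ + d)` is finite and tends to `0` as `κ → ∞`, and their
supports are disjoint. Hence for all large `κ` Krein's formula gives the resolvent as `(κ + d)⁻¹`
plus one rank one term for each parity, with coefficient `β / (1 - β Qᵢ(κ))` (`mem_opGraph_iff`). It
is compact, symmetric and injective, so the perturbed operator is diagonal in a Hilbert basis, with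
real eigenvalues bounded below (`exists_opGraph_diagonal`). The semigroup, its holomorphic
extension, its generator and the fractional powers are then read off from multipliers.

The identification with `∂_t⁴` is integration by parts against the sines: four integrations for a
function vanishing at both ends leave only the values of `f''` there, multiplied by the slopes of
the sines. The boundary conditions turn these terms into the coordinates of `a A f`. The regularity
needed comes from the lemma of du Bois-Reymond in one direction, and from solving the boundary value
problem explicitly in the other.

For the interpolation spaces, with `0 < α < 5/8`, both resolvents are integrated against `s^(-α)`.
The difference of the negative powers is `(κ + d)^(-α) K`, where `K` is an integral of rank two
kernels. The vector `(κ + d)^α (s + κ + d)⁻¹ pᵢ` has norm `O((κ + s)^(-θ))` whenever `θ + α < 5/8`,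
since then `(k + 1)^(1 + 4(α - 1 + θ))` is square-summable; this is where `5/8` comes from. The
integrals converge and `‖K‖ < 1` for large `κ`, so `1 + K` is invertible and the two negative powers
have the same range and equivalent norms (`exists_isUnit_fracPow`). A change of `κ` only costs a
bounded invertible multiplier. Negative orders follow by taking adjoints, as both powers are
self-adjoint. -/

theorem memℓp_two_iff {ι : Type*} {u : ι → ℂ} : Memℓp u 2 ↔ Summable fun i => ‖u i‖ ^ 2 := by
  rw [memℓp_gen_iff (by norm_num)]
  simp

theorem lp_norm_sq {ι : Type*} (x : lp (fun _ : ι => ℂ) 2) : ‖x‖ ^ 2 = ∑' i, ‖x i‖ ^ 2 := by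
  have h := lp.norm_rpow_eq_tsum (p := 2) (by norm_num) x
  simpa using h

variable {ι : Type*} {H : Type*} [NormedAddCommGroup H] [InnerProductSpace ℂ H]

/-- The sequence `m` is bounded. -/
def BddSeq (m : ι → ℂ) : Prop := ∃ C, ∀ i, ‖m i‖ ≤ C

theorem memℓp_mul {m u : ι → ℂ} (hm : BddSeq m) (hu : Memℓp u 2) :
    Memℓp (fun i => m i * u i) 2 := by
  obtain ⟨C, hC⟩ := hm
  rw [memℓp_two_iff] at hu ⊢
  refine Summable.of_nonneg_of_le (fun i => by positivity) (fun i => ?_) (hu.mul_left (C ^ 2))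
  rw [norm_mul, mul_pow]
  gcongr
  exact hC i

theorem hasSum_norm_repr_sq (b : HilbertBasis ι ℂ H) (x : H) :
    HasSum (fun i => ‖b.repr x i‖ ^ 2) (‖x‖ ^ 2) := by
  rw [← b.repr.norm_map x, lp_norm_sq]
  exact (memℓp_two_iff.1 (lp.memℓp (b.repr x))).hasSum

theorem ext_repr (b : HilbertBasis ι ℂ H) {x y : H} (h : ∀ i, b.repr x i = b.repr y i) : x = y :=
  b.repr.injective (lp.ext (funext h))

/-- The vector with coordinates `u`. -/
def vecOf (b : HilbertBasis ι ℂ H) (u : ι → ℂ) : H :=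
  -- The default value `0` makes the definition total, so that families of vectors can be written
  -- without carrying a proof of summability; `repr_vecOf` asks for that proof.
  open Classical in if h : Memℓp u 2 then b.repr.symm ⟨u, h⟩ else 0

theorem repr_vecOf (b : HilbertBasis ι ℂ H) {u : ι → ℂ} (hu : Memℓp u 2) (i : ι) :
    b.repr (vecOf b u) i = u i := by
  rw [vecOf, dif_pos hu, LinearIsometryEquiv.apply_symm_apply]

theorem inner_eq_tsum_repr (b : HilbertBasis ι ℂ H) (x y : H) :
    inner ℂ x y = ∑' i, (starRingEnd ℂ) (b.repr x i) * b.repr y i := by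
  rw [← b.repr.inner_map_map, lp.inner_eq_tsum]
  simp [mul_comm]

theorem summable_repr_mul (b : HilbertBasis ι ℂ H) (x y : H) :
    Summable fun i => (starRingEnd ℂ) (b.repr x i) * b.repr y i := by
  have h := lp.summable_inner (𝕜 := ℂ) (b.repr x) (b.repr y)
  simpa [mul_comm] using h

theorem ext_basis (b : HilbertBasis ι ℂ H) {E : Type*} [NormedAddCommGroup E] [NormedSpace ℂ E]
    {S T : H →L[ℂ] E} (h : ∀ i, S (b i) = T (b i)) : S = T :=
  ContinuousLinearMap.ext_on (s := Set.range b)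
    (Submodule.dense_iff_topologicalClosure_eq_top.2 b.dense_span)
    (by rintro _ ⟨i, rfl⟩; exact h i)

/-- The bounded operator which multiplies the coordinates by the bounded sequence `m`. -/
def diagOp (b : HilbertBasis ι ℂ H) (m : ι → ℂ) : H →L[ℂ] H :=
  open Classical in
  if h : BddSeq m then
    LinearMap.mkContinuousOfExistsBound
      { toFun := fun x => vecOf b fun i => m i * b.repr x i
        map_add' := fun x y => ext_repr b fun i => by
          simp only [map_add, lp.coeFn_add, Pi.add_apply]
          rw [repr_vecOf b (memℓp_mul h (lp.memℓp _)), repr_vecOf b (memℓp_mul h (lp.memℓp _)),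
            repr_vecOf]
          · ring
          · exact memℓp_mul h (lp.memℓp (b.repr x + b.repr y))
        map_smul' := fun c x => ext_repr b fun i => by
          simp only [map_smul, lp.coeFn_smul, Pi.smul_apply, RingHom.id_apply, smul_eq_mul]
          rw [repr_vecOf b (memℓp_mul h (lp.memℓp _)), repr_vecOf]
          · ring
          · exact memℓp_mul h (lp.memℓp (c • b.repr x)) }
      (by
        obtain ⟨C, hC⟩ := h
        -- The absolute value covers an empty index type, where the bound `C` may be negative.
        refine ⟨|C|, fun x => abs_le_of_sq_le_sq' ?_ (by positivity) |>.2⟩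
        have h1 := hasSum_norm_repr_sq b (vecOf b fun i => m i * b.repr x i)
        simp only [repr_vecOf b (memℓp_mul ⟨C, hC⟩ (lp.memℓp _))] at h1
        rw [mul_pow]
        refine hasSum_le (fun i => ?_) h1 ((hasSum_norm_repr_sq b x).mul_left (|C| ^ 2))
        rw [norm_mul, mul_pow]
        gcongr
        exact (hC i).trans (le_abs_self C))
  else 0

theorem repr_diagOp (b : HilbertBasis ι ℂ H) {m : ι → ℂ} (hm : BddSeq m) (x : H) (i : ι) :
    b.repr (diagOp b m x) i = m i * b.repr x i := by
  rw [diagOp, dif_pos hm]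
  exact repr_vecOf b (memℓp_mul hm (lp.memℓp _)) i

theorem norm_diagOp_le (b : HilbertBasis ι ℂ H) {m : ι → ℂ} {C : ℝ} (hC : 0 ≤ C)
    (hm : ∀ i, ‖m i‖ ≤ C) : ‖diagOp b m‖ ≤ C := by
  refine ContinuousLinearMap.opNorm_le_bound _ hC fun x =>
    (abs_le_of_sq_le_sq' ?_ (by positivity)).2
  have h1 := hasSum_norm_repr_sq b (diagOp b m x)
  simp only [repr_diagOp b ⟨C, hm⟩] at h1
  rw [mul_pow]
  refine hasSum_le (fun i => ?_) h1 ((hasSum_norm_repr_sq b x).mul_left (C ^ 2))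
  rw [norm_mul, mul_pow]
  gcongr
  exact hm i

theorem repr_basis (b : HilbertBasis ι ℂ H) [DecidableEq ι] (i j : ι) :
    b.repr (b i) j = if j = i then 1 else 0 := by
  rw [b.repr_self, lp.single_apply, Pi.single_apply]

theorem diagOp_basis (b : HilbertBasis ι ℂ H) {m : ι → ℂ} (hm : BddSeq m) (i : ι) :
    diagOp b m (b i) = m i • b i := by
  classical
  refine ext_repr b fun j => ?_
  rw [repr_diagOp b hm, map_smul, lp.coeFn_smul, Pi.smul_apply, repr_basis, smul_eq_mul]
  split_ifs with h
  · rw [h]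
  · simp

theorem BddSeq.mul {m m' : ι → ℂ} (h : BddSeq m) (h' : BddSeq m') :
    BddSeq fun i => m i * m' i := by
  obtain ⟨C, hC⟩ := h
  obtain ⟨C', hC'⟩ := h'
  refine ⟨C * C', fun i => ?_⟩
  rw [norm_mul]
  exact mul_le_mul (hC i) (hC' i) (norm_nonneg _) ((norm_nonneg _).trans (hC i))

theorem BddSeq.sub {m m' : ι → ℂ} (h : BddSeq m) (h' : BddSeq m') :
    BddSeq fun i => m i - m' i := by
  obtain ⟨C, hC⟩ := h
  obtain ⟨C', hC'⟩ := h'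
  exact ⟨C + C', fun i => (norm_sub_le _ _).trans (add_le_add (hC i) (hC' i))⟩

theorem BddSeq.const_mul {m : ι → ℂ} (h : BddSeq m) (c : ℂ) : BddSeq fun i => c * m i :=
  BddSeq.mul ⟨‖c‖, fun _ => le_rfl⟩ h

theorem diagOp_mul (b : HilbertBasis ι ℂ H) {m m' : ι → ℂ} (h : BddSeq m) (h' : BddSeq m') :
    diagOp b m * diagOp b m' = diagOp b fun i => m i * m' i := by
  refine ContinuousLinearMap.ext fun x => ext_repr b fun i => ?_
  change b.repr (diagOp b m (diagOp b m' x)) i = _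
  rw [repr_diagOp b h, repr_diagOp b h', repr_diagOp b (h.mul h'),
    mul_assoc]

theorem diagOp_one (b : HilbertBasis ι ℂ H) : diagOp b (fun _ => 1) = 1 := by
  refine ContinuousLinearMap.ext fun x => ext_repr b fun i => ?_
  rw [repr_diagOp b ⟨1, by simp⟩, one_mul, one_apply_eq_self]

theorem diagOp_sub (b : HilbertBasis ι ℂ H) {m m' : ι → ℂ} (h : BddSeq m) (h' : BddSeq m') :
    diagOp b m - diagOp b m' = diagOp b fun i => m i - m' i := by
  refine ContinuousLinearMap.ext fun x => ext_repr b fun i => ?_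
  rw [sub_apply, map_sub, lp.coeFn_sub, Pi.sub_apply, repr_diagOp b h,
    repr_diagOp b h', repr_diagOp b (h.sub h'), sub_mul]

theorem diagOp_smul (b : HilbertBasis ι ℂ H) {m : ι → ℂ} (h : BddSeq m) (c : ℂ) :
    c • diagOp b m = diagOp b fun i => c * m i := by
  refine ContinuousLinearMap.ext fun x => ext_repr b fun i => ?_
  rw [smul_apply, map_smul, lp.coeFn_smul, Pi.smul_apply, repr_diagOp b h,
    repr_diagOp b (h.const_mul c), smul_eq_mul, mul_assoc]

theorem inner_diagOp (b : HilbertBasis ι ℂ H) {m : ι → ℝ} (h : BddSeq fun i => (m i : ℂ))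
    (x y : H) : inner ℂ (diagOp b (fun i => (m i : ℂ)) x) y
      = inner ℂ x (diagOp b (fun i => (m i : ℂ)) y) := by
  rw [inner_eq_tsum_repr b, inner_eq_tsum_repr b]
  refine tsum_congr fun i => ?_
  rw [repr_diagOp b h, repr_diagOp b h, map_mul, Complex.conj_ofReal]
  ring

theorem adjoint_diagOp [CompleteSpace H] (b : HilbertBasis ι ℂ H) {m : ι → ℝ}
    (h : BddSeq fun i => (m i : ℂ)) :
    ContinuousLinearMap.adjoint (diagOp b fun i => (m i : ℂ)) = diagOp b fun i => (m i : ℂ) :=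
  ((ContinuousLinearMap.eq_adjoint_iff _ _).2 (inner_diagOp b h)).symm

/-- Dominated convergence for the squared coordinates. The convergence is only strong: `exp (-t l)`
with `l` unbounded above does not tend to `1` in norm as `t → 0`. -/
theorem tendsto_diagOp (b : HilbertBasis ι ℂ H) {σ : Type*} {l : Filter σ}
    {m : σ → ι → ℂ} {m₀ : ι → ℂ} {C : ℝ} (hm : ∀ᶠ s in l, ∀ i, ‖m s i‖ ≤ C)
    (hm₀ : ∀ i, ‖m₀ i‖ ≤ C) (hlim : ∀ i, Tendsto (fun s => m s i) l (𝓝 (m₀ i))) (x : H) :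
    Tendsto (fun s => diagOp b (m s) x) l (𝓝 (diagOp b m₀ x)) := by
  rw [tendsto_iff_norm_sub_tendsto_zero]
  have h2 : Tendsto (fun s => ∑' i, ‖(m s i - m₀ i) * b.repr x i‖ ^ 2) l
      (𝓝 (∑' _ : ι, (0 : ℝ))) := by
    refine tendsto_tsum_of_dominated_convergence
      (bound := fun i => (C + C) ^ 2 * ‖b.repr x i‖ ^ 2)
      ((hasSum_norm_repr_sq b x).summable.mul_left _) (fun i => ?_) ?_
    · have := (((hlim i).sub_const (m₀ i)).mul_const (b.repr x i)).norm.pow 2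
      simpa using this
    · filter_upwards [hm] with s hs i
      rw [Real.norm_of_nonneg (by positivity), norm_mul, mul_pow]
      gcongr
      exact (norm_sub_le _ _).trans (add_le_add (hs i) (hm₀ i))
  rw [tsum_zero] at h2
  have h3 : Tendsto (fun s => √(∑' i, ‖(m s i - m₀ i) * b.repr x i‖ ^ 2)) l (𝓝 0) := by
    simpa using h2.sqrt
  refine h3.congr' ?_
  filter_upwards [hm] with s hs
  rw [← Real.sqrt_sq (norm_nonneg (diagOp b (m s) x - diagOp b m₀ x)),
    ← (hasSum_norm_repr_sq b _).tsum_eq]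
  congr 1
  refine tsum_congr fun i => ?_
  rw [map_sub, lp.coeFn_sub, Pi.sub_apply, repr_diagOp b ⟨C, hs⟩, repr_diagOp b ⟨C, hm₀⟩, sub_mul]

theorem isCompactOperator_rankOne [CompleteSpace H] (x y : H) :
    IsCompactOperator (InnerProductSpace.rankOne ℂ x y) := by
  rw [InnerProductSpace.rankOne_def', ContinuousLinearMap.coe_comp]
  exact (isCompactOperator_of_locallyCompactSpace_dom (innerSL ℂ y)).clm_comp _

theorem diagOp_indicator (b : HilbertBasis ι ℂ H) (m : ι → ℂ) (s : Finset ι) [DecidableEq ι] :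
    diagOp b (fun i => if i ∈ s then m i else 0)
      = ∑ i ∈ s, m i • InnerProductSpace.rankOne ℂ (b i) (b i) := by
  have hb : BddSeq fun i => if i ∈ s then m i else 0 := by
    refine ⟨∑ i ∈ s, ‖m i‖, fun i => ?_⟩
    dsimp only
    split_ifs with h
    · exact Finset.single_le_sum (f := fun i => ‖m i‖) (fun _ _ => norm_nonneg _) h
    · simpa using Finset.sum_nonneg fun i _ => norm_nonneg (m i)
  refine ext_basis b fun j => ?_
  rw [diagOp_basis b hb, sum_apply]
  simp only [smul_apply, InnerProductSpace.rankOne_apply,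
    orthonormal_iff_ite.1 b.orthonormal]
  simp [ite_smul, smul_ite]

/-- The truncations to finite sets of indices have finite rank, and the norm of the remainder is at
most the supremum of `|m|` off the set, which is small. -/
theorem isCompactOperator_diagOp [CompleteSpace H] (b : HilbertBasis ι ℂ H) {m : ι → ℂ}
    (hm : Tendsto m cofinite (𝓝 0)) : IsCompactOperator (diagOp b m) := by
  classical
  have hbdd : BddSeq m := by
    have h1 : ∀ᶠ i in cofinite, ‖m i‖ < 1 := by
      simpa using (hm.norm.eventually (gt_mem_nhds (by simp : ‖(0 : ℂ)‖ < 1)))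
    have hfin := eventually_cofinite.1 h1
    refine ⟨∑ i ∈ hfin.toFinset, ‖m i‖ + 1, fun i => ?_⟩
    by_cases h : i ∈ hfin.toFinset
    · have := Finset.single_le_sum (f := fun i => ‖m i‖) (fun _ _ => norm_nonneg _) h
      linarith
    · have h0 : ‖m i‖ < 1 := by simpa using h
      have := Finset.sum_nonneg (s := hfin.toFinset) fun i _ => norm_nonneg (m i)
      linarith
  have hlim : Tendsto (fun s : Finset ι => diagOp b fun i => if i ∈ s then m i else 0) atTop
      (𝓝 (diagOp b m)) := by
    rw [Metric.tendsto_nhds]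
    intro ε hε
    have h1 : ∀ᶠ i in cofinite, ‖m i‖ < ε / 2 := by
      simpa using (hm.norm.eventually (gt_mem_nhds (by simpa using half_pos hε)))
    have hfin := eventually_cofinite.1 h1
    filter_upwards [eventually_ge_atTop hfin.toFinset] with s hs
    have hb' : BddSeq fun i => if i ∈ s then m i else 0 := by
      obtain ⟨C, hC⟩ := hbdd
      refine ⟨C, fun i => ?_⟩
      dsimp only
      split_ifs
      · exact hC i
      · simpa using (norm_nonneg _).trans (hC i)
    rw [dist_eq_norm, diagOp_sub b hb' hbdd]
    refine (norm_diagOp_le b (half_pos hε).le fun i => ?_).trans_lt (half_lt_self hε)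
    split_ifs with h
    · simpa using (half_pos hε).le
    · have : i ∉ hfin.toFinset := fun h' => h (hs h')
      have h0 : ‖m i‖ < ε / 2 := by simpa using this
      simpa using h0.le
  refine isCompactOperator_of_tendsto hlim (Eventually.of_forall fun s => ?_)
  rw [diagOp_indicator]
  have : ∀ i ∈ s, m i • InnerProductSpace.rankOne ℂ (b i) (b i)
      ∈ compactOperator (RingHom.id ℂ) H H := fun i _ =>
    Submodule.smul_mem _ _ (isCompactOperator_rankOne _ _)
  exact Submodule.sum_mem _ this

/-- Hilbert bases of the members of an orthogonal family of closed subspaces with dense span form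
a Hilbert basis of the whole space. -/
theorem exists_adapted_hilbertBasis {H : Type u} [NormedAddCommGroup H] [InnerProductSpace ℂ H]
    [CompleteSpace H] {κ : Type v} (V : κ → Submodule ℂ H)
    [∀ k, CompleteSpace (V k)] (hV : OrthogonalFamily ℂ (fun k => V k) fun k => (V k).subtypeₗᵢ)
    (hbot : (⨆ k, V k)ᗮ = ⊥) :
    ∃ (ι : Type (max u v)) (b : HilbertBasis ι ℂ H) (k : ι → κ), ∀ i, b i ∈ V (k i) := by
  choose w c hc using fun k => exists_hilbertBasis ℂ (V k)
  let v : (Σ k, w k) → H := fun p => (c p.1 p.2 : H)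
  have hv : Orthonormal ℂ v :=
    hV.orthonormal_sigma_orthonormal (v_family := fun k (a : w k) => c k a)
      fun k => (c k).orthonormal
  have hspan : (Submodule.span ℂ (range v))ᗮ = ⊥ := by
    -- A span and its closure have the same orthogonal complement, so it suffices that the closure
    -- contains every `V k`.
    rw [eq_bot_iff, ← hbot, ← Submodule.orthogonal_closure (Submodule.span ℂ (range v))]
    refine Submodule.orthogonal_le (iSup_le fun k x hx => ?_)
    have hx' : (⟨x, hx⟩ : V k) ∈ (Submodule.span ℂ (range (c k))).topologicalClosure := by
      rw [(c k).dense_span]; trivial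
    have h2 := image_closure_subset_closure_image (f := ((↑) : V k → H)) continuous_subtype_val
      (mem_image_of_mem _ hx')
    refine closure_mono ?_ h2
    rintro _ ⟨y, hy, rfl⟩
    have h3 : (y : H) ∈ (Submodule.span ℂ (range (c k))).map (V k).subtype := ⟨y, hy, rfl⟩
    rw [Submodule.map_span] at h3
    refine Submodule.span_mono ?_ h3
    rintro _ ⟨_, ⟨a, rfl⟩, rfl⟩
    exact ⟨⟨k, a⟩, rfl⟩
  refine ⟨_, HilbertBasis.mkOfOrthogonalEqBot hv hspan, fun p => p.1, fun p => ?_⟩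
  rw [HilbertBasis.coe_mkOfOrthogonalEqBot]
  exact (c p.1 p.2).2

/-- A compact self-adjoint operator has a Hilbert basis of eigenvectors. -/
theorem exists_eigenbasis {H : Type u} [NormedAddCommGroup H] [InnerProductSpace ℂ H]
    [CompleteSpace H] {T : H →L[ℂ] H} (hT : IsCompactOperator T)
    (hT' : (T : H →ₗ[ℂ] H).IsSymmetric) :
    ∃ (ι : Type u) (b : HilbertBasis ι ℂ H) (μ : ι → ℝ), ∀ i, T (b i) = (μ i : ℂ) • b i := by
  have hcomp : ∀ μ : ℂ, CompleteSpace (Module.End.eigenspace (T : H →ₗ[ℂ] H) μ) := fun μ => by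
    suffices h : IsClosed ((Module.End.eigenspace (T : H →ₗ[ℂ] H) μ : Submodule ℂ H) : Set H) from
      h.completeSpace_coe
    have : ((Module.End.eigenspace (T : H →ₗ[ℂ] H) μ : Submodule ℂ H) : Set H)
        = {x | T x = μ • x} := by
      ext x
      exact Module.End.mem_eigenspace_iff
    rw [this]
    exact isClosed_eq T.continuous (continuous_const_smul μ)
  obtain ⟨ι, b, k, hb⟩ := exists_adapted_hilbertBasis _ hT'.orthogonalFamily_eigenspaces
    (T.orthogonalComplement_iSup_eigenspaces_eq_bot hT hT')
  refine ⟨ι, b, fun i => (k i).re, fun i => ?_⟩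
  have h1 : T (b i) = k i • b i := Module.End.mem_eigenspace_iff.1 (hb i)
  have h2 : (starRingEnd ℂ) (k i) = k i :=
    hT'.conj_eigenvalue_eq_self (Module.End.hasEigenvalue_of_hasEigenvector
      ⟨hb i, b.orthonormal.ne_zero i⟩)
  rw [h1, Complex.conj_eq_iff_re.1 h2]

end Diagonal

/-! ### Semigroups which are diagonal in a Hilbert basis -/

section DiagonalSemigroup

variable {ι : Type*} {H : Type*} [NormedAddCommGroup H] [InnerProductSpace ℂ H]

/-- The operator `exp (-z L)`, where `L` multiplies the coordinates by `l`. -/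
def diagExp (b : HilbertBasis ι ℂ H) (l : ι → ℝ) (z : ℂ) : H →L[ℂ] H :=
  diagOp b fun i => Complex.exp (-(l i * z))

theorem norm_exp_neg_mul (x : ℝ) (z : ℂ) : ‖Complex.exp (-(x * z))‖ = Real.exp (-(x * z.re)) := by
  rw [Complex.norm_exp]; simp

theorem norm_exp_neg_mul_le {x c : ℝ} (hx : -c ≤ x) {z : ℂ} (hz : 0 ≤ z.re) :
    ‖Complex.exp (-(x * z))‖ ≤ Real.exp (c * z.re) := by
  rw [norm_exp_neg_mul, Real.exp_le_exp]
  nlinarith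

variable (b : HilbertBasis ι ℂ H) {l : ι → ℝ} {c : ℝ}

theorem bddSeq_exp (hl : ∀ i, -c ≤ l i) {z : ℂ} (hz : 0 ≤ z.re) :
    BddSeq fun i => Complex.exp (-(l i * z)) :=
  ⟨_, fun i => norm_exp_neg_mul_le (hl i) hz⟩

theorem norm_diagExp_le (hl : ∀ i, -c ≤ l i) {z : ℂ} (hz : 0 ≤ z.re) :
    ‖diagExp b l z‖ ≤ Real.exp (c * z.re) :=
  norm_diagOp_le b (Real.exp_pos _).le fun i => norm_exp_neg_mul_le (hl i) hz

theorem diagExp_add (hl : ∀ i, -c ≤ l i) {z w : ℂ} (hz : 0 ≤ z.re) (hw : 0 ≤ w.re) :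
    diagExp b l (z + w) = diagExp b l z * diagExp b l w := by
  rw [diagExp, diagExp, diagExp, diagOp_mul b (bddSeq_exp hl hz) (bddSeq_exp hl hw)]
  congr 1
  funext i
  rw [← Complex.exp_add]
  ring_nf

theorem diagExp_zero : diagExp b l 0 = 1 := by
  simp [diagExp, diagOp_one]

/-- The point is uniformity in `x`. After factoring out `exp (-x z)`, the Taylor remainder costs `x²
exp (|x| Re z / 2)`. For `x ≥ 0` half of the decay of `exp (-x Re z)` is still available, and `y² /
2 ≤ exp y` at `y = x Re z / 2` gives the constant `8 / (Re z)²`. For `x ≤ 0` there is the bound `|x|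
≤ |c|`. -/
theorem norm_exp_taylor_le {x c : ℝ} (hx : -c ≤ x) {z h : ℂ} (hz : 0 < z.re)
    (hh : ‖h‖ ≤ z.re / 2) :
    ‖Complex.exp (-(x * (z + h))) - Complex.exp (-(x * z)) - h * (-x * Complex.exp (-(x * z)))‖
      ≤ (8 / z.re ^ 2 + c ^ 2 * Real.exp (3 * |c| * z.re / 2)) * ‖h‖ ^ 2 := by
  have e : Complex.exp (-(x * (z + h))) - Complex.exp (-(x * z))
      - h * (-x * Complex.exp (-(x * z)))
      = Complex.exp (-(x * z)) * (Complex.exp (-(x * h)) - (1 + -(x * h))) := by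
    rw [mul_add, neg_add, Complex.exp_add]; ring
  have h1 := Complex.norm_exp_sub_sum_le_norm_mul_exp (-(x * h)) 2
  simp only [Finset.sum_range_succ, Finset.sum_range_zero, pow_zero, Nat.factorial, Nat.cast_one,
    div_one, zero_add, pow_one, norm_neg, norm_mul, Complex.norm_real, Real.norm_eq_abs,
    mul_one] at h1
  rw [e, norm_mul, norm_exp_neg_mul]
  have h2 : Real.exp (|x| * ‖h‖) ≤ Real.exp (|x| * (z.re / 2)) := by gcongr
  have h3 : Real.exp (-(x * z.re)) * x ^ 2 * Real.exp (|x| * (z.re / 2))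
      ≤ 8 / z.re ^ 2 + c ^ 2 * Real.exp (3 * |c| * z.re / 2) := by
    rw [mul_right_comm, ← Real.exp_add]
    rcases le_total 0 x with h0 | h0
    · rw [abs_of_nonneg h0]
      have h4 := Real.pow_div_factorial_le_exp (x := x * (z.re / 2)) (by positivity) 2
      have h5 : Real.exp (-(x * z.re) + x * (z.re / 2)) * x ^ 2 ≤ 8 / z.re ^ 2 := by
        rw [show -(x * z.re) + x * (z.re / 2) = -(x * (z.re / 2)) by ring, Real.exp_neg,
          inv_mul_le_iff₀ (Real.exp_pos _), mul_div_assoc', le_div_iff₀ (by positivity)]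
        simp only [Nat.factorial] at h4
        norm_num at h4
        nlinarith
      have h6 : 0 ≤ c ^ 2 * Real.exp (3 * |c| * z.re / 2) := by positivity
      linarith
    · have h4 : |x| ≤ |c| := by
        rw [abs_of_nonpos h0]; exact (by linarith : -x ≤ c).trans (le_abs_self c)
      have h5 : x ^ 2 ≤ c ^ 2 := sq_le_sq.2 h4
      have h6 : Real.exp (-(x * z.re) + |x| * (z.re / 2)) ≤ Real.exp (3 * |c| * z.re / 2) := by
        rw [Real.exp_le_exp]
        nlinarith [abs_of_nonpos h0]
      have h7 : 0 ≤ 8 / z.re ^ 2 := by positivity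
      rw [mul_comm]
      have := mul_le_mul h5 h6 (Real.exp_pos _).le (sq_nonneg c)
      linarith
  calc Real.exp (-(x * z.re)) * ‖Complex.exp (-(x * h)) - (1 + -(x * h))‖
      ≤ Real.exp (-(x * z.re)) * ((|x| * ‖h‖) ^ 2 * Real.exp (|x| * (z.re / 2))) := by
        gcongr
        exact h1.trans (by gcongr)
    _ = Real.exp (-(x * z.re)) * x ^ 2 * Real.exp (|x| * (z.re / 2)) * ‖h‖ ^ 2 := by
        rw [mul_pow, sq_abs]; ring
    _ ≤ _ := by gcongr

theorem bddSeq_mul_exp (hl : ∀ i, -c ≤ l i) {z : ℂ} (hz : 0 < z.re) :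
    BddSeq fun i => -(l i : ℂ) * Complex.exp (-(l i * z)) := by
  refine ⟨2 / z.re + |c| * Real.exp (|c| * z.re), fun i => ?_⟩
  rw [norm_mul, norm_exp_neg_mul, norm_neg, Complex.norm_real, Real.norm_eq_abs]
  rcases le_total 0 (l i) with h0 | h0
  · have h1 := Real.add_one_le_exp (l i * z.re)
    have h2 : |l i| * Real.exp (-(l i * z.re)) ≤ 2 / z.re := by
      rw [abs_of_nonneg h0, Real.exp_neg, mul_inv_le_iff₀ (Real.exp_pos _), div_mul_eq_mul_div,
        le_div_iff₀ hz]
      nlinarith [Real.exp_pos (l i * z.re)]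
    have : 0 ≤ |c| * Real.exp (|c| * z.re) := by positivity
    linarith
  · have h4 : |l i| ≤ |c| := by
      rw [abs_of_nonpos h0]
      exact (by linarith [hl i] : -l i ≤ c).trans (le_abs_self c)
    have h5 : Real.exp (-(l i * z.re)) ≤ Real.exp (|c| * z.re) := by
      rw [Real.exp_le_exp]
      nlinarith [abs_of_nonpos h0]
    have h7 : 0 ≤ 2 / z.re := by positivity
    have := mul_le_mul h4 h5 (Real.exp_pos _).le (abs_nonneg c)
    linarith

/-- The scalar remainder is `O(|h|²)` uniformly in the coordinate, so the derivative exists in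
operator norm. -/
theorem hasDerivAt_diagExp (hl : ∀ i, -c ≤ l i) {z : ℂ} (hz : 0 < z.re) :
    HasDerivAt (diagExp b l) (diagOp b fun i => -(l i : ℂ) * Complex.exp (-(l i * z))) z := by
  rw [hasDerivAt_iff_isLittleO_nhds_zero]
  refine Asymptotics.IsBigO.trans_isLittleO (g := fun h : ℂ => h ^ 2) ?_ ?_
  · refine Asymptotics.IsBigO.of_bound
      (8 / z.re ^ 2 + c ^ 2 * Real.exp (3 * |c| * z.re / 2)) ?_
    filter_upwards [Metric.closedBall_mem_nhds (0 : ℂ) (half_pos hz)] with h hh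
    have hh' : ‖h‖ ≤ z.re / 2 := by simpa using hh
    have hre : 0 ≤ (z + h).re := by
      have := (abs_le.1 ((Complex.abs_re_le_norm h).trans hh')).1
      rw [Complex.add_re]
      linarith
    rw [diagExp, diagExp, diagOp_sub b (bddSeq_exp hl hre) (bddSeq_exp hl hz.le),
      diagOp_smul b (bddSeq_mul_exp hl hz), diagOp_sub b
        ((bddSeq_exp hl hre).sub (bddSeq_exp hl hz.le)) ((bddSeq_mul_exp hl hz).const_mul h),
      norm_pow]
    refine norm_diagOp_le b (by positivity) fun i => ?_
    exact norm_exp_taylor_le (hl i) hz hh'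
  · exact Asymptotics.isLittleO_pow_id one_lt_two

theorem re_pos_of_mem_sector {z : ℂ} (hz : z ∈ sector (Real.pi / 2)) : 0 < z.re :=
  (Complex.abs_arg_lt_pi_div_two_iff.1 hz.2).resolve_right hz.1

theorem tendsto_diagExp (hl : ∀ i, -c ≤ l i) {z₀ : ℂ} {s : Set ℂ}
    (hs : ∀ z ∈ s, 0 ≤ z.re) (hz₀ : 0 ≤ z₀.re) (x : H) :
    Tendsto (fun z => diagExp b l z x) (𝓝[s] z₀) (𝓝 (diagExp b l z₀ x)) := by
  -- Replacing `c` by `|c|` makes the bound increasing in the real part, so one constant serves all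
  -- points with real part below `Re z₀ + 1`.
  refine tendsto_diagOp b (C := Real.exp (|c| * (z₀.re + 1))) ?_ (fun i => ?_) (fun i => ?_) x
  · have h1 : ∀ᶠ z : ℂ in 𝓝[s] z₀, z.re < z₀.re + 1 :=
      (Complex.continuous_re.tendsto z₀).mono_left nhdsWithin_le_nhds
        |>.eventually (gt_mem_nhds (lt_add_one _))
    filter_upwards [h1, self_mem_nhdsWithin] with z hz hzs i
    refine (norm_exp_neg_mul_le (c := |c|)
      ((neg_le_neg (le_abs_self c)).trans (hl i)) (hs z hzs)).trans ?_
    gcongr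
  · refine (norm_exp_neg_mul_le (c := |c|)
      ((neg_le_neg (le_abs_self c)).trans (hl i)) hz₀).trans ?_
    gcongr
    linarith
  · have : Continuous fun z : ℂ => Complex.exp (-(l i * z)) := by fun_prop
    exact (this.tendsto z₀).mono_left nhdsWithin_le_nhds

/-- The semigroup `exp (-t L)`, where `L` multiplies the coordinates by `l`. -/
def diagSemigroup (b : HilbertBasis ι ℂ H) (l : ι → ℝ) (t : ℝ) : H →L[ℂ] H := diagExp b l t

theorem isAnalyticSemigroup_diagSemigroup (hl : ∀ i, -c ≤ l i) :
    IsAnalyticSemigroup (diagSemigroup b l) where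
  zero := by rw [diagSemigroup, Complex.ofReal_zero, diagExp_zero]
  add s t hs ht := by
    rw [diagSemigroup, Complex.ofReal_add]
    exact diagExp_add b hl (by simpa using hs) (by simpa using ht)
  cont x t ht := by
    have h1 := tendsto_diagExp b hl (s := {z | 0 ≤ z.re}) (fun _ h => h)
      (z₀ := (t : ℂ)) (by simpa using ht) x
    refine h1.comp (tendsto_nhdsWithin_iff.2 ⟨?_, ?_⟩)
    · exact (Complex.continuous_ofReal.tendsto t).mono_left nhdsWithin_le_nhds
    · filter_upwards [self_mem_nhdsWithin] with s hs
      simpa using hs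
  exists_extension := by
    -- The spectrum is real and bounded below, so the whole right half-plane is available.
    refine ⟨Real.pi / 2, by positivity, le_rfl, diagExp b l, fun t _ => rfl, fun z hz => ?_,
      fun z hz w hw => ?_, fun x => ?_⟩
    · exact (hasDerivAt_diagExp b hl (re_pos_of_mem_sector hz)).differentiableAt
        |>.differentiableWithinAt
    · exact diagExp_add b hl (re_pos_of_mem_sector hz).le (re_pos_of_mem_sector hw).le
    · have := tendsto_diagExp b hl (s := sector (Real.pi / 2))
        (fun z hz => (re_pos_of_mem_sector hz).le) (z₀ := 0) le_rfl x
      simpa [diagExp_zero] using this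

theorem abs_exp_neg_sub_one_le {x c t : ℝ} (hx : -c ≤ x) (ht : 0 ≤ t) (ht' : t ≤ 1) :
    |Real.exp (-(x * t)) - 1| ≤ |x| * t * Real.exp |c| := by
  have h1 : (1 : ℝ) ≤ Real.exp |c| := Real.one_le_exp (abs_nonneg c)
  rcases le_total 0 x with h0 | h0
  · have h2 := Real.add_one_le_exp (-(x * t))
    have h3 : Real.exp (-(x * t)) ≤ 1 := Real.exp_le_one_iff.2 (by nlinarith)
    rw [abs_of_nonpos (by linarith), abs_of_nonneg h0]
    nlinarith [mul_nonneg h0 ht]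
  · have h2 := Real.add_one_le_exp (x * t)
    have h3 : 1 ≤ Real.exp (-(x * t)) := Real.one_le_exp (by nlinarith)
    have h4 : Real.exp (-(x * t)) ≤ Real.exp |c| := by
      rw [Real.exp_le_exp]
      nlinarith [le_abs_self c, abs_nonneg c]
    rw [abs_of_nonneg (by linarith), abs_of_nonpos h0]
    have h5 : Real.exp (-(x * t)) * Real.exp (x * t) = 1 := by
      rw [← Real.exp_add]; simp
    have h6 : 0 ≤ -x * t := by nlinarith
    nlinarith [mul_le_mul_of_nonneg_left h4 h6, Real.exp_pos (-(x * t))]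

/-- A limit of difference quotients can be read in each coordinate. Conversely, if `f` and `l f` are
both in the space, so is `x = (|l| + 1) f`. The difference quotients of `f` are then multipliers
applied to `x`, uniformly bounded for `t ≤ 1`, and pointwise convergence of these multipliers
suffices. -/
theorem generator_diagSemigroup (hl : ∀ i, -c ≤ l i) :
    generator (diagSemigroup b l)
      = {p | ∀ i, b.repr p.2 i = -(l i : ℂ) * b.repr p.1 i} := by
  have hrepr : ∀ (t : ℝ) (_ : 0 < t) (f : H) (i : ι),
      b.repr (t⁻¹ • (diagSemigroup b l t f - f)) i
        = (t⁻¹ * (Real.exp (-(l i * t)) - 1) : ℝ) * b.repr f i := by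
    intro t ht f i
    rw [RCLike.real_smul_eq_coe_smul (K := ℂ), map_smul, lp.coeFn_smul, Pi.smul_apply, map_sub,
      lp.coeFn_sub, Pi.sub_apply, diagSemigroup, diagExp,
      repr_diagOp b (bddSeq_exp hl (by simpa using ht.le))]
    simp
    ring
  ext ⟨f, g⟩
  simp only [generator, mem_ofPred_eq]
  constructor
  · intro h i
    have h1 : Tendsto (fun t : ℝ => b.repr (t⁻¹ • (diagSemigroup b l t f - f)) i) (𝓝[>] 0)
        (𝓝 (b.repr g i)) := by
      have hc : Continuous fun x : H => b.repr x i := by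
        simp only [HilbertBasis.repr_apply_apply]
        fun_prop
      exact (hc.tendsto g).comp h
    have h2 : Tendsto (fun t : ℝ => ((t⁻¹ * (Real.exp (-(l i * t)) - 1) : ℝ) : ℂ) * b.repr f i)
        (𝓝[>] 0) (𝓝 ((-(l i) : ℝ) * b.repr f i)) := by
      refine ((Complex.continuous_ofReal.tendsto _).comp ?_).mul_const _
      have hd : HasDerivAt (fun t : ℝ => Real.exp (-(l i * t))) (-(l i)) 0 := by
        have := ((hasDerivAt_id (0 : ℝ)).const_mul (l i)).neg.exp
        simpa using this
      have := hd.tendsto_slope_zero_right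
      simpa using this
    have h3 := tendsto_nhds_unique (h1.congr' ?_) h2
    · simpa using h3
    · filter_upwards [self_mem_nhdsWithin] with t ht
      exact hrepr t ht f i
  · intro h
    let w : ι → ℝ := fun i => |l i| + 1
    have hw : ∀ i, 0 < w i := fun i => by positivity
    have hmem : Memℓp (fun i => (w i : ℂ) * b.repr f i) 2 := by
      -- Since `g = -l f`, the product `|l| f` is `-g` where `l ≥ 0` and `g` elsewhere.
      have h1 := (lp.memℓp (b.repr f)).add (memℓp_mul (m := fun i => if 0 ≤ l i then -1 else 1)
        ⟨1, fun i => by dsimp only; split_ifs <;> simp⟩ (lp.memℓp (b.repr g)))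
      refine (congrArg (fun u : ι → ℂ => Memℓp u 2) (funext fun i => ?_)).mpr h1
      change _ = b.repr f i + (if 0 ≤ l i then -1 else 1) * b.repr g i
      simp only [h i, w]
      split_ifs with h0
      · rw [abs_of_nonneg h0]; push_cast; ring
      · rw [abs_of_neg (not_le.1 h0)]; push_cast; ring
    let x := vecOf b fun i => (w i : ℂ) * b.repr f i
    have hx : ∀ i, b.repr x i = (w i : ℂ) * b.repr f i := repr_vecOf b hmem
    have hlw : ∀ i, |l i| / w i ≤ 1 := fun i => by
      rw [div_le_one (hw i)]; simp [w]
    have hwC : ∀ i, (w i : ℂ) ≠ 0 := fun i => by exact_mod_cast (hw i).ne'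
    have hbd : ∀ t : ℝ, 0 < t → t ≤ 1 → ∀ i,
        ‖(((t⁻¹ * (Real.exp (-(l i * t)) - 1) / w i : ℝ)) : ℂ)‖ ≤ Real.exp |c| := by
      intro t ht ht1 i
      rw [Complex.norm_real, Real.norm_eq_abs, abs_div, abs_mul, abs_of_pos (hw i),
        abs_of_pos (inv_pos.2 ht), div_le_iff₀ (hw i), inv_mul_le_iff₀ ht]
      refine (abs_exp_neg_sub_one_le (hl i) ht.le ht1).trans ?_
      have h1 : |l i| ≤ w i := by simp [w]
      have h2 := mul_le_mul_of_nonneg_right h1 (mul_nonneg ht.le (Real.exp_pos |c|).le)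
      linarith
    have hbd0 : ∀ i, ‖((-(l i) / w i : ℝ) : ℂ)‖ ≤ Real.exp |c| := by
      intro i
      rw [Complex.norm_real, Real.norm_eq_abs, abs_div, abs_neg, abs_of_pos (hw i)]
      exact (hlw i).trans (Real.one_le_exp (abs_nonneg c))
    have key := tendsto_diagOp b (l := 𝓝[>] (0 : ℝ))
      (m := fun t i => (((t⁻¹ * (Real.exp (-(l i * t)) - 1) / w i : ℝ)) : ℂ))
      (m₀ := fun i => ((-(l i) / w i : ℝ) : ℂ)) (C := Real.exp |c|) ?_ hbd0 (fun i => ?_) x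
    · have e0 : diagOp b (fun i => ((-(l i) / w i : ℝ) : ℂ)) x = g := by
        refine ext_repr b fun i => ?_
        rw [repr_diagOp b ⟨_, hbd0⟩, hx, h i]
        push_cast
        field_simp [hwC i]
      rw [e0] at key
      refine key.congr' ?_
      filter_upwards [Ioo_mem_nhdsGT zero_lt_one] with t ht
      refine ext_repr b fun i => ?_
      rw [repr_diagOp b ⟨_, hbd t ht.1 ht.2.le⟩, hx, hrepr t ht.1]
      push_cast
      field_simp [hwC i]
    · filter_upwards [Ioo_mem_nhdsGT zero_lt_one] with t ht i
      exact hbd t ht.1 ht.2.le i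
    · refine (Complex.continuous_ofReal.tendsto _).comp ?_
      have hd : HasDerivAt (fun t : ℝ => Real.exp (-(l i * t))) (-(l i)) 0 := by
        have := ((hasDerivAt_id (0 : ℝ)).const_mul (l i)).neg.exp
        simpa using this
      have := hd.tendsto_slope_zero_right.div_const (w i)
      simpa using this

theorem isAdmissibleShift_diagSemigroup (hl : ∀ i, -c ≤ l i) :
    IsAdmissibleShift (diagSemigroup b l) (c + 1) := by
  refine ⟨1, 1, one_pos, fun t ht => ?_⟩
  have := norm_diagExp_le b hl (z := (t : ℂ)) (by simpa using ht)
  simpa [diagSemigroup] using this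

/-- Tested on a basis vector, the decay gives `exp ((δ - κ - l i) t) ≤ M` for all `t ≥ 0`, which
excludes a positive exponent. An arbitrary admissible shift thus puts the spectrum of `κ + L` in
`[δ, ∞)`. -/
theorem exists_gap_of_isAdmissibleShift (hl : ∀ i, -c ≤ l i) {κ : ℝ}
    (h : IsAdmissibleShift (diagSemigroup b l) κ) : ∃ δ : ℝ, 0 < δ ∧ ∀ i, δ ≤ κ + l i := by
  obtain ⟨M, δ, hδ, hM⟩ := h
  refine ⟨δ, hδ, fun i => ?_⟩
  by_contra! hlt
  have h1 : ∀ t : ℝ, 0 ≤ t → Real.exp ((δ - κ - l i) * t) ≤ M := by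
    intro t ht
    have h2 := (diagSemigroup b l t).le_opNorm (b i)
    rw [diagSemigroup, diagExp, diagOp_basis b (bddSeq_exp hl (by simpa using ht)), norm_smul,
      b.orthonormal.1 i, mul_one, mul_one, norm_exp_neg_mul, Complex.ofReal_re] at h2
    have h3 := h2.trans (hM t ht)
    rw [← mul_inv_le_iff₀ (Real.exp_pos _), ← Real.exp_neg, ← Real.exp_add] at h3
    rwa [show (δ - κ - l i) * t = -(l i * t) + -((κ - δ) * t) by ring]
  have h2 : Tendsto (fun t : ℝ => Real.exp ((δ - κ - l i) * t)) atTop atTop :=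
    Real.tendsto_exp_atTop.comp (tendsto_id.const_mul_atTop (by linarith))
  obtain ⟨t, ht, ht'⟩ := ((h2.eventually (eventually_gt_atTop M)).and
    (eventually_ge_atTop 0)).exists
  exact absurd (h1 t ht') (not_le.2 ht)

theorem bddSeq_rpow_neg {δ : ℝ} (hδ : 0 < δ) {w : ι → ℝ} (hw : ∀ i, δ ≤ w i) {α : ℝ}
    (hα : 0 ≤ α) : BddSeq fun i => ((w i ^ (-α) : ℝ) : ℂ) := by
  refine ⟨δ ^ (-α), fun i => ?_⟩
  rw [Complex.norm_real, Real.norm_of_nonneg (Real.rpow_nonneg (hδ.le.trans (hw i)) _)]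
  exact Real.rpow_le_rpow_of_nonpos hδ (hw i) (by linarith)

/-- On a basis vector the integral is Euler's Gamma integral. Evaluation at a vector passes through
the operator-valued integral because that integral converges in norm. -/
theorem negPow_diagSemigroup [CompleteSpace H] (hl : ∀ i, -c ≤ l i) {κ δ : ℝ} (hδ : 0 < δ)
    (hκ : ∀ i, δ ≤ κ + l i) {α : ℝ} (hα : 0 ≤ α) :
    negPow (diagSemigroup b l) κ α = diagOp b fun i => (((κ + l i) ^ (-α) : ℝ) : ℂ) := by
  rcases hα.eq_or_lt with rfl | hα'
  · rw [negPow, if_pos rfl]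
    simp [diagOp_one]
  rw [negPow, if_neg hα'.ne']
  -- Norm continuity may fail at `0`; away from `0` it follows from differentiability and is enough
  -- for measurability of the integrand.
  have hcont : ContinuousOn (diagSemigroup b l) (Ioi 0) := by
    intro t ht
    have h1 := (hasDerivAt_diagExp b hl (z := (t : ℂ)) (by simpa using ht)).continuousAt
    exact (ContinuousAt.comp (f := fun t : ℝ => (t : ℂ)) h1
      Complex.continuous_ofReal.continuousAt).continuousWithinAt
  have hint : IntegrableOn
      (fun t : ℝ => (t ^ (α - 1) * Real.exp (-(κ * t))) • diagSemigroup b l t) (Ioi 0) := by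
    have h1 := integrableOn_rpow_mul_exp_neg_mul_rpow (s := α - 1) (p := 1) (b := δ)
      (by linarith) one_pos hδ
    refine Integrable.mono' h1 ?_ ?_
    · refine ContinuousOn.aestronglyMeasurable ?_ measurableSet_Ioi
      have h2 : Continuous fun t : ℝ => Real.exp (-(κ * t)) := by fun_prop
      refine ContinuousOn.smul (ContinuousOn.mul ?_ h2.continuousOn) hcont
      exact continuousOn_id.rpow_const fun t ht => Or.inl (ne_of_gt ht)
    · refine (ae_restrict_iff' measurableSet_Ioi).2 (ae_of_all _ fun t ht => ?_)
      have ht0 : (0 : ℝ) < t := ht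
      have h2 := norm_diagExp_le b (l := l) (c := κ - δ) (fun i => by linarith [hκ i]) (z := (t : ℂ))
        (by simpa using ht0.le)
      rw [Complex.ofReal_re] at h2
      rw [norm_smul, Real.norm_of_nonneg (by positivity), mul_assoc, Real.rpow_one]
      refine mul_le_mul_of_nonneg_left ?_ (by positivity)
      refine (mul_le_mul_of_nonneg_left h2 (Real.exp_pos _).le).trans_eq ?_
      rw [← Real.exp_add]
      ring_nf
  refine ext_basis b fun i => ?_
  have hw : 0 < κ + l i := hδ.trans_le (hκ i)
  rw [smul_apply, ContinuousLinearMap.integral_apply hint,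
    diagOp_basis b (bddSeq_rpow_neg hδ hκ hα)]
  have h1 : ∀ t ∈ Ioi (0 : ℝ), ((t ^ (α - 1) * Real.exp (-(κ * t))) • diagSemigroup b l t) (b i)
      = (t ^ (α - 1) * Real.exp (-((κ + l i) * t))) • b i := by
    intro t ht
    have ht0 : (0 : ℝ) < t := ht
    rw [smul_apply, diagSemigroup, diagExp,
      diagOp_basis b (bddSeq_exp hl (by simpa using ht0.le))]
    have : Complex.exp (-(l i * (t : ℂ))) = (Real.exp (-(l i * t)) : ℝ) := by push_cast; rfl
    rw [this, Complex.coe_smul, smul_smul, mul_assoc, ← Real.exp_add]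
    ring_nf
  rw [setIntegral_congr_fun measurableSet_Ioi h1, integral_smul_const,
    Real.integral_rpow_mul_exp_neg_mul_Ioi hα' hw, smul_smul, Complex.coe_smul]
  congr 1
  rw [mul_comm, mul_assoc, mul_inv_cancel₀ (Real.Gamma_pos_of_pos hα').ne', mul_one,
    Real.rpow_neg hw.le, one_div, Real.inv_rpow hw.le]

end DiagonalSemigroup

/-! ### The fourth order operator with a singular perturbation of rank two, in sine coordinates -/

section Sequences

theorem memℓp_of_norm_le {ι : Type*} {u v : ι → ℂ} {C : ℝ} (hv : Memℓp v 2)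
    (h : ∀ i, ‖u i‖ ≤ C * ‖v i‖) : Memℓp u 2 := by
  rw [memℓp_two_iff] at hv ⊢
  refine Summable.of_nonneg_of_le (fun i => by positivity) (fun i => ?_) (hv.mul_left (C ^ 2))
  rw [← mul_pow]
  exact pow_le_pow_left₀ (norm_nonneg _) (h i) 2

theorem summable_succ_rpow {s : ℝ} (hs : s < -1) : Summable fun k : ℕ => ((k : ℝ) + 1) ^ s := by
  have := (summable_nat_add_iff 1).2 (Real.summable_nat_rpow.2 hs)
  simpa using this

theorem memℓp_succ_rpow {s : ℝ} (hs : s < -(1 / 2)) :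
    Memℓp (fun k : ℕ => ((((k : ℝ) + 1) ^ s : ℝ) : ℂ)) 2 := by
  rw [memℓp_two_iff]
  refine (summable_succ_rpow (s := 2 * s) (by linarith)).congr fun k => ?_
  have : (0 : ℝ) < (k : ℝ) + 1 := by positivity
  rw [Complex.norm_real, Real.norm_of_nonneg (by positivity), ← Real.rpow_natCast,
    ← Real.rpow_mul this.le, mul_comm]
  norm_num

theorem summable_mul_of_memℓp {ι : Type*} {u v : ι → ℂ} (hu : Memℓp u 2) (hv : Memℓp v 2) :
    Summable fun i => u i * v i := by
  rw [memℓp_two_iff] at hu hv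
  refine Summable.of_norm_bounded (hu.add hv) fun i => ?_
  rw [norm_mul]
  nlinarith [sq_nonneg (‖u i‖ - ‖v i‖), sq_nonneg (‖u i‖), sq_nonneg (‖v i‖)]

end Sequences

/-! ### Krein's resolvent formula for the rank two perturbation -/

section Krein

/-- The eigenvalues of the square of the Dirichlet Laplacian. -/
def biEig (k : ℕ) : ℝ := ((k : ℝ) + 1) ^ 4

/-- The frequencies of parity `i`. -/
def parFreq (i : Fin 2) (k : ℕ) : ℝ := if k % 2 = (i : ℕ) then (k : ℝ) + 1 else 0

theorem one_le_biEig (k : ℕ) : 1 ≤ biEig k :=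
  one_le_pow₀ (by linarith [Nat.cast_nonneg (α := ℝ) k])

theorem biEig_pos (k : ℕ) : 0 < biEig k := zero_lt_one.trans_le (one_le_biEig k)

theorem biEig_eq_rpow (k : ℕ) : biEig k = ((k : ℝ) + 1) ^ (4 : ℝ) := by
  rw [biEig, ← Real.rpow_natCast]
  norm_num

theorem parFreq_nonneg (i : Fin 2) (k : ℕ) : 0 ≤ parFreq i k := by
  rw [parFreq]; split_ifs <;> positivity

theorem parFreq_le (i : Fin 2) (k : ℕ) : parFreq i k ≤ (k : ℝ) + 1 := by
  rw [parFreq]; split_ifs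
  · exact le_rfl
  · positivity

/-- The disjoint supports decouple the two rank one terms: the two by two matrix of Krein's formula
is diagonal. The parity is that of the index `k`, so `i = 0` collects the odd frequencies `k + 1`.
-/
theorem parFreq_mul_of_ne {i j : Fin 2} (h : i ≠ j) (k : ℕ) : parFreq i k * parFreq j k = 0 := by
  rw [parFreq, parFreq]
  split_ifs with h1 h2
  · exact absurd (Fin.ext (h1.symm.trans h2)) h
  all_goals simp

theorem parFreq_mul_sum (i : Fin 2) (k : ℕ) (s : Fin 2 → ℂ) :
    (parFreq i k : ℂ) * ∑ j, (parFreq j k : ℂ) * s j = (parFreq i k : ℂ) ^ 2 * s i := by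
  rw [Finset.mul_sum, Finset.sum_eq_single i]
  · ring
  · intro j _ hj
    rw [← mul_assoc, ← Complex.ofReal_mul, parFreq_mul_of_ne hj.symm]
    simp
  · simp

/-- `∑ p(k)² / (κ + d(k))`, for the frequencies `p` of parity `i`. -/
def kreinSum (κ : ℝ) (i : Fin 2) : ℝ := ∑' k, parFreq i k ^ 2 / (κ + biEig k)

theorem kreinTerm_le {κ : ℝ} (hκ : 0 ≤ κ) (i : Fin 2) (k : ℕ) :
    parFreq i k ^ 2 / (κ + biEig k) ≤ ((k : ℝ) + 1) ^ (-2 : ℝ) := by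
  have h0 : (0 : ℝ) < (k : ℝ) + 1 := by positivity
  rw [div_le_iff₀ (add_pos_of_nonneg_of_pos hκ (biEig_pos k)), Real.rpow_neg h0.le, Real.rpow_two,
    ← div_eq_inv_mul, le_div_iff₀ (by positivity)]
  have h1 := pow_le_pow_left₀ (parFreq_nonneg i k) (parFreq_le i k) 2
  have h2 : biEig k = ((k : ℝ) + 1) ^ 2 * ((k : ℝ) + 1) ^ 2 := by rw [biEig]; ring
  nlinarith [sq_nonneg ((k : ℝ) + 1)]

theorem kreinTerm_nonneg {κ : ℝ} (hκ : 0 ≤ κ) (i : Fin 2) (k : ℕ) :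
    0 ≤ parFreq i k ^ 2 / (κ + biEig k) :=
  div_nonneg (sq_nonneg _) (add_pos_of_nonneg_of_pos hκ (biEig_pos k)).le

theorem summable_kreinTerm {κ : ℝ} (hκ : 0 ≤ κ) (i : Fin 2) :
    Summable fun k => parFreq i k ^ 2 / (κ + biEig k) :=
  Summable.of_nonneg_of_le (kreinTerm_nonneg hκ i) (kreinTerm_le hκ i)
    (summable_succ_rpow (by norm_num))

/-- Each term tends to zero, and `(k + 1)^(-2)` dominates uniformly in `κ ≥ 0`. -/
theorem tendsto_kreinSum (i : Fin 2) : Tendsto (fun κ => kreinSum κ i) atTop (𝓝 0) := by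
  have h : Tendsto (fun κ => kreinSum κ i) atTop (𝓝 (∑' _ : ℕ, (0 : ℝ))) := by
    refine tendsto_tsum_of_dominated_convergence
      (summable_succ_rpow (s := -2) (by norm_num)) (fun k => ?_) ?_
    · exact (tendsto_atTop_add_const_right _ _ tendsto_id).const_div_atTop _
    · filter_upwards [eventually_ge_atTop 0] with κ hκ k
      rw [Real.norm_of_nonneg (kreinTerm_nonneg hκ i k)]
      exact kreinTerm_le hκ i k
  simpa using h

/-- This keeps the denominators `1 - β Qᵢ(κ)` at least `1/2` for all large `κ`, whatever the sign of
`β`. -/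
theorem exists_krein_bound (β : ℝ) :
    ∃ κ₀ : ℝ, 1 ≤ κ₀ ∧ ∀ κ, κ₀ ≤ κ → ∀ i, |β * kreinSum κ i| ≤ 1 / 2 := by
  have h : ∀ i, ∀ᶠ κ in atTop, |β * kreinSum κ i| ≤ 1 / 2 := fun i => by
    have := ((tendsto_kreinSum i).const_mul β).abs
    rw [mul_zero, abs_zero] at this
    exact this.eventually (ge_mem_nhds (by norm_num))
  obtain ⟨κ₀, h₀⟩ := eventually_atTop.1 (eventually_all.2 h)
  exact ⟨max 1 κ₀, le_max_left _ _, fun κ hκ => h₀ κ ((le_max_right _ _).trans hκ)⟩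

variable {H : Type*} [NormedAddCommGroup H] [InnerProductSpace ℂ H] (b : HilbertBasis ℕ ℂ H)

/-- The graph of the operator which in coordinates maps `f` to
`d(k) f(k) - β ∑ᵢ pᵢ(k) ∑ₘ pᵢ(m) f(m)`. -/
def opGraph (β : ℝ) : Set (H × H) :=
  {fg | (Summable fun k : ℕ => ((k : ℝ) + 1) * ‖b.repr fg.1 k‖) ∧
    ∀ k, b.repr fg.2 k = biEig k * b.repr fg.1 k
      - β * ∑ i, (parFreq i k : ℂ) * ∑' m, (parFreq i m : ℂ) * b.repr fg.1 m}

/-- The vector with coordinates `pᵢ(k) / (κ + d(k))`. -/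
def resVec (κ : ℝ) (i : Fin 2) : H :=
  vecOf b fun k => ((parFreq i k / (κ + biEig k) : ℝ) : ℂ)

/-- The coefficient of the rank one term in Krein's resolvent formula. -/
def kreinCoef (β κ : ℝ) (i : Fin 2) : ℝ := β / (1 - β * kreinSum κ i)

/-- Krein's formula for the resolvent of `opGraph`. -/
def kreinRes (β κ : ℝ) : H →L[ℂ] H :=
  diagOp b (fun k => (((κ + biEig k)⁻¹ : ℝ) : ℂ))
    + ∑ i, (kreinCoef β κ i : ℂ) • InnerProductSpace.rankOne ℂ (resVec b κ i) (resVec b κ i)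

theorem bddSeq_inv_add {ι : Type*} {w : ι → ℝ} {δ : ℝ} (hδ : 0 < δ) (hw : ∀ i, δ ≤ w i) :
    BddSeq fun i => (((w i)⁻¹ : ℝ) : ℂ) := by
  refine ⟨δ⁻¹, fun i => ?_⟩
  rw [Complex.norm_real, Real.norm_of_nonneg (inv_nonneg.2 (hδ.le.trans (hw i)))]
  exact inv_anti₀ hδ (hw i)

theorem bddSeq_res {κ : ℝ} (hκ : 0 ≤ κ) : BddSeq fun k => (((κ + biEig k)⁻¹ : ℝ) : ℂ) :=
  bddSeq_inv_add one_pos fun k => by linarith [one_le_biEig k]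

theorem memℓp_resVec {κ : ℝ} (hκ : 0 ≤ κ) (i : Fin 2) :
    Memℓp (fun k => ((parFreq i k / (κ + biEig k) : ℝ) : ℂ)) 2 := by
  refine memℓp_of_norm_le (C := 1) (memℓp_succ_rpow (s := -3) (by norm_num)) fun k => ?_
  have h0 : (0 : ℝ) < (k : ℝ) + 1 := by positivity
  have h1 : 0 < κ + biEig k := add_pos_of_nonneg_of_pos hκ (biEig_pos k)
  rw [Complex.norm_real, Complex.norm_real, Real.norm_of_nonneg
    (div_nonneg (parFreq_nonneg i k) h1.le), Real.norm_of_nonneg (by positivity), one_mul,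
    div_le_iff₀ h1, Real.rpow_neg h0.le, ← div_eq_inv_mul, le_div_iff₀ (by positivity)]
  have h2 : biEig k = ((k : ℝ) + 1) * ((k : ℝ) + 1) ^ (3 : ℝ) := by
    rw [biEig, show (3 : ℝ) = ((3 : ℕ) : ℝ) by norm_num, Real.rpow_natCast]; ring
  have h3 := mul_le_mul_of_nonneg_right (parFreq_le i k)
    (by positivity : 0 ≤ ((k : ℝ) + 1) ^ (3 : ℝ))
  linarith

theorem repr_resVec {κ : ℝ} (hκ : 0 ≤ κ) (i : Fin 2) (k : ℕ) :
    b.repr (resVec b κ i) k = ((parFreq i k / (κ + biEig k) : ℝ) : ℂ) :=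
  repr_vecOf b (memℓp_resVec hκ i) k

theorem hasSum_inner_resVec {κ : ℝ} (hκ : 0 ≤ κ) (i : Fin 2) (h : H) :
    HasSum (fun k => ((parFreq i k / (κ + biEig k) : ℝ) : ℂ) * b.repr h k)
      (inner ℂ (resVec b κ i) h) := by
  rw [inner_eq_tsum_repr b]
  have := (summable_repr_mul b (resVec b κ i) h).hasSum
  simpa only [repr_resVec b hκ, Complex.conj_ofReal] using this

theorem repr_kreinRes {β κ : ℝ} (hκ : 0 ≤ κ) (h : H) (k : ℕ) :
    b.repr (kreinRes b β κ h) k = (((κ + biEig k)⁻¹ : ℝ) : ℂ) * (b.repr h k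
      + ∑ i, (parFreq i k : ℂ) * (kreinCoef β κ i * inner ℂ (resVec b κ i) h)) := by
  rw [kreinRes, add_apply, map_add, lp.coeFn_add, Pi.add_apply, repr_diagOp b (bddSeq_res hκ),
    mul_add, sum_apply, map_sum, Fin.sum_univ_two, Fin.sum_univ_two, lp.coeFn_add, Pi.add_apply]
  simp only [smul_apply, InnerProductSpace.rankOne_apply, map_smul, lp.coeFn_smul, Pi.smul_apply,
    repr_resVec b hκ, smul_eq_mul]
  push_cast
  ring

theorem kreinCoef_mul {β κ : ℝ} {i : Fin 2} (h : |β * kreinSum κ i| ≤ 1 / 2) :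
    kreinCoef β κ i * (1 - β * kreinSum κ i) = β := by
  have : 1 - β * kreinSum κ i ≠ 0 := by have := (abs_le.1 h).2; linarith
  rw [kreinCoef, div_mul_cancel₀ _ this]

theorem abs_kreinCoef_le {β κ : ℝ} {i : Fin 2} (h : |β * kreinSum κ i| ≤ 1 / 2) :
    |kreinCoef β κ i| ≤ 2 * |β| := by
  have h1 : 1 / 2 ≤ 1 - β * kreinSum κ i := by have := (abs_le.1 h).2; linarith
  rw [kreinCoef, abs_div, abs_of_pos (a := 1 - β * kreinSum κ i) (by linarith),
    div_le_iff₀ (by linarith)]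
  nlinarith [abs_nonneg β]

/-- Solving `(κ + d) f - β ∑ᵢ pᵢ sᵢ = h` for `f`, where `sᵢ = ∑ pᵢ f`, and summing against `pᵢ`
gives one scalar equation for each parity, `(1 - β Qᵢ) sᵢ = ⟨rᵢ, h⟩` with `rᵢ = pᵢ / (κ + d)`. It is
uniquely solvable, and `β sᵢ` is the coefficient in Krein's formula times `⟨rᵢ, h⟩`. The summability
condition in `opGraph` is what gives `sᵢ` a meaning. -/
theorem mem_opGraph_iff {β κ : ℝ} (hκ : 0 ≤ κ) (hβ : ∀ i, |β * kreinSum κ i| ≤ 1 / 2)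
    (f g : H) : (f, g) ∈ opGraph b β ↔ f = kreinRes b β κ ((κ : ℂ) • f + g) := by
  have hpos : ∀ k, 0 < κ + biEig k := fun k => add_pos_of_nonneg_of_pos hκ (biEig_pos k)
  have hne : ∀ k, (κ : ℂ) + biEig k ≠ 0 := fun k => by exact_mod_cast (hpos k).ne'
  have hsum : ∀ i, HasSum (fun k => ((parFreq i k ^ 2 / (κ + biEig k) : ℝ) : ℂ))
      (kreinSum κ i : ℂ) := fun i => by
    exact_mod_cast (summable_kreinTerm hκ i).hasSum
  have hcoef : ∀ i, (kreinCoef β κ i : ℂ) * (1 - β * kreinSum κ i) = β := fun i => by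
    exact_mod_cast kreinCoef_mul (hβ i)
  constructor
  · rintro ⟨hs, hg⟩
    dsimp only at hs hg
    set s : Fin 2 → ℂ := fun i => ∑' m, (parFreq i m : ℂ) * b.repr f m with hsdef
    have hsums : ∀ i, HasSum (fun m => (parFreq i m : ℂ) * b.repr f m) (s i) := fun i => by
      refine Summable.hasSum (Summable.of_norm_bounded hs fun k => ?_)
      rw [norm_mul, Complex.norm_real, Real.norm_of_nonneg (parFreq_nonneg i k)]
      exact mul_le_mul_of_nonneg_right (parFreq_le i k) (norm_nonneg _)
    have hh : ∀ k, b.repr ((κ : ℂ) • f + g) k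
        = (κ + biEig k) * b.repr f k - β * ∑ i, (parFreq i k : ℂ) * s i := fun k => by
      rw [map_add, map_smul, lp.coeFn_add, Pi.add_apply, lp.coeFn_smul, Pi.smul_apply, smul_eq_mul,
        hg k]
      ring
    have hin : ∀ i, inner ℂ (resVec b κ i) ((κ : ℂ) • f + g) = s i - β * kreinSum κ i * s i := by
      intro i
      refine (hasSum_inner_resVec b hκ i _).unique ?_
      refine (((hsums i).sub (((hsum i).mul_left (β : ℂ)).mul_right (s i)))).congr_fun fun k => ?_
      rw [hh]
      have e := parFreq_mul_sum i k s
      push_cast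
      field_simp [hne k]
      linear_combination (-(β : ℂ)) * e
    refine ext_repr b fun k => ?_
    have e1 : ∀ i, (kreinCoef β κ i : ℂ) * inner ℂ (resVec b κ i) ((κ : ℂ) • f + g) = β * s i := by
      intro i
      rw [hin i]
      linear_combination s i * hcoef i
    rw [repr_kreinRes b hκ, hh]
    simp only [e1]
    have e2 : ∑ i, (parFreq i k : ℂ) * (β * s i) = β * ∑ i, (parFreq i k : ℂ) * s i := by
      rw [Finset.mul_sum]
      exact Finset.sum_congr rfl fun i _ => by ring
    rw [e2]
    push_cast
    field_simp [hne k]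
    ring
  · intro hf
    set h := (κ : ℂ) • f + g with hh
    set c : Fin 2 → ℂ := fun i => inner ℂ (resVec b κ i) h with hc
    have hfk : ∀ k, b.repr f k = (((κ + biEig k)⁻¹ : ℝ) : ℂ) * (b.repr h k
      + ∑ i, (parFreq i k : ℂ) * (kreinCoef β κ i * c i)) := fun k => by
      conv_lhs => rw [hf]
      exact repr_kreinRes b hκ h k
    have hsums : ∀ i, HasSum (fun m => (parFreq i m : ℂ) * b.repr f m)
        (c i + kreinSum κ i * (kreinCoef β κ i * c i)) := by
      intro i
      refine ((hasSum_inner_resVec b hκ i h).add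
        ((hsum i).mul_right (kreinCoef β κ i * c i))).congr_fun fun k => ?_
      rw [hfk]
      have e := parFreq_mul_sum i k fun i => kreinCoef β κ i * c i
      beta_reduce at e
      generalize (∑ j, (parFreq j k : ℂ) * (kreinCoef β κ j * c j)) = S at e ⊢
      push_cast
      field_simp [hne k]
      linear_combination e
    have hs : ∀ i, β * ∑' m, (parFreq i m : ℂ) * b.repr f m = kreinCoef β κ i * c i := by
      intro i
      rw [(hsums i).tsum_eq]
      linear_combination (-(c i) : ℂ) * hcoef i
    refine ⟨?_, fun k => ?_⟩
    -- Every index has exactly one parity, and summability in `ℂ` is absolute, so convergence of the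
    -- two sums `∑ pᵢ f` gives the domain condition.
    · have h1 : ∀ k : ℕ, ((k : ℝ) + 1) * ‖b.repr f k‖
          = ∑ i, ‖(parFreq i k : ℂ) * b.repr f k‖ := fun k => by
        simp only [norm_mul, Complex.norm_real, Real.norm_of_nonneg (parFreq_nonneg _ k)]
        rw [← Finset.sum_mul, Fin.sum_univ_two, parFreq, parFreq]
        congr 1
        rcases Nat.mod_two_eq_zero_or_one k with h0 | h0 <;> simp [h0]
      simp only [h1]
      exact summable_sum fun i _ => (hsums i).summable.norm
    · have e : β * ∑ i, (parFreq i k : ℂ) * ∑' m, (parFreq i m : ℂ) * b.repr f m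
          = ∑ i, (parFreq i k : ℂ) * (kreinCoef β κ i * c i) := by
        rw [Finset.mul_sum]
        exact Finset.sum_congr rfl fun i _ => by rw [← hs i]; ring
      have hgk : b.repr g k = b.repr h k - κ * b.repr f k := by
        rw [hh, map_add, map_smul, lp.coeFn_add, Pi.add_apply, lp.coeFn_smul, Pi.smul_apply,
          smul_eq_mul]
        ring
      rw [e, hgk]
      have h2 := hfk k
      have h3 : ((κ : ℂ) + biEig k) * b.repr f k = b.repr h k
          + ∑ i, (parFreq i k : ℂ) * (kreinCoef β κ i * c i) := by
        rw [h2]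
        push_cast
        rw [← mul_assoc, mul_inv_cancel₀ (hne k), one_mul]
      linear_combination (-1 : ℂ) * h3

/-- A multiplier tending to zero plus an operator of finite rank. -/
theorem isCompactOperator_kreinRes [CompleteSpace H] {β κ : ℝ} (hκ : 0 ≤ κ) :
    IsCompactOperator (kreinRes b β κ) := by
  refine Submodule.add_mem (compactOperator (RingHom.id ℂ) H H) ?_
    (Submodule.sum_mem _ fun i _ => Submodule.smul_mem _ _ (isCompactOperator_rankOne _ _))
  refine isCompactOperator_diagOp b ?_
  rw [Nat.cofinite_eq_atTop, ← Complex.ofReal_zero]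
  refine (Complex.continuous_ofReal.tendsto 0).comp ?_
  refine tendsto_inv_atTop_zero.comp (tendsto_atTop_mono (fun k : ℕ => ?_)
    tendsto_natCast_atTop_atTop)
  have h0 : (1 : ℝ) ≤ (k : ℝ) + 1 := by linarith [Nat.cast_nonneg (α := ℝ) k]
  have h1 : (k : ℝ) + 1 ≤ biEig k := le_self_pow₀ h0 (by norm_num)
  linarith

theorem isSymmetric_kreinRes {β κ : ℝ} (hκ : 0 ≤ κ) :
    (kreinRes b β κ : H →ₗ[ℂ] H).IsSymmetric := by
  intro x y
  change inner ℂ (kreinRes b β κ x) y = inner ℂ x (kreinRes b β κ y)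
  rw [kreinRes, add_apply, add_apply, inner_add_left, inner_add_right,
    inner_diagOp b (bddSeq_res hκ)]
  simp only [sum_apply, smul_apply, sum_inner, inner_sum, inner_smul_left, inner_smul_right,
    Complex.conj_ofReal, InnerProductSpace.rankOne_apply, inner_conj_symm]
  congr 1
  exact Finset.sum_congr rfl fun i _ => by ring

end Krein

/-- The operator with graph `opGraph b β` is diagonal in some Hilbert basis. -/
theorem exists_opGraph_diagonal {H : Type u} [NormedAddCommGroup H] [InnerProductSpace ℂ H]
    [CompleteSpace H] (b : HilbertBasis ℕ ℂ H) {β κ₀ : ℝ} (hκ₀ : 1 ≤ κ₀)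
    (hβ : ∀ κ, κ₀ ≤ κ → ∀ i, |β * kreinSum κ i| ≤ 1 / 2) :
    ∃ (ι : Type u) (φ : HilbertBasis ι ℂ H) (l : ι → ℝ), (∀ i, -κ₀ < l i) ∧
      (∀ κ, κ₀ ≤ κ → ∀ i, kreinRes b β κ (φ i) = (((κ + l i)⁻¹ : ℝ) : ℂ) • φ i) ∧
      opGraph b β = {p | ∀ i, φ.repr p.2 i = (l i : ℂ) * φ.repr p.1 i} := by
  have h0 : 0 ≤ κ₀ := by linarith
  obtain ⟨ι, φ, μ, hμ⟩ := exists_eigenbasis (isCompactOperator_kreinRes b (β := β) h0)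
    (isSymmetric_kreinRes b h0)
  -- If `h` is in the kernel, then `(0, h)` lies in the graph, and the graph determines the image of
  -- `0`.
  have hinj : ∀ h : H, kreinRes b β κ₀ h = 0 → h = 0 := by
    intro h hh
    have h1 : ((0 : H), h) ∈ opGraph b β := by
      rw [mem_opGraph_iff b h0 (hβ κ₀ le_rfl), smul_zero, zero_add, hh]
    refine ext_repr b fun k => ?_
    rw [h1.2 k]
    simp
  have hφ : ∀ i, φ i ≠ 0 := fun i => φ.orthonormal.ne_zero i
  have hμ0 : ∀ i, μ i ≠ 0 := fun i h => hφ i (hinj _ (by rw [hμ, h]; simp))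
  let l : ι → ℝ := fun i => (μ i)⁻¹ - κ₀
  have hl : ∀ i, κ₀ + l i = (μ i)⁻¹ := fun i => by simp [l]
  have hmem : ∀ i, (φ i, (l i : ℂ) • φ i) ∈ opGraph b β := by
    intro i
    rw [mem_opGraph_iff b h0 (hβ κ₀ le_rfl), ← add_smul, ← Complex.ofReal_add, hl, map_smul, hμ,
      smul_smul, ← Complex.ofReal_mul, inv_mul_cancel₀ (hμ0 i), Complex.ofReal_one, one_smul]
  -- The `φ i` are eigenvectors of the operator itself, hence of its resolvent at every `κ ≥ κ₀` and
  -- not only at the one used to construct them.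
  have hres : ∀ κ, κ₀ ≤ κ → ∀ i, φ i = ((κ + l i : ℝ) : ℂ) • kreinRes b β κ (φ i) := by
    intro κ hκ i
    have h1 := (mem_opGraph_iff b (h0.trans hκ) (hβ κ hκ) _ _).1 (hmem i)
    rwa [← add_smul, ← Complex.ofReal_add, map_smul] at h1
  have hne : ∀ κ, κ₀ ≤ κ → ∀ i, κ + l i ≠ 0 := fun κ hκ i h => by
    have := hres κ hκ i
    rw [h, Complex.ofReal_zero, zero_smul] at this
    exact hφ i this
  have hres' : ∀ κ, κ₀ ≤ κ → ∀ i, kreinRes b β κ (φ i) = (((κ + l i)⁻¹ : ℝ) : ℂ) • φ i := by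
    intro κ hκ i
    conv_rhs => rw [hres κ hκ i]
    rw [smul_smul, ← Complex.ofReal_mul, inv_mul_cancel₀ (hne κ hκ i), Complex.ofReal_one, one_smul]
  refine ⟨ι, φ, l, fun i => ?_, hres', ?_⟩
  -- If `l i ≤ -κ₀`, the value `κ = -l i` would be allowed in `hne`, where `κ + l i` cannot vanish.
  · by_contra! hlt
    exact hne (-l i) (by linarith) i (by ring)
  · have hbd : BddSeq fun i => (((κ₀ + l i)⁻¹ : ℝ) : ℂ) := by
      refine ⟨‖kreinRes b β κ₀‖, fun i => ?_⟩
      have h1 := (kreinRes b β κ₀).le_opNorm (φ i)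
      rwa [hres' κ₀ le_rfl i, norm_smul, φ.orthonormal.1 i, mul_one, mul_one] at h1
    have hT : kreinRes b β κ₀ = diagOp φ fun i => (((κ₀ + l i)⁻¹ : ℝ) : ℂ) :=
      ext_basis φ fun i => by rw [hres' κ₀ le_rfl i, diagOp_basis φ hbd]
    ext ⟨f, g⟩
    rw [mem_opGraph_iff b h0 (hβ κ₀ le_rfl), hT]
    have hneC : ∀ i, ((κ₀ : ℂ) + l i) ≠ 0 := fun i => by exact_mod_cast hne κ₀ le_rfl i
    have key : ∀ i, φ.repr f i = φ.repr (diagOp φ (fun i => (((κ₀ + l i)⁻¹ : ℝ) : ℂ))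
        ((κ₀ : ℂ) • f + g)) i ↔ φ.repr g i = (l i : ℂ) * φ.repr f i := by
      intro i
      rw [repr_diagOp φ hbd, map_add, map_smul, lp.coeFn_add, Pi.add_apply, lp.coeFn_smul,
        Pi.smul_apply, smul_eq_mul]
      push_cast
      rw [← div_eq_inv_mul, eq_div_iff (hneC i)]
      constructor <;> intro h <;> linear_combination (-1 : ℂ) * h
    constructor
    · intro h i
      exact (key i).1 (congrArg (fun x => φ.repr x i) h)
    · intro h
      exact ext_repr φ fun i => (key i).2 (h i)

/-! ### Fractional powers -/

section Stieltjes

/-- Comparison with `s^(-α)` near `0` and with `s^(-(α + ρ))` at infinity. -/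
theorem integrableOn_rpow_mul_add_rpow {α ρ δ : ℝ} (hα : α < 1) (hρ : 1 < α + ρ)
    (hδ : 0 < δ) : IntegrableOn (fun s : ℝ => s ^ (-α) * (s + δ) ^ (-ρ)) (Ioi 0) := by
  have hmeas : ∀ t : Set ℝ, t ⊆ Ioi 0 → MeasurableSet t → AEStronglyMeasurable
      (fun s : ℝ => s ^ (-α) * (s + δ) ^ (-ρ)) (volume.restrict t) := by
    intro t ht hmt
    refine ContinuousOn.aestronglyMeasurable ?_ hmt
    refine (continuousOn_id.rpow_const fun s hs => Or.inl (ne_of_gt (ht hs))).mul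
      (ContinuousOn.rpow_const (by fun_prop) fun s hs => Or.inl ?_)
    have : (0 : ℝ) < s := ht hs
    positivity
  rw [← Ioc_union_Ioi_eq_Ioi (zero_le_one' ℝ)]
  refine IntegrableOn.union ?_ ?_
  · have h1 : IntegrableOn (fun s : ℝ => s ^ (-α) * δ ^ (-ρ)) (Ioc 0 1) := by
      refine Integrable.mul_const ?_ _
      have := intervalIntegral.intervalIntegrable_rpow' (a := 0) (b := 1) (r := -α) (by linarith)
      rwa [intervalIntegrable_iff_integrableOn_Ioc_of_le zero_le_one] at this
    refine Integrable.mono' h1 (hmeas _ (fun s hs => hs.1) measurableSet_Ioc) ?_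
    refine (ae_restrict_iff' measurableSet_Ioc).2 (ae_of_all _ fun s hs => ?_)
    have hs0 : 0 < s := hs.1
    rw [Real.norm_of_nonneg (by positivity)]
    refine mul_le_mul_of_nonneg_left ?_ (by positivity)
    exact Real.rpow_le_rpow_of_nonpos hδ (by linarith) (by linarith)
  · have h1 := integrableOn_Ioi_rpow_of_lt (a := -(α + ρ)) (by linarith) (zero_lt_one' ℝ)
    refine Integrable.mono' h1 (hmeas _ (Ioi_subset_Ioi zero_le_one) measurableSet_Ioi) ?_
    refine (ae_restrict_iff' measurableSet_Ioi).2 (ae_of_all _ fun s hs => ?_)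
    have hs0 : 0 < s := zero_lt_one.trans hs
    rw [Real.norm_of_nonneg (by positivity), neg_add, Real.rpow_add hs0]
    refine mul_le_mul_of_nonneg_left ?_ (by positivity)
    exact Real.rpow_le_rpow_of_nonpos hs0 (by linarith) (by linarith)

theorem integrableOn_rpow_mul_add_inv {α δ : ℝ} (hα0 : 0 < α) (hα : α < 1) (hδ : 0 < δ) :
    IntegrableOn (fun s : ℝ => s ^ (-α) * (s + δ)⁻¹) (Ioi 0) := by
  simpa only [Real.rpow_neg_one] using
    integrableOn_rpow_mul_add_rpow (ρ := 1) hα (by linarith) hδ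

/-- `∫₀^∞ s ^ (-α) / (s + 1) ds`. -/
def stieltjesConst (α : ℝ) : ℝ := ∫ s in Ioi (0 : ℝ), s ^ (-α) * (s + 1)⁻¹

/-- The constant is divided out later; its value `π / sin (π α)` plays no role, only its being
positive. -/
theorem stieltjesConst_pos {α : ℝ} (hα0 : 0 < α) (hα : α < 1) : 0 < stieltjesConst α := by
  rw [stieltjesConst, setIntegral_pos_iff_support_of_nonneg_ae]
  · have : Ioi (0 : ℝ) ⊆ Function.support fun s : ℝ => s ^ (-α) * (s + 1)⁻¹ := by
      intro s hs
      have hs0 : (0 : ℝ) < s := hs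
      exact ne_of_gt (by positivity)
    rw [inter_eq_self_of_subset_right this]
    simp
  · refine (ae_restrict_iff' measurableSet_Ioi).2 (ae_of_all _ fun s hs => ?_)
    have hs0 : (0 : ℝ) < s := hs
    simp only [Pi.zero_apply]
    positivity
  · exact integrableOn_rpow_mul_add_inv hα0 hα one_pos

theorem integral_rpow_mul_add_inv {α w : ℝ} (hw : 0 < w) :
    ∫ s in Ioi (0 : ℝ), s ^ (-α) * (s + w)⁻¹ = stieltjesConst α * w ^ (-α) := by
  have h1 := integral_comp_mul_left_Ioi (fun s : ℝ => s ^ (-α) * (s + w)⁻¹) 0 hw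
  have h2 : ∀ s ∈ Ioi (0 : ℝ), (w * s) ^ (-α) * (w * s + w)⁻¹
      = w ^ (-α) * w⁻¹ * (s ^ (-α) * (s + 1)⁻¹) := by
    intro s hs
    have hs0 : (0 : ℝ) < s := hs
    rw [Real.mul_rpow hw.le hs0.le, show w * s + w = w * (s + 1) by ring, mul_inv]
    ring
  rw [setIntegral_congr_fun measurableSet_Ioi h2, integral_const_mul, mul_zero, smul_eq_mul] at h1
  rw [stieltjesConst]
  field_simp at h1 ⊢
  linarith

variable {ι : Type*} {H : Type*} [NormedAddCommGroup H] [InnerProductSpace ℂ H]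
  (b : HilbertBasis ι ℂ H)

/-- By the resolvent identity the family is Lipschitz with constant `δ⁻²`. -/
theorem continuousOn_diagOp_res {w : ι → ℝ} {δ : ℝ} (hδ : 0 < δ) (hw : ∀ i, δ ≤ w i) :
    ContinuousOn (fun s : ℝ => diagOp b fun i => (((s + w i)⁻¹ : ℝ) : ℂ)) (Ici 0) := by
  refine LipschitzOnWith.continuousOn (K := Real.toNNReal (δ⁻¹ * δ⁻¹)) ?_
  refine LipschitzOnWith.of_dist_le_mul fun s hs t ht => ?_
  have hs0 : (0 : ℝ) ≤ s := hs
  have ht0 : (0 : ℝ) ≤ t := ht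
  rw [dist_eq_norm, dist_eq_norm, diagOp_sub b
    (bddSeq_inv_add hδ fun i => by linarith [hw i]) (bddSeq_inv_add hδ fun i => by linarith [hw i]),
    Real.coe_toNNReal _ (by positivity)]
  refine norm_diagOp_le b (by positivity) fun i => ?_
  have h1 : 0 < s + w i := by linarith [hw i]
  have h2 : 0 < t + w i := by linarith [hw i]
  rw [← Complex.ofReal_sub, Complex.norm_real, inv_sub_inv h1.ne' h2.ne', norm_div, norm_mul,
    Real.norm_of_nonneg h1.le, Real.norm_of_nonneg h2.le, div_eq_inv_mul, mul_inv,
    show t + w i - (s + w i) = -(s - t) by ring, norm_neg]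
  refine mul_le_mul_of_nonneg_right ?_ (norm_nonneg _)
  exact mul_le_mul (inv_anti₀ hδ (by linarith [hw i])) (inv_anti₀ hδ (by linarith [hw i]))
    (by positivity) (by positivity)

theorem integrableOn_diagOp_res {w : ι → ℝ} {δ α : ℝ} (hδ : 0 < δ) (hw : ∀ i, δ ≤ w i)
    (hα0 : 0 < α) (hα : α < 1) : IntegrableOn
      (fun s : ℝ => s ^ (-α) • diagOp b fun i => (((s + w i)⁻¹ : ℝ) : ℂ)) (Ioi 0) := by
  refine Integrable.mono' (integrableOn_rpow_mul_add_inv hα0 hα hδ) ?_ ?_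
  · refine ContinuousOn.aestronglyMeasurable ?_ measurableSet_Ioi
    refine ContinuousOn.fun_smul ?_ ((continuousOn_diagOp_res b hδ hw).mono Ioi_subset_Ici_self)
    exact continuousOn_id.rpow_const fun t ht => Or.inl (ne_of_gt ht)
  · refine (ae_restrict_iff' measurableSet_Ioi).2 (ae_of_all _ fun s hs => ?_)
    have hs0 : (0 : ℝ) < s := hs
    rw [norm_smul, Real.norm_of_nonneg (by positivity)]
    refine mul_le_mul_of_nonneg_left (norm_diagOp_le b (by positivity) fun i => ?_) (by positivity)
    have h1 : 0 < s + w i := by linarith [hw i]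
    rw [Complex.norm_real, Real.norm_of_nonneg (by positivity)]
    exact inv_anti₀ (by positivity) (by linarith [hw i])

/-- The formula expressing a negative fractional power through resolvents, which makes Krein's
formula usable for fractional powers. On a basis vector it is the substitution `s ↦ w s`. -/
theorem integral_diagOp_res [CompleteSpace H] {w : ι → ℝ} {δ α : ℝ} (hδ : 0 < δ)
    (hw : ∀ i, δ ≤ w i) (hα0 : 0 < α) (hα : α < 1) :
    ∫ s in Ioi (0 : ℝ), s ^ (-α) • (diagOp b fun i => (((s + w i)⁻¹ : ℝ) : ℂ))
      = stieltjesConst α • diagOp b fun i => ((w i ^ (-α) : ℝ) : ℂ) := by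
  refine ext_basis b fun i => ?_
  rw [ContinuousLinearMap.integral_apply (integrableOn_diagOp_res b hδ hw hα0 hα), smul_apply,
    diagOp_basis b (bddSeq_rpow_neg hδ hw hα0.le)]
  have h1 : ∀ s ∈ Ioi (0 : ℝ), (s ^ (-α) • diagOp b fun i => (((s + w i)⁻¹ : ℝ) : ℂ)) (b i)
      = (s ^ (-α) * (s + w i)⁻¹) • b i := by
    intro s hs
    have hs0 : (0 : ℝ) < s := hs
    rw [smul_apply, diagOp_basis b (bddSeq_inv_add hδ fun i => by linarith [hw i]),
      Complex.coe_smul, smul_smul]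
  rw [setIntegral_congr_fun measurableSet_Ioi h1, integral_smul_const,
    integral_rpow_mul_add_inv (hδ.trans_le (hw i)), Complex.coe_smul, smul_smul]

theorem isUnit_diagOp {m : ι → ℂ} (h0 : ∀ i, m i ≠ 0) (hm : BddSeq m)
    (hm' : BddSeq fun i => (m i)⁻¹) : IsUnit (diagOp b m) := by
  refine isUnit_iff_exists.2 ⟨diagOp b fun i => (m i)⁻¹, ?_, ?_⟩
  · rw [diagOp_mul b hm hm']
    simp only [mul_inv_cancel₀ (h0 _), diagOp_one]
  · rw [diagOp_mul b hm' hm]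
    simp only [inv_mul_cancel₀ (h0 _), diagOp_one]

theorem bddSeq_ratio_rpow {w w' : ι → ℝ} {δ M α : ℝ} (hδ : 0 < δ) (hw : ∀ i, δ ≤ w i)
    (hw' : ∀ i, δ ≤ w' i) (hM : ∀ i, |w i - w' i| ≤ M) (hα : 0 ≤ α) :
    BddSeq fun i => (((w i / w' i) ^ α : ℝ) : ℂ) := by
  refine ⟨(1 + M / δ) ^ α, fun i => ?_⟩
  have h1 : 0 < w i := hδ.trans_le (hw i)
  have h2 : 0 < w' i := hδ.trans_le (hw' i)
  rw [Complex.norm_real, Real.norm_of_nonneg (by positivity)]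
  refine Real.rpow_le_rpow (by positivity) ?_ hα
  rw [div_le_iff₀ h2, add_mul, one_mul]
  have h3 : M ≤ M / δ * w' i := by
    rw [div_mul_eq_mul_div, le_div_iff₀ hδ]
    exact mul_le_mul_of_nonneg_left (hw' i) ((abs_nonneg _).trans (hM i))
  have := (abs_le.1 (hM i)).2
  linarith

/-- Bounded perturbations of a weight change its negative powers by an invertible factor. -/
theorem exists_isUnit_diagOp_rpow {w w' : ι → ℝ} {δ M α : ℝ} (hδ : 0 < δ) (hw : ∀ i, δ ≤ w i)
    (hw' : ∀ i, δ ≤ w' i) (hM : ∀ i, |w i - w' i| ≤ M) (hα : 0 ≤ α) :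
    ∃ W : H →L[ℂ] H, IsUnit W ∧ diagOp b (fun i => ((w i ^ (-α) : ℝ) : ℂ))
      = diagOp b (fun i => ((w' i ^ (-α) : ℝ) : ℂ)) * W := by
  have h1 : ∀ i, 0 < w i := fun i => hδ.trans_le (hw i)
  have h2 : ∀ i, 0 < w' i := fun i => hδ.trans_le (hw' i)
  have hb := bddSeq_ratio_rpow hδ hw' hw (M := M) (fun i => by rw [abs_sub_comm]; exact hM i) hα
  refine ⟨diagOp b fun i => (((w' i / w i) ^ α : ℝ) : ℂ), isUnit_diagOp b (fun i => ?_) hb ?_, ?_⟩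
  · have := Real.rpow_pos_of_pos (div_pos (h2 i) (h1 i)) α
    exact_mod_cast this.ne'
  · have := bddSeq_ratio_rpow hδ hw hw' hM hα
    convert this using 2 with i
    rw [← Complex.ofReal_inv, ← Real.inv_rpow (div_pos (h2 i) (h1 i)).le, inv_div]
  · rw [diagOp_mul b (bddSeq_rpow_neg hδ hw' hα) hb]
    congr 1
    funext i
    rw [← Complex.ofReal_mul, Real.div_rpow (h2 i).le (h1 i).le, Real.rpow_neg (h1 i).le,
      Real.rpow_neg (h2 i).le]
    have := (Real.rpow_pos_of_pos (h2 i) α).ne'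
    field_simp

end Stieltjes

/-! ### Comparison of the fractional powers of the perturbed and unperturbed operators -/

section Comparison

variable {H : Type*} [NormedAddCommGroup H] [InnerProductSpace ℂ H]

theorem norm_le_of_repr_le {ι : Type*} (b : HilbertBasis ι ℂ H) {x y : H} {C : ℝ} (hC : 0 ≤ C)
    (h : ∀ i, ‖b.repr x i‖ ≤ C * ‖b.repr y i‖) : ‖x‖ ≤ C * ‖y‖ := by
  refine (abs_le_of_sq_le_sq' ?_ (by positivity)).2
  rw [mul_pow]
  refine hasSum_le (fun i => ?_) (hasSum_norm_repr_sq b x)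
    ((hasSum_norm_repr_sq b y).mul_left (C ^ 2))
  rw [← mul_pow]
  exact pow_le_pow_left₀ (norm_nonneg _) (h i) 2

variable (b : HilbertBasis ℕ ℂ H)

/-- The vector with coordinates `pᵢ(k) (κ + d(k)) ^ α / (s + κ + d(k))`. -/
def fracVec (κ α : ℝ) (i : Fin 2) (s : ℝ) : H :=
  vecOf b fun k => ((parFreq i k * (κ + biEig k) ^ α * (s + (κ + biEig k))⁻¹ : ℝ) : ℂ)

/-- The left side is at most `pᵢ (s + κ + d)^(α - 1)`. Of this negative exponent, `-θ` is spent on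
`κ + s` and the rest on `d = (k + 1)^4`; the factor `pᵢ ≤ k + 1` adds `1` to the power of `k + 1`.
-/
theorem fracVec_coord_le {κ α θ s : ℝ} (hκ : 1 ≤ κ) (hα : 0 ≤ α) (hs : 0 ≤ s) (hθ : 0 ≤ θ)
    (hθ' : θ + α ≤ 1) (i : Fin 2) (k : ℕ) :
    ‖((parFreq i k * (κ + biEig k) ^ α * (s + (κ + biEig k))⁻¹ : ℝ) : ℂ)‖
      ≤ (κ + s) ^ (-θ) * ‖((((k : ℝ) + 1) ^ (1 + 4 * (α - 1 + θ)) : ℝ) : ℂ)‖ := by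
  have h0 : (0 : ℝ) < (k : ℝ) + 1 := by positivity
  have hd := biEig_pos k
  have h1 : 0 < κ + biEig k := by linarith
  have h2 : 0 < s + (κ + biEig k) := by linarith
  have h3 := parFreq_nonneg i k
  rw [Complex.norm_real, Complex.norm_real, Real.norm_of_nonneg (by positivity),
    Real.norm_of_nonneg (by positivity)]
  have h4 : (κ + biEig k) ^ α * (s + (κ + biEig k))⁻¹ ≤ (s + (κ + biEig k)) ^ (α - 1) := by
    rw [Real.rpow_sub_one h2.ne', div_eq_mul_inv]
    refine mul_le_mul_of_nonneg_right ?_ (by positivity)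
    exact Real.rpow_le_rpow h1.le (by linarith) hα
  have h5 : (s + (κ + biEig k)) ^ (α - 1) ≤ (κ + s) ^ (-θ) * biEig k ^ (α - 1 + θ) := by
    have e : (s + (κ + biEig k)) ^ (α - 1)
        = (s + (κ + biEig k)) ^ (-θ) * (s + (κ + biEig k)) ^ (α - 1 + θ) := by
      rw [← Real.rpow_add h2]; ring_nf
    rw [e]
    refine mul_le_mul ?_ ?_ (by positivity) (by positivity)
    · exact Real.rpow_le_rpow_of_nonpos (by linarith) (by linarith) (by linarith)
    · exact Real.rpow_le_rpow_of_nonpos hd (by linarith) (by linarith)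
  calc parFreq i k * (κ + biEig k) ^ α * (s + (κ + biEig k))⁻¹
      = parFreq i k * ((κ + biEig k) ^ α * (s + (κ + biEig k))⁻¹) := by ring
    _ ≤ ((k : ℝ) + 1) * ((κ + s) ^ (-θ) * biEig k ^ (α - 1 + θ)) :=
        mul_le_mul (parFreq_le i k) (h4.trans h5) (by positivity) h0.le
    _ = _ := by
        rw [biEig_eq_rpow, ← Real.rpow_mul h0.le, Real.rpow_add h0, Real.rpow_one]
        ring

/-- The threshold `5/8` is the condition `1 + 4(α - 1) < -1/2` for square-summability. -/
theorem memℓp_fracVec {κ α s : ℝ} (hκ : 1 ≤ κ) (hα : 0 ≤ α) (hα' : α < 5 / 8) (hs : 0 ≤ s)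
    (i : Fin 2) : Memℓp
      (fun k => ((parFreq i k * (κ + biEig k) ^ α * (s + (κ + biEig k))⁻¹ : ℝ) : ℂ)) 2 :=
  memℓp_of_norm_le (memℓp_succ_rpow (s := 1 + 4 * (α - 1 + 0)) (by linarith)) fun k =>
    fracVec_coord_le hκ hα hs le_rfl (by linarith) i k

theorem repr_fracVec {κ α s : ℝ} (hκ : 1 ≤ κ) (hα : 0 ≤ α) (hα' : α < 5 / 8) (hs : 0 ≤ s)
    (i : Fin 2) (k : ℕ) : b.repr (fracVec b κ α i s) k
      = ((parFreq i k * (κ + biEig k) ^ α * (s + (κ + biEig k))⁻¹ : ℝ) : ℂ) :=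
  repr_vecOf b (memℓp_fracVec hκ hα hα' hs i) k

theorem fracVec_zero_eq_resVec {κ s : ℝ} (i : Fin 2) :
    fracVec b κ 0 i s = resVec b (κ + s) i := by
  rw [fracVec, resVec]
  congr 1
  funext k
  rw [Real.rpow_zero, mul_one, div_eq_mul_inv]
  ring_nf

theorem norm_fracVec_le {κ α θ s : ℝ} (hκ : 1 ≤ κ) (hα : 0 ≤ α) (hs : 0 ≤ s) (hθ : 0 ≤ θ)
    (hθ' : θ + α < 5 / 8) (i : Fin 2) :
    ‖fracVec b κ α i s‖ ≤ (κ + s) ^ (-θ)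
      * ‖vecOf b fun k : ℕ => ((((k : ℝ) + 1) ^ (1 + 4 * (α - 1 + θ)) : ℝ) : ℂ)‖ := by
  refine norm_le_of_repr_le b (Real.rpow_nonneg (by linarith) _) fun k => ?_
  rw [repr_fracVec b hκ hα (by linarith) hs, repr_vecOf b (memℓp_succ_rpow (by linarith))]
  exact fracVec_coord_le hκ hα hs hθ (by linarith) i k

/-- The resolvent identity writes the vector at `s` as `v - s R(s) v`, with `v` the vector at `0`
and `R(s)` a norm-continuous resolvent. -/
theorem continuousOn_fracVec {κ α : ℝ} (hκ : 1 ≤ κ) (hα : 0 ≤ α) (hα' : α < 5 / 8) (i : Fin 2) :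
    ContinuousOn (fracVec b κ α i) (Ici 0) := by
  have hδ : ∀ k, (1 : ℝ) ≤ κ + biEig k := fun k => by linarith [biEig_pos k]
  have h1 : ContinuousOn (fun s : ℝ => fracVec b κ α i 0 - (s : ℂ) •
      (diagOp b fun k => (((s + (κ + biEig k))⁻¹ : ℝ) : ℂ)) (fracVec b κ α i 0)) (Ici 0) := by
    refine continuousOn_const.sub (ContinuousOn.fun_smul (Complex.continuous_ofReal.continuousOn) ?_)
    exact (continuousOn_diagOp_res b one_pos hδ).clm_apply continuousOn_const
  refine h1.congr fun s hs => ext_repr b fun k => ?_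
  have hs0 : (0 : ℝ) ≤ s := hs
  rw [map_sub, lp.coeFn_sub, Pi.sub_apply, map_smul, lp.coeFn_smul, Pi.smul_apply, smul_eq_mul,
    repr_diagOp b (bddSeq_inv_add one_pos fun k => by linarith [hδ k]),
    repr_fracVec b hκ hα hα' hs0, repr_fracVec b hκ hα hα' le_rfl]
  have h2 : κ + biEig k ≠ 0 := by linarith [hδ k]
  have h3 : s + (κ + biEig k) ≠ 0 := by linarith [hδ k]
  have h4 : (s + (κ + biEig k))⁻¹ = (0 + (κ + biEig k))⁻¹
      - s * ((s + (κ + biEig k))⁻¹ * (0 + (κ + biEig k))⁻¹) := by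
    rw [zero_add]
    field_simp
    ring
  rw [← Complex.ofReal_mul, ← Complex.ofReal_mul, ← Complex.ofReal_sub]
  congr 1
  conv_lhs => rw [h4]
  ring

theorem continuousOn_kreinCoef {β κ : ℝ} (hκ : 0 ≤ κ)
    (hβ : ∀ κ', κ ≤ κ' → ∀ i, |β * kreinSum κ' i| ≤ 1 / 2) (i : Fin 2) :
    ContinuousOn (fun s => kreinCoef β (κ + s) i) (Ici 0) := by
  have h1 : ContinuousOn (fun s => kreinSum (κ + s) i) (Ici 0) := by
    refine continuousOn_tsum (fun k => ?_) (summable_succ_rpow (s := -2) (by norm_num))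
      fun k s hs => ?_
    · refine continuousOn_const.div (by fun_prop) fun s hs => ?_
      have : (0 : ℝ) ≤ s := hs
      linarith [biEig_pos k]
    · have hs0 : (0 : ℝ) ≤ s := hs
      rw [Real.norm_of_nonneg (kreinTerm_nonneg (by linarith) i k)]
      exact kreinTerm_le (by linarith) i k
  refine continuousOn_const.div (continuousOn_const.sub (continuousOn_const.mul h1)) fun s hs => ?_
  have hs0 : (0 : ℝ) ≤ s := hs
  have := (abs_le.1 (hβ (κ + s) (by linarith) i)).2
  linarith

/-- `(κ + d) ^ α` applied to the difference of the resolvents of the perturbed and the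
unperturbed operators. -/
def kreinKernel (β κ α s : ℝ) : H →L[ℂ] H :=
  ∑ i, (kreinCoef β (κ + s) i : ℂ) •
    InnerProductSpace.rankOne ℂ (fracVec b κ α i s) (fracVec b κ 0 i s)

theorem continuous_rankOne :
    Continuous fun p : H × H => InnerProductSpace.rankOne ℂ p.1 p.2 := by
  have h1 : Continuous fun p : H × H => innerSL ℂ p.2 :=
    (innerSL ℂ (E := H)).continuous.comp continuous_snd
  exact (ContinuousLinearMap.smulRightL ℂ H H).continuous₂.comp (h1.prodMk continuous_fst)

theorem continuousOn_kreinKernel {β κ α : ℝ} (hκ : 1 ≤ κ) (hα : 0 ≤ α) (hα' : α < 5 / 8)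
    (hβ : ∀ κ', κ ≤ κ' → ∀ i, |β * kreinSum κ' i| ≤ 1 / 2) :
    ContinuousOn (kreinKernel b β κ α) (Ici 0) := by
  have h1 : ∀ i, ContinuousOn (fun s => InnerProductSpace.rankOne ℂ (fracVec b κ α i s)
      (fracVec b κ 0 i s)) (Ici 0) := fun i =>
    Continuous.comp_continuousOn (g := fun p : H × H => InnerProductSpace.rankOne ℂ p.1 p.2)
      (f := fun s => (fracVec b κ α i s, fracVec b κ 0 i s)) continuous_rankOne
      ((continuousOn_fracVec b hκ hα hα' i).prodMk
        (continuousOn_fracVec b hκ le_rfl (by norm_num) i))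
  have h2 : ∀ i, ContinuousOn (fun s => (kreinCoef β (κ + s) i : ℂ)) (Ici 0) := fun i =>
    Complex.continuous_ofReal.comp_continuousOn (continuousOn_kreinCoef (by linarith) hβ i)
  unfold kreinKernel
  exact continuousOn_finsetSum _ fun i _ => (h2 i).fun_smul (h1 i)

theorem norm_kreinKernel_le {κ₀ β α θ θ' : ℝ} (hκ₀ : 1 ≤ κ₀) (hα : 0 ≤ α) (hθ : 0 ≤ θ)
    (hθα : θ + α < 5 / 8) (hθ' : 0 ≤ θ') (hθ'' : θ' < 5 / 8)
    (hβ : ∀ κ', κ₀ ≤ κ' → ∀ i, |β * kreinSum κ' i| ≤ 1 / 2) :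
    ∃ A : ℝ, 0 ≤ A ∧ ∀ κ s, κ₀ ≤ κ → 0 ≤ s →
      ‖kreinKernel b β κ α s‖ ≤ A * (κ + s) ^ (-(θ + θ')) := by
  -- The outer `2` counts the parities, and `2 |β|` bounds the coefficient in Krein's formula. The
  -- two exponents may be chosen independently because only one of the two vectors carries the power
  -- `α`.
  refine ⟨2 * (2 * |β| * (‖vecOf b fun k : ℕ => ((((k : ℝ) + 1) ^ (1 + 4 * (α - 1 + θ)) : ℝ) : ℂ)‖
    * ‖vecOf b fun k : ℕ => ((((k : ℝ) + 1) ^ (1 + 4 * (0 - 1 + θ')) : ℝ) : ℂ)‖)), by positivity,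
    fun κ s hκ hs => ?_⟩
  have hterm : ∀ i, ‖(kreinCoef β (κ + s) i : ℂ) •
      InnerProductSpace.rankOne ℂ (fracVec b κ α i s) (fracVec b κ 0 i s)‖
      ≤ 2 * |β| * (‖vecOf b fun k : ℕ => ((((k : ℝ) + 1) ^ (1 + 4 * (α - 1 + θ)) : ℝ) : ℂ)‖
    * ‖vecOf b fun k : ℕ => ((((k : ℝ) + 1) ^ (1 + 4 * (0 - 1 + θ')) : ℝ) : ℂ)‖)
      * (κ + s) ^ (-(θ + θ')) := by
    intro i
    rw [norm_smul, InnerProductSpace.norm_rankOne, Complex.norm_real, Real.norm_eq_abs, neg_add,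
      Real.rpow_add (by linarith)]
    have h1 := abs_kreinCoef_le (hβ (κ + s) (by linarith) i)
    have h2 := norm_fracVec_le b (hκ₀.trans hκ) hα hs hθ hθα i
    have h3 := norm_fracVec_le b (hκ₀.trans hκ) le_rfl hs hθ' (by linarith) i
    have h4 : 0 ≤ (κ + s) ^ (-θ) := Real.rpow_nonneg (by linarith) _
    refine (mul_le_mul h1 (mul_le_mul h2 h3 (norm_nonneg _) (by positivity)) (by positivity)
      (by positivity)).trans_eq ?_
    ring
  refine (norm_sum_le _ _).trans ((Finset.sum_le_sum fun i _ => hterm i).trans_eq ?_)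
  rw [Finset.sum_const, Finset.card_univ, Fintype.card_fin]
  simp
  ring

/-- The power `-α` on the left cancels the power `α` in the first vector of each rank one term,
which restores Krein's formula at `κ + s`. -/
theorem diagOp_mul_kreinKernel [CompleteSpace H] {β κ α s : ℝ} (hκ : 1 ≤ κ) (hα : 0 ≤ α)
    (hα' : α < 5 / 8) (hs : 0 ≤ s) :
    diagOp b (fun k => (((κ + biEig k) ^ (-α) : ℝ) : ℂ)) * kreinKernel b β κ α s
      = kreinRes b β (κ + s) - diagOp b fun k => (((s + (κ + biEig k))⁻¹ : ℝ) : ℂ) := by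
  have hδ : ∀ k, (1 : ℝ) ≤ κ + biEig k := fun k => by linarith [biEig_pos k]
  have h1 : ∀ i, diagOp b (fun k => (((κ + biEig k) ^ (-α) : ℝ) : ℂ)) (fracVec b κ α i s)
      = resVec b (κ + s) i := by
    intro i
    rw [← fracVec_zero_eq_resVec]
    refine ext_repr b fun k => ?_
    rw [repr_diagOp b (bddSeq_rpow_neg one_pos hδ hα), repr_fracVec b hκ hα hα' hs,
      repr_fracVec b hκ le_rfl (by norm_num) hs, ← Complex.ofReal_mul, Real.rpow_zero,
      Real.rpow_neg (by linarith [hδ k])]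
    have : (κ + biEig k) ^ α ≠ 0 := (Real.rpow_pos_of_pos (by linarith [hδ k]) α).ne'
    congr 1
    field_simp
  have h2 : (fun k => (((κ + s + biEig k)⁻¹ : ℝ) : ℂ))
      = fun k => (((s + (κ + biEig k))⁻¹ : ℝ) : ℂ) := by
    funext k; ring_nf
  rw [kreinKernel, Finset.mul_sum, kreinRes, h2, add_sub_cancel_left]
  refine Finset.sum_congr rfl fun i _ => ?_
  rw [mul_smul_comm, ContinuousLinearMap.mul_def, InnerProductSpace.comp_rankOne, h1,
    fracVec_zero_eq_resVec]

/-- The negative fractional powers of the perturbed operator of order less than `5/8` are those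
of the unperturbed operator up to an invertible factor. -/
theorem exists_isUnit_fracPow [CompleteSpace H] {ι : Type*} {φ : HilbertBasis ι ℂ H} {l : ι → ℝ}
    {β κ₀ α : ℝ} (hκ₀ : 1 ≤ κ₀) (hβ : ∀ κ, κ₀ ≤ κ → ∀ i, |β * kreinSum κ i| ≤ 1 / 2)
    (hl : ∀ i, -κ₀ < l i)
    (hφ : ∀ κ, κ₀ ≤ κ → ∀ i, kreinRes b β κ (φ i) = (((κ + l i)⁻¹ : ℝ) : ℂ) • φ i)
    (hα : 0 < α) (hα' : α < 5 / 8) :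
    ∃ κ, κ₀ + 1 ≤ κ ∧ ∃ W : H →L[ℂ] H, IsUnit W ∧
      diagOp φ (fun i => (((κ + l i) ^ (-α) : ℝ) : ℂ))
        = diagOp b (fun k => (((κ + biEig k) ^ (-α) : ℝ) : ℂ)) * W := by
  -- The slack `η` keeps both exponents strictly below their thresholds. As `2 η < 10/48`, their sum
  -- with `α` exceeds `50/48`.
  obtain ⟨η, hη⟩ : ∃ η : ℝ, η = (5 / 8 - α) / 6 := ⟨_, rfl⟩
  obtain ⟨A, hA, hbound⟩ := norm_kreinKernel_le b (α := α) (θ := 5 / 8 - α - η)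
    (θ' := 5 / 8 - η) hκ₀ hα.le (by linarith) (by linarith) (by linarith) (by linarith) hβ
  have hC := stieltjesConst_pos hα (by linarith : α < 1)
  set C := stieltjesConst α with hCdef
  -- The decay exponent `θ + θ'` is split as `ρ + 1/48`: `α + ρ > 1` still makes the integral in `s`
  -- converge, and the spare `1/48` becomes a factor `κ^(-1/48)` that makes the norm small.
  set ρ : ℝ := 5 / 4 - α - 2 * η - 1 / 48 with hρ
  have hint : IntegrableOn (fun s : ℝ => s ^ (-α) * (s + 1) ^ (-ρ)) (Ioi 0) :=
    integrableOn_rpow_mul_add_rpow (by linarith) (by linarith) one_pos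
  set J := ∫ s in Ioi (0 : ℝ), s ^ (-α) * (s + 1) ^ (-ρ) with hJ
  have hlim : Tendsto (fun κ : ℝ => C⁻¹ * (A * κ ^ (-(1 / 48) : ℝ) * J)) atTop (𝓝 0) := by
    have := (((tendsto_rpow_neg_atTop (y := 1 / 48) (by norm_num)).const_mul A).mul_const
      J).const_mul C⁻¹
    simpa using this
  obtain ⟨κ, hκ1, hκ⟩ := ((hlim.eventually (gt_mem_nhds one_pos)).and
    (eventually_ge_atTop (κ₀ + 1))).exists
  refine ⟨κ, hκ, ?_⟩
  have hκone : 1 ≤ κ := by linarith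
  have hβκ : ∀ κ', κ ≤ κ' → ∀ i, |β * kreinSum κ' i| ≤ 1 / 2 := fun κ' h => hβ κ' (by linarith)
  have hpt : ∀ s ∈ Ioi (0 : ℝ), ‖s ^ (-α) • kreinKernel b β κ α s‖
      ≤ A * κ ^ (-(1 / 48) : ℝ) * (s ^ (-α) * (s + 1) ^ (-ρ)) := by
    intro s hs
    have hs0 : (0 : ℝ) < s := hs
    rw [norm_smul, Real.norm_of_nonneg (by positivity)]
    have h1 := hbound κ s (by linarith) hs0.le
    have h2 : (κ + s) ^ (-(5 / 8 - α - η + (5 / 8 - η)))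
        ≤ κ ^ (-(1 / 48) : ℝ) * (s + 1) ^ (-ρ) := by
      rw [show -(5 / 8 - α - η + (5 / 8 - η)) = -(1 / 48) + -ρ by rw [hρ]; ring,
        Real.rpow_add (by linarith)]
      refine mul_le_mul ?_ ?_ (Real.rpow_nonneg (by linarith) _) (Real.rpow_nonneg (by linarith) _)
      · exact Real.rpow_le_rpow_of_nonpos (by linarith) (by linarith) (by norm_num)
      · exact Real.rpow_le_rpow_of_nonpos (by linarith) (by linarith) (by linarith)
    calc s ^ (-α) * ‖kreinKernel b β κ α s‖
        ≤ s ^ (-α) * (A * (κ ^ (-(1 / 48) : ℝ) * (s + 1) ^ (-ρ))) := by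
          refine mul_le_mul_of_nonneg_left (h1.trans ?_) (by positivity)
          exact mul_le_mul_of_nonneg_left h2 hA
      _ = _ := by ring
  have hGint : IntegrableOn (fun s : ℝ => s ^ (-α) • kreinKernel b β κ α s) (Ioi 0) := by
    refine Integrable.mono' (hint.const_mul (A * κ ^ (-(1 / 48) : ℝ))) ?_ ?_
    · refine ContinuousOn.aestronglyMeasurable ?_ measurableSet_Ioi
      refine ContinuousOn.fun_smul ?_ ((continuousOn_kreinKernel b hκone hα.le hα' hβκ).mono
        Ioi_subset_Ici_self)
      exact continuousOn_id.rpow_const fun t ht => Or.inl (ne_of_gt ht)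
    · exact (ae_restrict_iff' measurableSet_Ioi).2 (ae_of_all _ hpt)
  set K : H →L[ℂ] H := C⁻¹ • ∫ s in Ioi (0 : ℝ), s ^ (-α) • kreinKernel b β κ α s with hK
  have hKnorm : ‖K‖ < 1 := by
    refine lt_of_le_of_lt ?_ hκ1
    rw [hK, norm_smul, Real.norm_of_nonneg (by positivity)]
    refine mul_le_mul_of_nonneg_left ?_ (by positivity)
    rw [hJ, ← integral_const_mul]
    refine (norm_integral_le_integral_norm _).trans ?_
    exact setIntegral_mono_on hGint.norm (hint.const_mul _) measurableSet_Ioi hpt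
  -- Invertible by the Neumann series.
  refine ⟨1 + K, ?_, ?_⟩
  · have := isUnit_one_sub_of_norm_lt_one (x := -K) (by rwa [norm_neg])
    rwa [sub_neg_eq_add] at this
  · have hw : ∀ k, (1 : ℝ) ≤ κ + biEig k := fun k => by linarith [biEig_pos k]
    have hwl : ∀ i, (1 : ℝ) ≤ κ + l i := fun i => by linarith [hl i]
    have hα1 : α < 1 := by linarith
    have hres : ∀ s ∈ Ioi (0 : ℝ),
        diagOp b (fun k => (((κ + biEig k) ^ (-α) : ℝ) : ℂ)) * (s ^ (-α) • kreinKernel b β κ α s)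
        = s ^ (-α) • (diagOp φ fun i => (((s + (κ + l i))⁻¹ : ℝ) : ℂ))
          - s ^ (-α) • diagOp b fun k => (((s + (κ + biEig k))⁻¹ : ℝ) : ℂ) := by
      intro s hs
      have hs0 : (0 : ℝ) < s := hs
      have h1 : kreinRes b β (κ + s) = diagOp φ fun i => (((s + (κ + l i))⁻¹ : ℝ) : ℂ) := by
        refine ext_basis φ fun i => ?_
        rw [hφ (κ + s) (by linarith), diagOp_basis φ
          (bddSeq_inv_add one_pos fun i => by linarith [hwl i])]
        congr 3
        ring
      rw [mul_smul_comm, diagOp_mul_kreinKernel b hκone hα.le hα' hs0.le, h1, smul_sub]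
    have h2 : diagOp b (fun k => (((κ + biEig k) ^ (-α) : ℝ) : ℂ))
        * ∫ s in Ioi (0 : ℝ), s ^ (-α) • kreinKernel b β κ α s
        = C • (diagOp φ fun i => (((κ + l i) ^ (-α) : ℝ) : ℂ))
          - C • diagOp b fun k => (((κ + biEig k) ^ (-α) : ℝ) : ℂ) := by
      rw [← integral_const_mul_of_integrable hGint, setIntegral_congr_fun measurableSet_Ioi hres,
        integral_sub (integrableOn_diagOp_res φ one_pos hwl hα hα1)
          (integrableOn_diagOp_res b one_pos hw hα hα1),
        integral_diagOp_res φ one_pos hwl hα hα1, integral_diagOp_res b one_pos hw hα hα1]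
    rw [hK, mul_add, mul_one, mul_smul_comm, h2, ← smul_sub, smul_smul, inv_mul_cancel₀ hC.ne',
      one_smul, add_sub_cancel]

end Comparison

/-! ### The sine basis of `L²([0, π])` -/

section SineBasis

theorem integral_μI_eq (g : ℝ → ℂ) : ∫ t, g t ∂μI = ∫ t in (0 : ℝ)..Real.pi, g t := by
  rw [integral_Icc_eq_integral_Ioc, intervalIntegral.integral_of_le Real.pi_pos.le]

theorem continuous_sinBasis (k : ℕ) : Continuous (sinBasis k) := by
  unfold sinBasis
  fun_prop

theorem abs_sinBasis_le (k : ℕ) (t : ℝ) : |sinBasis k t| ≤ √(2 / Real.pi) := by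
  rw [sinBasis, abs_mul, abs_of_nonneg (Real.sqrt_nonneg _)]
  exact mul_le_of_le_one_right (Real.sqrt_nonneg _) (Real.abs_sin_le_one _)

theorem memLp_of_continuousOn {F : ℝ → ℂ} (hF : ContinuousOn F I) : MemLp F 2 μI := by
  obtain ⟨C, hC⟩ := isCompact_Icc.exists_bound_of_continuousOn hF
  exact MemLp.of_bound (hF.aestronglyMeasurable measurableSet_Icc) C
    ((ae_restrict_iff' measurableSet_Icc).2 (ae_of_all _ hC))

theorem integrable_H₀ (f : H₀) : Integrable f μI := (Lp.memLp f).integrable one_le_two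

/-- `sinBasis k` as an element of `L²`. -/
def sinVec (k : ℕ) : H₀ :=
  (memLp_of_continuousOn (F := fun t => (sinBasis k t : ℂ))
    (Complex.continuous_ofReal.comp (continuous_sinBasis k)).continuousOn).toLp _

theorem coeFn_sinVec (k : ℕ) : sinVec k =ᵐ[μI] fun t => (sinBasis k t : ℂ) := MemLp.coeFn_toLp _

theorem inner_sinVec (k : ℕ) (f : H₀) : inner ℂ (sinVec k) f = coeff f k := by
  rw [L2.inner_def, coeff]
  refine integral_congr_ae ?_
  filter_upwards [coeFn_sinVec k] with t ht
  simp [ht, mul_comm]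

theorem integral_cos_int_mul (m : ℤ) :
    ∫ t in (0 : ℝ)..Real.pi, Real.cos (m * t) = if m = 0 then Real.pi else 0 := by
  split_ifs with h
  · simp [h]
  · rw [intervalIntegral.integral_comp_mul_left _ (by exact_mod_cast h : (m : ℝ) ≠ 0)]
    simp

theorem integral_sinBasis_mul (j k : ℕ) :
    ∫ t in (0 : ℝ)..Real.pi, sinBasis j t * sinBasis k t = if j = k then 1 else 0 := by
  have h1 : ∀ t, sinBasis j t * sinBasis k t = Real.pi⁻¹ *
      (Real.cos (((j : ℤ) - k : ℤ) * t) - Real.cos (((j : ℤ) + k + 2 : ℤ) * t)) := by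
    intro t
    have h2 := Real.cos_sub (((j : ℝ) + 1) * t) (((k : ℝ) + 1) * t)
    have h3 := Real.cos_add (((j : ℝ) + 1) * t) (((k : ℝ) + 1) * t)
    have e1 : (((j : ℤ) - k : ℤ) : ℝ) * t = ((j : ℝ) + 1) * t - ((k : ℝ) + 1) * t := by
      push_cast; ring
    have e2 : (((j : ℤ) + k + 2 : ℤ) : ℝ) * t = ((j : ℝ) + 1) * t + ((k : ℝ) + 1) * t := by
      push_cast; ring
    have e3 : √(2 / Real.pi) * √(2 / Real.pi) = 2 / Real.pi :=
      Real.mul_self_sqrt (by positivity)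
    rw [sinBasis, sinBasis, e1, e2, h2, h3]
    calc _ = (√(2 / Real.pi) * √(2 / Real.pi))
          * (Real.sin (((j : ℝ) + 1) * t) * Real.sin (((k : ℝ) + 1) * t)) := by ring
      _ = _ := by rw [e3]; ring
  have hc : ∀ m : ℤ, IntervalIntegrable (fun t : ℝ => Real.cos (m * t)) volume 0 Real.pi :=
    fun m => Continuous.intervalIntegrable (by fun_prop) _ _
  simp only [h1]
  rw [intervalIntegral.integral_const_mul, intervalIntegral.integral_sub (hc _) (hc _),
    integral_cos_int_mul, integral_cos_int_mul, if_neg (by omega : ¬((j : ℤ) + k + 2 = 0)), sub_zero]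
  by_cases h : j = k
  · rw [if_pos h, if_pos (by omega), inv_mul_cancel₀ Real.pi_ne_zero]
  · rw [if_neg h, if_neg (by omega), mul_zero]

theorem orthonormal_sinVec : Orthonormal ℂ sinVec := by
  rw [orthonormal_iff_ite]
  intro j k
  rw [inner_sinVec, coeff]
  have h1 : ∫ t, sinBasis j t • sinVec k t ∂μI
      = ∫ t, ((sinBasis j t * sinBasis k t : ℝ) : ℂ) ∂μI := by
    refine integral_congr_ae ?_
    filter_upwards [coeFn_sinVec k] with t ht
    rw [ht]
    simp
  rw [h1, integral_μI_eq, intervalIntegral.integral_ofReal, integral_sinBasis_mul]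
  split_ifs <;> simp

theorem integrable_smul_H₀ {g : ℝ → ℝ} (hg : Continuous g) (f : H₀) :
    Integrable (fun t => g t • f t) μI := by
  obtain ⟨C, hC⟩ := isCompact_Icc.exists_bound_of_continuousOn (s := I) hg.continuousOn
  exact (integrable_H₀ f).bdd_smul C hg.aestronglyMeasurable
    ((ae_restrict_iff' measurableSet_Icc).2 (ae_of_all _ hC))

/-- The identity `2 sin ((n+1)t) cos t = sin ((n+2)t) + sin (nt)` shows that the span of the sines
is stable under multiplication by `cos t`. -/
theorem integral_sin_mul_cos_pow {f : H₀} (hf : ∀ k, coeff f k = 0) (m : ℕ) : ∀ n : ℕ,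
    ∫ t, (Real.sin (n * t) * Real.cos t ^ m) • f t ∂μI = 0 := by
  have hint : ∀ m n : ℕ, Integrable (fun t => (Real.sin (n * t) * Real.cos t ^ m) • f t) μI :=
    fun m n => integrable_smul_H₀ (by fun_prop) f
  induction m with
  | zero =>
    intro n
    rcases n with _ | k
    · simp
    · have h1 : ∀ t : ℝ, (Real.sin ((k + 1 : ℕ) * t) * Real.cos t ^ 0) • f t
          = (√(2 / Real.pi))⁻¹ • (sinBasis k t • f t) := by
        intro t
        rw [sinBasis, smul_smul, ← mul_assoc, inv_mul_cancel₀ (by positivity), one_mul]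
        simp
      simp only [h1]
      have := hf k
      rw [coeff] at this
      rw [integral_smul, this, smul_zero]
  | succ m ih =>
    intro n
    rcases n with _ | n
    · simp
    · have h1 : ∀ t : ℝ, (Real.sin ((n + 1 : ℕ) * t) * Real.cos t ^ (m + 1)) • f t
          = (1 / 2 : ℝ) • ((Real.sin ((n + 2 : ℕ) * t) * Real.cos t ^ m) • f t
            + (Real.sin (n * t) * Real.cos t ^ m) • f t) := by
        intro t
        rw [← add_smul, smul_smul]
        congr 1
        have e1 : ((n + 2 : ℕ) : ℝ) * t = ((n + 1 : ℕ) : ℝ) * t + t := by push_cast; ring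
        have e2 : (n : ℝ) * t = ((n + 1 : ℕ) : ℝ) * t - t := by push_cast; ring
        rw [e1, e2, Real.sin_add, Real.sin_sub]
        ring
      simp only [h1]
      rw [integral_smul, integral_add (hint m _) (hint m _), ih, ih]
      simp

/-- The function `sin t f(t)` annihilates all polynomials in `cos t`. By Weierstrass these are
uniformly dense in the continuous functions on `[0, π]`, since `cos` maps this interval
homeomorphically onto `[-1, 1]`. -/
theorem integral_sin_mul_smul {f : H₀} (hf : ∀ k, coeff f k = 0) {g : ℝ → ℝ} (hg : Continuous g) :
    ∫ t, (Real.sin t * g t) • f t ∂μI = 0 := by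
  have hpoly : ∀ p : Polynomial ℝ, ∫ t, (Real.sin t * p.eval (Real.cos t)) • f t ∂μI = 0 := by
    intro p
    induction p using Polynomial.induction_on' with
    | add p q hp hq =>
      simp only [Polynomial.eval_add, mul_add, add_smul]
      rw [integral_add (integrable_smul_H₀ (by fun_prop) f) (integrable_smul_H₀ (by fun_prop) f),
        hp, hq, add_zero]
    | monomial m c =>
      have h1 := integral_sin_mul_cos_pow hf m 1
      have h2 : ∀ t : ℝ, (Real.sin t * (Polynomial.monomial m c).eval (Real.cos t)) • f t
          = c • ((Real.sin ((1 : ℕ) * t) * Real.cos t ^ m) • f t) := by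
        intro t
        rw [Polynomial.eval_monomial, smul_smul]
        congr 1
        simp
        ring
      simp only [h2]
      rw [integral_smul, h1, smul_zero]
  refine norm_le_zero_iff.1 (le_of_forall_pos_le_add fun ε hε => ?_)
  rw [zero_add]
  set N := ∫ t, ‖f t‖ ∂μI with hN
  have hN0 : 0 ≤ N := integral_nonneg fun _ => norm_nonneg _
  obtain ⟨p, hp⟩ := exists_polynomial_near_of_continuousOn (-1) 1 (fun x => g (Real.arccos x))
    (hg.comp Real.continuous_arccos).continuousOn (ε / (N + 1)) (by positivity)
  have h1 : ∫ t, (Real.sin t * g t) • f t ∂μI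
      = ∫ t, (Real.sin t * (g t - p.eval (Real.cos t))) • f t ∂μI := by
    simp only [mul_sub, sub_smul]
    rw [integral_sub (integrable_smul_H₀ (by fun_prop) f) (integrable_smul_H₀ (by fun_prop) f),
      hpoly, sub_zero]
  rw [h1]
  calc ‖∫ t, (Real.sin t * (g t - p.eval (Real.cos t))) • f t ∂μI‖
      ≤ ∫ t, ε / (N + 1) * ‖f t‖ ∂μI := by
        refine norm_integral_le_of_norm_le ((integrable_H₀ f).norm.const_mul _) ?_
        refine (ae_restrict_iff' measurableSet_Icc).2 (ae_of_all _ fun t ht => ?_)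
        rw [norm_smul, norm_mul]
        refine mul_le_mul_of_nonneg_right ?_ (norm_nonneg _)
        have h2 := hp (Real.cos t) ⟨Real.neg_one_le_cos t, Real.cos_le_one t⟩
        rw [Real.arccos_cos ht.1 ht.2, abs_sub_comm] at h2
        calc ‖Real.sin t‖ * ‖g t - p.eval (Real.cos t)‖ ≤ 1 * ‖g t - p.eval (Real.cos t)‖ :=
              mul_le_mul_of_nonneg_right (Real.abs_sin_le_one t) (norm_nonneg _)
          _ ≤ ε / (N + 1) := by rw [one_mul]; exact h2.le
    _ = ε / (N + 1) * N := by rw [integral_const_mul]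
    _ ≤ ε := by
        rw [div_mul_eq_mul_div, div_le_iff₀ (by positivity)]
        nlinarith

/-- Completeness of the sines: `sin t f(t)` annihilates all test functions, and `sin` has no zero
inside the interval. -/
theorem eq_zero_of_coeff_eq_zero {f : H₀} (hf : ∀ k, coeff f k = 0) : f = 0 := by
  rw [Lp.eq_zero_iff_ae_eq_zero]
  have h1 : ∀ᵐ t ∂μI, Real.sin t • f t = 0 := by
    refine ae_eq_zero_of_integral_contDiff_smul_eq_zero
      (integrable_smul_H₀ Real.continuous_sin f).locallyIntegrable fun g hg _ => ?_
    rw [← integral_sin_mul_smul hf hg.continuous]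
    exact integral_congr_ae (ae_of_all _ fun t => by beta_reduce; rw [smul_smul, mul_comm])
  have h2 : ∀ᵐ t ∂μI, t ∈ Ioo 0 Real.pi := by
    rw [ae_restrict_congr_set Ioo_ae_eq_Icc.symm]
    exact ae_restrict_mem measurableSet_Ioo
  filter_upwards [h1, h2] with t ht ht'
  exact (smul_eq_zero.1 ht).resolve_left (Real.sin_pos_of_mem_Ioo ht').ne'

/-- The sine basis of `L²([0, π])`. -/
def sineBasis : HilbertBasis ℕ ℂ H₀ :=
  HilbertBasis.mkOfOrthogonalEqBot orthonormal_sinVec (by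
    rw [eq_bot_iff]
    intro f hf
    rw [Submodule.mem_bot]
    refine eq_zero_of_coeff_eq_zero fun k => ?_
    rw [← inner_sinVec]
    exact (Submodule.mem_orthogonal _ f).1 hf _ (Submodule.subset_span ⟨k, rfl⟩))

theorem repr_sineBasis (f : H₀) (k : ℕ) : sineBasis.repr f k = coeff f k := by
  rw [HilbertBasis.repr_apply_apply, ← inner_sinVec, sineBasis,
    HilbertBasis.coe_mkOfOrthogonalEqBot]

theorem coeff_injective : Function.Injective coeff := fun f g h =>
  ext_repr sineBasis fun k => by rw [repr_sineBasis, repr_sineBasis, h]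

theorem coeff_of_ae_eq {f : H₀} {F : ℝ → ℂ} (h : f =ᵐ[μI] F) (k : ℕ) :
    coeff f k = ∫ t in (0 : ℝ)..Real.pi, sinBasis k t • F t := by
  rw [coeff, ← integral_μI_eq]
  refine integral_congr_ae ?_
  filter_upwards [h] with t ht
  rw [ht]

end SineBasis

/-! ### Absolutely continuous functions on `[0, π]` -/

section Primitive

/-- On `[0, π]`, the function `u` is absolutely continuous with derivative `v`. -/
structure IsPrim (u v : ℝ → ℂ) : Prop where
  integrable : IntervalIntegrable v volume 0 Real.pi
  eq_add : ∀ t ∈ I, u t = u 0 + ∫ s in (0 : ℝ)..t, v s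

theorem uIcc_eq_I : uIcc 0 Real.pi = I := uIcc_of_le Real.pi_pos.le

theorem zero_mem_I : (0 : ℝ) ∈ I := ⟨le_rfl, Real.pi_pos.le⟩

theorem pi_mem_I : Real.pi ∈ I := ⟨Real.pi_pos.le, le_rfl⟩

theorem uniqueDiffOn_I : UniqueDiffOn ℝ I := uniqueDiffOn_Icc Real.pi_pos

theorem IsPrim.continuousOn {u v : ℝ → ℂ} (h : IsPrim u v) : ContinuousOn u I := by
  have h1 := intervalIntegral.continuousOn_primitive_interval' (a := 0) h.integrable (by simp)
  rw [uIcc_eq_I] at h1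
  exact (continuousOn_const.add h1).congr h.eq_add

theorem IsPrim.hasDerivWithinAt {u v : ℝ → ℂ} (h : IsPrim u v) (hv : ContinuousOn v I) {t : ℝ}
    (ht : t ∈ I) : HasDerivWithinAt u (v t) I t := by
  have h1 : HasDerivWithinAt (fun x => ∫ s in (0 : ℝ)..x, v s) (v t) I t := by
    have : Fact (t ∈ Icc 0 Real.pi) := ⟨ht⟩
    refine intervalIntegral.integral_hasDerivWithinAt_right
      (h.integrable.mono_set (uIcc_subset_uIcc left_mem_uIcc (by rwa [uIcc_eq_I])))
      (hv.stronglyMeasurableAtFilter_nhdsWithin measurableSet_Icc t) (hv t ht)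
  exact (h1.const_add (u 0)).congr h.eq_add (h.eq_add t ht)

theorem isPrim_of_hasDerivWithinAt {u v : ℝ → ℂ} (hu : ∀ t ∈ I, HasDerivWithinAt u (v t) I t)
    (hv : ContinuousOn v I) : IsPrim u v := by
  have hint : IntervalIntegrable v volume 0 Real.pi := by
    rw [← uIcc_eq_I] at hv
    exact hv.intervalIntegrable
  refine ⟨hint, fun t ht => ?_⟩
  have h1 := intervalIntegral.integral_eq_sub_of_hasDeriv_right_of_le (a := 0) (b := t) ht.1
    (f := u) (f' := v) (fun s hs => ((hu s ⟨hs.1, hs.2.trans ht.2⟩).continuousWithinAt).mono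
      (Icc_subset_Icc_right ht.2)) (fun s hs => ?_)
    (hint.mono_set (uIcc_subset_uIcc left_mem_uIcc (by rwa [uIcc_eq_I])))
  · rw [h1]; ring
  · exact ((hu s ⟨hs.1.le, hs.2.le.trans ht.2⟩).hasDerivAt
      (Icc_mem_nhds hs.1 (hs.2.trans_le ht.2))).hasDerivWithinAt

theorem isPrim_integral {v : ℝ → ℂ} (hv : IntervalIntegrable v volume 0 Real.pi) (c : ℂ) :
    IsPrim (fun t => c + ∫ s in (0 : ℝ)..t, v s) v :=
  ⟨hv, fun t _ => by simp⟩

theorem IsPrim.add {u v u' v' : ℝ → ℂ} (h : IsPrim u v) (h' : IsPrim u' v') :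
    IsPrim (fun t => u t + u' t) (fun t => v t + v' t) := by
  refine ⟨h.integrable.add h'.integrable, fun t ht => ?_⟩
  have hsub : uIcc 0 t ⊆ uIcc 0 Real.pi :=
    uIcc_subset_uIcc left_mem_uIcc (by rwa [uIcc_eq_I])
  rw [h.eq_add t ht, h'.eq_add t ht, intervalIntegral.integral_add (h.integrable.mono_set hsub)
    (h'.integrable.mono_set hsub)]
  ring

theorem isPrim_const_add_mul (c d : ℂ) : IsPrim (fun t => c + d * t) fun _ => d := by
  refine ⟨intervalIntegrable_const, fun t _ => ?_⟩
  simp [mul_comm]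

theorem IsPrim.congr {u v u' : ℝ → ℂ} (h : IsPrim u v) (hu : EqOn u' u I) : IsPrim u' v :=
  ⟨h.integrable, fun t ht => by rw [hu ht, hu zero_mem_I]; exact h.eq_add t ht⟩

/-- There is a function with prescribed second derivative and prescribed boundary values. -/
theorem exists_isPrim_isPrim {v : ℝ → ℂ} (hv : IntervalIntegrable v volume 0 Real.pi) (x y : ℂ) :
    ∃ u u' : ℝ → ℂ, IsPrim u u' ∧ IsPrim u' v ∧ u 0 = x ∧ u Real.pi = y := by
  let W : ℝ → ℂ := fun t => ∫ s in (0 : ℝ)..t, v s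
  have hW : IsPrim W v := ⟨hv, fun t _ => by simp [W]⟩
  have hWi : IntervalIntegrable W volume 0 Real.pi := by
    have := hW.continuousOn
    rw [← uIcc_eq_I] at this
    exact this.intervalIntegrable
  -- The initial slope for which `x + D π + ∫ W` is the prescribed value `y` at `π`.
  let D : ℂ := (y - x - ∫ s in (0 : ℝ)..Real.pi, W s) / Real.pi
  have hu' : IsPrim (fun t => D + W t) v := isPrim_integral hv D
  refine ⟨fun t => x + ∫ s in (0 : ℝ)..t, (D + W s), fun t => D + W t,
    isPrim_integral (intervalIntegrable_const.add hWi) x, hu', by simp, ?_⟩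
  have hpi : (Real.pi : ℂ) ≠ 0 := by exact_mod_cast Real.pi_ne_zero
  beta_reduce
  rw [intervalIntegral.integral_add intervalIntegrable_const hWi, intervalIntegral.integral_const,
    sub_zero, Complex.real_smul]
  simp only [D]
  field_simp
  ring

/-- Since `v` is merely integrable, its primitive is only absolutely continuous, with derivative `v`
almost everywhere. -/
theorem integral_deriv_mul_primitive {e v : ℝ → ℝ} (he : ContDiff ℝ 1 e)
    (hv : IntervalIntegrable v volume 0 Real.pi) :
    ∫ t in (0 : ℝ)..Real.pi, deriv e t * ∫ s in (0 : ℝ)..t, v s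
      = e Real.pi * (∫ s in (0 : ℝ)..Real.pi, v s) - ∫ t in (0 : ℝ)..Real.pi, e t * v t := by
  have h1 : AbsolutelyContinuousOnInterval e 0 Real.pi :=
    he.contDiffOn.absolutelyContinuousOnInterval
  have h2 := hv.absolutelyContinuousOnInterval_intervalIntegral (c := 0) (by simp)
  have h3 := h1.integral_mul_deriv_eq_deriv_mul h2
  have h4 : ∫ t in (0 : ℝ)..Real.pi, e t * deriv (fun x => ∫ s in (0 : ℝ)..x, v s) t
      = ∫ t in (0 : ℝ)..Real.pi, e t * v t := by
    refine intervalIntegral.integral_congr_ae ?_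
    filter_upwards [hv.ae_hasDerivAt_integral] with t ht ht'
    rw [(ht (uIoc_subset_uIcc ht') 0 (by simp)).deriv]
  rw [h4] at h3
  rw [intervalIntegral.integral_same] at h3
  linarith

/-- Integration by parts. -/
theorem IsPrim.integral_deriv_smul {u v : ℝ → ℂ} (h : IsPrim u v) {e : ℝ → ℝ}
    (he : ContDiff ℝ 1 e) :
    ∫ t in (0 : ℝ)..Real.pi, deriv e t • u t
      = e Real.pi • u Real.pi - e 0 • u 0 - ∫ t in (0 : ℝ)..Real.pi, e t • v t := by
  have hde : Continuous (deriv e) := he.continuous_deriv le_rfl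
  have hui : IntervalIntegrable (fun t => deriv e t • u t) volume 0 Real.pi := by
    refine ContinuousOn.intervalIntegrable ?_
    rw [uIcc_eq_I]
    exact hde.continuousOn.smul h.continuousOn
  have hvi : IntervalIntegrable (fun t => e t • v t) volume 0 Real.pi :=
    h.integrable.continuousOn_smul he.continuous.continuousOn
  -- Reduction to real-valued functions: the identity is checked after every real-linear functional,
  -- in particular real and imaginary parts.
  have key : ∀ L : ℂ →L[ℝ] ℝ, L (∫ t in (0 : ℝ)..Real.pi, deriv e t • u t)
      = L (e Real.pi • u Real.pi - e 0 • u 0 - ∫ t in (0 : ℝ)..Real.pi, e t • v t) := by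
    intro L
    have hLv : IntervalIntegrable (fun t => L (v t)) volume 0 Real.pi :=
      ⟨L.integrable_comp h.integrable.1, L.integrable_comp h.integrable.2⟩
    have hLu : ∀ t ∈ I, L (u t) = L (u 0) + ∫ s in (0 : ℝ)..t, L (v s) := by
      intro t ht
      rw [h.eq_add t ht, map_add, L.intervalIntegral_comp_comm]
      exact h.integrable.mono_set (uIcc_subset_uIcc left_mem_uIcc (by rwa [uIcc_eq_I]))
    have h1 := integral_deriv_mul_primitive he hLv
    rw [map_sub, map_sub, map_smul, map_smul, ← L.intervalIntegral_comp_comm hui,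
      ← L.intervalIntegral_comp_comm hvi]
    have h2 : ∫ t in (0 : ℝ)..Real.pi, L (deriv e t • u t)
        = ∫ t in (0 : ℝ)..Real.pi, (deriv e t * L (u 0)
          + deriv e t * ∫ s in (0 : ℝ)..t, L (v s)) := by
      refine intervalIntegral.integral_congr fun t ht => ?_
      rw [uIcc_eq_I] at ht
      rw [map_smul, hLu t ht, smul_eq_mul, mul_add]
    have hprim : ContinuousOn (fun t => ∫ s in (0 : ℝ)..t, L (v s)) (uIcc 0 Real.pi) :=
      intervalIntegral.continuousOn_primitive_interval' (a := 0) hLv (by simp)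
    have hi1 : IntervalIntegrable (fun t => deriv e t * L (u 0)) volume 0 Real.pi :=
      Continuous.intervalIntegrable (by fun_prop) _ _
    have hi2 : IntervalIntegrable (fun t => deriv e t * ∫ s in (0 : ℝ)..t, L (v s))
        volume 0 Real.pi := (hde.continuousOn.fun_mul hprim).intervalIntegrable
    rw [h2, intervalIntegral.integral_add hi1 hi2, h1, intervalIntegral.integral_mul_const,
      intervalIntegral.integral_deriv_eq_sub (fun t _ => he.differentiable one_ne_zero t)
        (hde.intervalIntegrable _ _), hLu Real.pi pi_mem_I]
    simp only [map_smul, smul_eq_mul]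
    ring
  apply Complex.ext
  · exact key Complex.reCLM
  · exact key Complex.imCLM

end Primitive

/-! ### Test functions and the lemma of du Bois-Reymond -/

section TestFunctions

/-- `φ` is a test function on `(0, π)`. -/
structure IsTest (φ : ℝ → ℝ) : Prop where
  contDiff : ContDiff ℝ ∞ φ
  compact : HasCompactSupport φ
  subset : tsupport φ ⊆ Ioo 0 Real.pi

theorem IsTest.eq_zero {φ : ℝ → ℝ} (h : IsTest φ) {t : ℝ} (ht : t ∉ Ioo 0 Real.pi) : φ t = 0 :=
  image_eq_zero_of_notMem_tsupport fun h' => ht (h.subset h')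

theorem IsTest.deriv {φ : ℝ → ℝ} (h : IsTest φ) : IsTest (deriv φ) :=
  ⟨(contDiff_infty_iff_deriv.1 h.contDiff).2, h.compact.deriv,
    (tsupport_deriv_subset (𝕜 := ℝ)).trans h.subset⟩

theorem IsTest.iteratedDeriv {φ : ℝ → ℝ} (h : IsTest φ) (j : ℕ) : IsTest (iteratedDeriv j φ) := by
  induction j with
  | zero => rwa [iteratedDeriv_zero]
  | succ j ih => rw [iteratedDeriv_succ]; exact ih.deriv

theorem IsTest.sub {φ ψ : ℝ → ℝ} (hφ : IsTest φ) (hψ : IsTest ψ) : IsTest fun t => φ t - ψ t := by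
  refine ⟨hφ.contDiff.sub hψ.contDiff, hφ.compact.sub hψ.compact, ?_⟩
  exact (tsupport_sub φ ψ).trans (union_subset hφ.subset hψ.subset)

theorem IsTest.const_mul {φ : ℝ → ℝ} (hφ : IsTest φ) (c : ℝ) : IsTest fun t => c * φ t :=
  ⟨contDiff_const.mul hφ.contDiff, hφ.compact.mul_left,
    (tsupport_mul_subset_right (f := fun _ => c) (g := φ)).trans hφ.subset⟩

theorem IsPrim.integral_deriv_test {u v : ℝ → ℂ} (h : IsPrim u v) {φ : ℝ → ℝ} (hφ : IsTest φ) :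
    ∫ t, deriv φ t • u t ∂μI = -∫ t, φ t • v t ∂μI := by
  rw [integral_μI_eq, integral_μI_eq, h.integral_deriv_smul (hφ.contDiff.of_le (by simp)),
    hφ.eq_zero (by simp), hφ.eq_zero (by simp)]
  simp

/-- A test function with vanishing integral is the derivative of a test function. -/
theorem IsTest.exists_deriv_eq {ψ : ℝ → ℝ} (h : IsTest ψ)
    (h0 : ∫ t in (0 : ℝ)..Real.pi, ψ t = 0) : ∃ φ, IsTest φ ∧ _root_.deriv φ = ψ := by
  have hc := h.contDiff.continuous
  let φ : ℝ → ℝ := fun t => ∫ s in (0 : ℝ)..t, ψ s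
  have hd : ∀ t, HasDerivAt φ (ψ t) t := fun t =>
    intervalIntegral.integral_hasDerivAt_right (hc.intervalIntegrable _ _)
      hc.stronglyMeasurable.stronglyMeasurableAtFilter hc.continuousAt
  have hderiv : _root_.deriv φ = ψ := funext fun t => (hd t).deriv
  obtain ⟨α, β, hα, hβ, hsub⟩ : ∃ α β : ℝ, 0 < α ∧ β < Real.pi ∧ tsupport ψ ⊆ Icc α β := by
    rcases (tsupport ψ).eq_empty_or_nonempty with he | hne
    · exact ⟨1, 1, one_pos, by linarith [Real.pi_gt_three], by simp [he]⟩
    · have hcomp : IsCompact (tsupport ψ) := h.compact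
      obtain ⟨x, hx, hx'⟩ := hcomp.exists_isLeast hne
      obtain ⟨y, hy, hy'⟩ := hcomp.exists_isGreatest hne
      exact ⟨x, y, (h.subset hx).1, (h.subset hy).2, fun t ht => ⟨hx' ht, hy' ht⟩⟩
  have hψ0 : ∀ t, t ∉ Icc α β → ψ t = 0 := fun t ht =>
    image_eq_zero_of_notMem_tsupport fun h' => ht (hsub h')
  have hφ0 : ∀ t, t ∉ Icc α β → φ t = 0 := by
    intro t ht
    rcases lt_or_ge t α with h1 | h1
    · refine intervalIntegral.integral_zero_ae (ae_of_all _ fun s hs => hψ0 s fun hs' => ?_)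
      have := hs.2
      rcases le_max_iff.1 this with h2 | h2 <;> linarith [hs'.1]
    · have h2 : β < t := not_le.1 fun h2 => ht ⟨h1, h2⟩
      -- To the right of the support, the primitive equals the full integral, which vanishes by
      -- hypothesis.
      have h3 : ∫ s in t..Real.pi, ψ s = 0 := by
        refine intervalIntegral.integral_zero_ae (ae_of_all _ fun s hs => hψ0 s fun hs' => ?_)
        have := hs.1
        rcases min_lt_iff.1 this with h2 | h2 <;> linarith [hs'.2]
      have h4 := intervalIntegral.integral_add_adjacent_intervals (μ := volume)
        (hc.intervalIntegrable 0 t) (hc.intervalIntegrable t Real.pi)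
      change ∫ s in (0 : ℝ)..t, ψ s = 0
      linarith
  have hsupp : tsupport φ ⊆ Icc α β :=
    closure_minimal (fun t ht => by_contra fun h' => ht (hφ0 t h')) isClosed_Icc
  refine ⟨φ, ⟨?_, ?_, ?_⟩, hderiv⟩
  · rw [contDiff_infty_iff_deriv, hderiv]
    exact ⟨fun t => (hd t).differentiableAt, h.contDiff⟩
  · exact IsCompact.of_isClosed_subset isCompact_Icc (isClosed_tsupport φ) hsupp
  · exact hsupp.trans fun t ht => ⟨hα.trans_le ht.1, ht.2.trans_lt hβ⟩

theorem exists_isTest_integral_eq_one :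
    ∃ ρ, IsTest ρ ∧ ∫ t in (0 : ℝ)..Real.pi, ρ t = 1 := by
  have hpi := Real.pi_gt_three
  let B : ContDiffBump (Real.pi / 2) := ⟨1 / 2, 1, by norm_num, by norm_num⟩
  have hs : tsupport (B.normed volume) ⊆ Ioo 0 Real.pi := by
    rw [B.tsupport_normed_eq]
    intro t ht
    have h1 := abs_le.1 (Real.dist_eq t _ ▸ Metric.mem_closedBall.1 ht)
    have h2 : B.rOut = 1 := rfl
    rw [h2] at h1
    constructor <;> linarith [h1.1, h1.2]
  refine ⟨B.normed volume, ⟨B.contDiff_normed, B.hasCompactSupport_normed, hs⟩, ?_⟩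
  rw [← B.integral_normed (μ := volume), intervalIntegral.integral_of_le Real.pi_pos.le]
  refine setIntegral_eq_integral_of_forall_compl_eq_zero fun t ht => ?_
  exact image_eq_zero_of_notMem_tsupport fun h' => ht (Ioo_subset_Ioc_self (hs h'))

/-- The lemma of du Bois-Reymond. -/
theorem exists_const_of_forall_deriv_test {h : ℝ → ℂ} (hh : ContinuousOn h I)
    (H : ∀ φ, IsTest φ → ∫ t, deriv φ t • h t ∂μI = 0) : ∃ c : ℂ, EqOn h (fun _ => c) I := by
  obtain ⟨ρ, hρ, hρ1⟩ := exists_isTest_integral_eq_one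
  have hhi : Integrable h μI := hh.integrableOn_compact isCompact_Icc
  have hint : ∀ ψ, IsTest ψ → ∀ u : ℝ → ℂ, ContinuousOn u I →
      Integrable (fun t => ψ t • u t) μI := fun ψ hψ u hu =>
    (hψ.contDiff.continuous.continuousOn.smul hu).integrableOn_compact isCompact_Icc
  let c : ℂ := ∫ t, ρ t • h t ∂μI
  refine ⟨c, ?_⟩
  have key : ∀ ψ, IsTest ψ → ∫ t, ψ t • (h t - c) ∂μI = 0 := by
    intro ψ hψ
    set m := ∫ t in (0 : ℝ)..Real.pi, ψ t with hm
    -- Subtracting `m ρ` makes the integral of `ψ` vanish, so the hypothesis applies to a primitive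
    -- of the difference.
    obtain ⟨φ, hφ, hφ'⟩ := (hψ.sub (hρ.const_mul m)).exists_deriv_eq (by
      rw [intervalIntegral.integral_sub (hψ.contDiff.continuous.intervalIntegrable _ _)
        ((hρ.const_mul m).contDiff.continuous.intervalIntegrable _ _),
        intervalIntegral.integral_const_mul, hρ1, hm]
      ring)
    have h1 := H φ hφ
    rw [hφ'] at h1
    simp only [sub_smul, mul_smul] at h1
    rw [integral_sub (hint ψ hψ h hh) (show Integrable (fun t => m • ρ t • h t) μI from
        (hint ρ hρ h hh).smul m), integral_smul] at h1
    have h2 : ∫ t, ψ t • c ∂μI = m • c := by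
      rw [integral_smul_const, hm, integral_Icc_eq_integral_Ioc,
        intervalIntegral.integral_of_le Real.pi_pos.le]
    simp only [smul_sub]
    rw [integral_sub (hint ψ hψ h hh) (hint ψ hψ _ continuousOn_const), h2]
    exact h1
  have hae : ∀ᵐ t ∂μI, t ∈ Ioo 0 Real.pi → h t - c = 0 :=
    isOpen_Ioo.ae_eq_zero_of_integral_contDiff_smul_eq_zero
      ((hhi.sub (integrable_const c)).locallyIntegrable.locallyIntegrableOn _)
      fun g h1 h2 h3 => key g ⟨h1, h2, h3⟩
  have h2 : ∀ᵐ t ∂μI, t ∈ Ioo 0 Real.pi := by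
    rw [ae_restrict_congr_set Ioo_ae_eq_Icc.symm]
    exact ae_restrict_mem measurableSet_Ioo
  refine Measure.eqOn_Icc_of_ae_eq volume Real.pi_pos.ne ?_ hh continuousOn_const
  filter_upwards [hae, h2] with t h1 h2
  exact sub_eq_zero.1 (h1 h2)

/-- The lemma of du Bois-Reymond for second derivatives. -/
theorem exists_affine_of_forall_deriv_deriv_test {h : ℝ → ℂ} (hh : ContinuousOn h I)
    (H : ∀ φ, IsTest φ → ∫ t, deriv (deriv φ) t • h t ∂μI = 0) :
    ∃ c d : ℂ, EqOn h (fun t => c + d * t) I := by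
  obtain ⟨ρ, hρ, hρ1⟩ := exists_isTest_integral_eq_one
  have hint : ∀ ψ, IsTest ψ → ∀ u : ℝ → ℂ, ContinuousOn u I →
      Integrable (fun t => ψ t • u t) μI := fun ψ hψ u hu =>
    (hψ.contDiff.continuous.continuousOn.smul hu).integrableOn_compact isCompact_Icc
  -- The weak derivative of `h` paired with `ρ`, hence the slope if `h` is affine; subtracting `d t`
  -- reduces to the first order lemma.
  let d : ℂ := -∫ t, deriv ρ t • h t ∂μI
  have hlin : ContinuousOn (fun t : ℝ => d * (t : ℂ)) I := by fun_prop
  obtain ⟨c, hc⟩ := exists_const_of_forall_deriv_test (h := fun t => h t - d * t)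
    (hh.sub hlin) (by
      intro ψ hψ
      set m := ∫ t in (0 : ℝ)..Real.pi, ψ t with hm
      obtain ⟨φ, hφ, hφ'⟩ := (hψ.sub (hρ.const_mul m)).exists_deriv_eq (by
        rw [intervalIntegral.integral_sub (hψ.contDiff.continuous.intervalIntegrable _ _)
          ((hρ.const_mul m).contDiff.continuous.intervalIntegrable _ _),
          intervalIntegral.integral_const_mul, hρ1, hm]
        ring)
      have h1 := H φ hφ
      have hdd : deriv (deriv φ) = fun t => deriv ψ t - m * deriv ρ t := by
        rw [hφ']
        funext t
        rw [deriv_fun_sub ((hψ.contDiff.differentiable (by simp)) t)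
          (((hρ.const_mul m).contDiff.differentiable (by simp)) t), deriv_const_mul_field]
      rw [hdd] at h1
      simp only [sub_smul, mul_smul] at h1
      rw [integral_sub (hint _ hψ.deriv h hh) (show Integrable (fun t => m • deriv ρ t • h t) μI
        from (hint _ hρ.deriv h hh).smul m), integral_smul] at h1
      have h2 : ∫ t, ψ t • d ∂μI = m • d := by
        rw [integral_smul_const, hm, integral_Icc_eq_integral_Ioc,
          intervalIntegral.integral_of_le Real.pi_pos.le]
      have h3 := (isPrim_const_add_mul 0 d).integral_deriv_test hψ
      simp only [zero_add] at h3
      simp only [smul_sub]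
      rw [integral_sub (hint _ hψ.deriv h hh) (hint _ hψ.deriv _ hlin), h3, h2]
      simp only [d, smul_neg, sub_neg_eq_add]
      linear_combination h1)
  refine ⟨c, d, fun t ht => ?_⟩
  have := hc ht
  beta_reduce at this ⊢
  linear_combination this

end TestFunctions

/-! ### The perturbed operator and the fourth order operator -/

section SineCoefficients

theorem sinBasis_zero (k : ℕ) : sinBasis k 0 = 0 := by simp [sinBasis]

theorem sinBasis_pi (k : ℕ) : sinBasis k Real.pi = 0 := by
  have := Real.sin_nat_mul_pi (k + 1)
  push_cast at this
  simp [sinBasis, this]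

theorem contDiff_sinBasis (k : ℕ) {n : WithTop ℕ∞} : ContDiff ℝ n (sinBasis k) := by
  unfold sinBasis
  fun_prop

theorem hasDerivAt_sinBasis (k : ℕ) (t : ℝ) :
    HasDerivAt (sinBasis k) (√(2 / Real.pi) * ((k + 1) * Real.cos ((k + 1) * t))) t := by
  have h := (((hasDerivAt_id t).const_mul ((k : ℝ) + 1)).sin).const_mul √(2 / Real.pi)
  refine h.congr_deriv ?_
  simp only [id]
  ring

theorem deriv_sinBasis (k : ℕ) : deriv (sinBasis k)
    = fun t => √(2 / Real.pi) * ((k + 1) * Real.cos ((k + 1) * t)) :=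
  funext fun t => (hasDerivAt_sinBasis k t).deriv

theorem deriv_deriv_sinBasis (k : ℕ) (t : ℝ) :
    deriv (deriv (sinBasis k)) t = -((k + 1) ^ 2 * sinBasis k t) := by
  have h := ((((hasDerivAt_id t).const_mul ((k : ℝ) + 1)).cos).const_mul
    ((k : ℝ) + 1)).const_mul √(2 / Real.pi)
  rw [deriv_sinBasis]
  refine (h.congr_deriv (f := fun t => √(2 / Real.pi) * ((k + 1) * Real.cos ((k + 1) * t))) ?_).deriv
  rw [sinBasis]
  simp
  ring

theorem IsPrim.sinBasis_coeff {u u' v : ℝ → ℂ} (h : IsPrim u u') (h' : IsPrim u' v) (k : ℕ) :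
    ∫ t in (0 : ℝ)..Real.pi, sinBasis k t • v t
      = -((k : ℂ) + 1) ^ 2 * (∫ t in (0 : ℝ)..Real.pi, sinBasis k t • u t)
        - (deriv (sinBasis k) Real.pi • u Real.pi - deriv (sinBasis k) 0 • u 0) := by
  have h1 := h'.integral_deriv_smul (contDiff_sinBasis k)
  have h2 := h.integral_deriv_smul (e := deriv (sinBasis k))
    ((contDiff_infty_iff_deriv.1 (contDiff_sinBasis k)).2.of_le (by simp))
  rw [sinBasis_zero, sinBasis_pi, zero_smul, zero_smul, sub_zero, zero_sub] at h1
  have h3 : ∫ t in (0 : ℝ)..Real.pi, deriv (deriv (sinBasis k)) t • u t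
      = -((k : ℂ) + 1) ^ 2 * ∫ t in (0 : ℝ)..Real.pi, sinBasis k t • u t := by
    rw [← intervalIntegral.integral_const_mul]
    refine intervalIntegral.integral_congr fun t _ => ?_
    rw [deriv_deriv_sinBasis, Complex.real_smul, Complex.real_smul]
    push_cast
    ring
  rw [h3, h1] at h2
  linear_combination -h2

/-- The sines vanish at the end points, so each pair of integrations by parts leaves only values of
the function itself. For `F` these are zero; the values of `w = F''` survive and become the singular
part of the operator. -/
theorem sinBasis_coeff_fourth {F F' w w' g : ℝ → ℂ} (h1 : IsPrim F F') (h2 : IsPrim F' w)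
    (h3 : IsPrim w w') (h4 : IsPrim w' g) (h0 : F 0 = 0) (hpi : F Real.pi = 0) (k : ℕ) :
    ∫ t in (0 : ℝ)..Real.pi, sinBasis k t • g t
      = ((k : ℂ) + 1) ^ 4 * (∫ t in (0 : ℝ)..Real.pi, sinBasis k t • F t)
        - (deriv (sinBasis k) Real.pi • w Real.pi - deriv (sinBasis k) 0 • w 0) := by
  have e1 := h1.sinBasis_coeff h2 k
  have e2 := h3.sinBasis_coeff h4 k
  rw [h0, hpi, smul_zero, smul_zero, sub_zero, sub_zero] at e1
  rw [e2, e1]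
  ring

theorem slopeDist_eq (p q : ℂ) (k : ℕ) : slopeDist p q k
    = -(deriv (sinBasis k) 0 • p + deriv (sinBasis k) Real.pi • q) := by
  rw [slopeDist, deltaDeriv, deltaDeriv, Complex.real_smul, Complex.real_smul]
  push_cast
  ring

theorem norm_slopeDist_le (p q : ℂ) (k : ℕ) :
    ‖slopeDist p q k‖ ≤ √(2 / Real.pi) * (‖p‖ + ‖q‖) * ((k : ℝ) + 1) := by
  have h1 : ∀ t, ‖deriv (sinBasis k) t‖ ≤ √(2 / Real.pi) * ((k : ℝ) + 1) := fun t => by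
    rw [deriv_sinBasis, norm_mul, norm_mul, Real.norm_of_nonneg (Real.sqrt_nonneg _),
      Real.norm_of_nonneg (by positivity : (0 : ℝ) ≤ (k : ℝ) + 1)]
    refine mul_le_mul_of_nonneg_left ?_ (Real.sqrt_nonneg _)
    exact mul_le_of_le_one_right (by positivity) (Real.abs_cos_le_one _)
  rw [slopeDist_eq, norm_neg]
  refine (norm_add_le _ _).trans ?_
  rw [norm_smul, norm_smul]
  have e1 := mul_le_mul_of_nonneg_right (h1 0) (norm_nonneg p)
  have e2 := mul_le_mul_of_nonneg_right (h1 Real.pi) (norm_nonneg q)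
  linarith

/-- The slopes at the end points are determined by any `C¹` representative. -/
theorem HasEndSlopes.eq {f : H₀} {p q : ℂ} (h : HasEndSlopes f p q) {F : ℝ → ℂ}
    (hF : f =ᵐ[μI] F) (hF1 : ContinuousOn F I) :
    p = derivWithin F I 0 ∧ q = derivWithin F I Real.pi := by
  obtain ⟨G, hG, hG1, hp, hq⟩ := h
  have h1 : EqOn F G I := Measure.eqOn_Icc_of_ae_eq volume Real.pi_pos.ne
    (hF.symm.trans hG) hF1 hG1.continuousOn
  rw [← hp, ← hq, derivWithin_congr h1 (h1 zero_mem_I), derivWithin_congr h1 (h1 pi_mem_I)]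
  exact ⟨rfl, rfl⟩

/-- The relation bounds the coefficients of `f` by `(k+1)^(-4) (|g_k| + C (k+1))`, and `(k+1)^(s-3)`
is square-summable because `s < 5/2`. With `s = 3/2 + ε` this is the restriction `ε < 1`. -/
theorem mem_dirSubmodule_of_relation {f g : H₀} {r : ℕ → ℂ} {C s : ℝ} (hs : s < 5 / 2)
    (hr : ∀ k : ℕ, ‖r k‖ ≤ C * ((k : ℝ) + 1))
    (h : ∀ k, coeff g k = ((k : ℂ) + 1) ^ 4 * coeff f k + r k) : coeff f ∈ dirSubmodule s := by
  have hC : 0 ≤ C := by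
    have := (norm_nonneg _).trans (hr 0)
    simpa using this
  have hg : Memℓp (fun k => ((‖coeff g k‖ : ℝ) : ℂ)) 2 := by
    refine memℓp_of_norm_le (C := 1) (lp.memℓp (sineBasis.repr g)) fun k => ?_
    rw [repr_sineBasis]
    simp
  have hr' : Memℓp (fun k : ℕ => ((C * ((k : ℝ) + 1) ^ (s - 3) : ℝ) : ℂ)) 2 := by
    refine memℓp_of_norm_le (C := C) (memℓp_succ_rpow (s := s - 3) (by linarith)) fun k => ?_
    rw [Complex.ofReal_mul, norm_mul, Complex.norm_real, Real.norm_of_nonneg hC]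
  refine memℓp_of_norm_le (C := 1) (hg.add hr') fun k => ?_
  have h0 : (1 : ℝ) ≤ (k : ℝ) + 1 := by linarith [Nat.cast_nonneg (α := ℝ) k]
  have h0' : (0 : ℝ) < (k : ℝ) + 1 := by linarith
  have e1 : ‖coeff f k‖ * ((k : ℝ) + 1) ^ 4 ≤ ‖coeff g k‖ + C * ((k : ℝ) + 1) := by
    have e2 : ((k : ℂ) + 1) ^ 4 * coeff f k = coeff g k - r k := by rw [h k]; ring
    have e3 : ‖((k : ℂ) + 1) ^ 4‖ = ((k : ℝ) + 1) ^ 4 := by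
      rw [norm_pow]
      congr 1
      exact_mod_cast Complex.norm_of_nonneg h0'.le
    rw [mul_comm, ← e3, ← norm_mul, e2]
    exact (norm_sub_le _ _).trans (add_le_add le_rfl (hr k))
  rw [norm_smul, Real.norm_of_nonneg (by positivity), one_mul, Pi.add_apply, ← Complex.ofReal_add,
    Complex.norm_real, Real.norm_of_nonneg (by positivity)]
  have e4 : ((k : ℝ) + 1) ^ s = ((k : ℝ) + 1) ^ (s - 4) * ((k : ℝ) + 1) ^ 4 := by
    rw [← Real.rpow_natCast, ← Real.rpow_add h0']; norm_num
  have e5 : ((k : ℝ) + 1) ^ (s - 3) = ((k : ℝ) + 1) ^ (s - 4) * ((k : ℝ) + 1) := by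
    rw [← Real.rpow_add_one h0'.ne']; ring_nf
  have e6 : ((k : ℝ) + 1) ^ (s - 4) ≤ 1 := Real.rpow_le_one_of_one_le_of_nonpos h0 (by linarith)
  have e7 : 0 ≤ ((k : ℝ) + 1) ^ (s - 4) := by positivity
  rw [e4, e5]
  nlinarith [mul_le_mul_of_nonneg_left e1 e7, mul_le_mul_of_nonneg_right e6 (norm_nonneg (coeff g k))]

end SineCoefficients

/-! ### Equality of the two operators, and their form in sine coordinates -/

section Operators

theorem isWeakDeriv_iff {j : ℕ} {f g : H₀} {F G : ℝ → ℂ} (hF : f =ᵐ[μI] F) (hG : g =ᵐ[μI] G) :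
    IsWeakDeriv j f g ↔ ∀ φ, IsTest φ →
      ∫ t, iteratedDeriv j φ t • F t ∂μI = (-1 : ℂ) ^ j * ∫ t, φ t • G t ∂μI := by
  have e : ∀ φ : ℝ → ℝ, (∫ t, iteratedDeriv j φ t • f t ∂μI = ∫ t, iteratedDeriv j φ t • F t ∂μI)
      ∧ ∫ t, φ t • g t ∂μI = ∫ t, φ t • G t ∂μI := fun φ =>
    ⟨integral_congr_ae (hF.mono fun t ht => by beta_reduce; rw [ht]),
      integral_congr_ae (hG.mono fun t ht => by beta_reduce; rw [ht])⟩
  constructor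
  · intro h φ hφ
    rw [← (e φ).1, ← (e φ).2]
    exact h φ hφ.contDiff hφ.compact hφ.subset
  · intro h φ h1 h2 h3
    rw [(e φ).1, (e φ).2]
    exact h φ ⟨h1, h2, h3⟩

theorem IsPrim.integral_iteratedDeriv_succ {u v G : ℝ → ℂ} (h : IsPrim u v) {j : ℕ}
    (hj : ∀ φ, IsTest φ →
      ∫ t, iteratedDeriv j φ t • v t ∂μI = (-1 : ℂ) ^ j * ∫ t, φ t • G t ∂μI)
    {φ : ℝ → ℝ} (hφ : IsTest φ) :
    ∫ t, iteratedDeriv (j + 1) φ t • u t ∂μI = (-1 : ℂ) ^ (j + 1) * ∫ t, φ t • G t ∂μI := by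
  rw [iteratedDeriv_succ, h.integral_deriv_test (hφ.iteratedDeriv j), hj φ hφ]
  ring

theorem intervalIntegrable_H₀ (g : H₀) : IntervalIntegrable g volume 0 Real.pi := by
  rw [intervalIntegrable_iff_integrableOn_Icc_of_le Real.pi_pos.le]
  exact integrable_H₀ g

/-- The second derivative of the `C²` representative differs from a second primitive of `g` by an
affine function, by du Bois-Reymond. Hence it is regular enough for four integrations by parts
against the sines. -/
theorem fourthOp_subset_perturbedOp {a ε : ℝ} (hε : ε < 1) : fourthOp a ⊆ perturbedOp a ε := by
  rintro ⟨f, g⟩ ⟨-, ⟨F, hfF, hF, h0, hpi, hbc0, hbcpi⟩, hw⟩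
  dsimp only at hfF hw
  set w := iteratedDerivWithin 2 F I with hwdef
  set F' := derivWithin F I with hF'def
  have hd1 : ContDiffOn ℝ 1 F' I := hF.derivWithin uniqueDiffOn_I (by norm_num)
  have hw2 : w = derivWithin F' I := by
    funext t
    rw [hwdef, show (2 : ℕ) = 1 + 1 from rfl, iteratedDerivWithin_succ]
    congr 1
    funext t
    rw [iteratedDerivWithin_one]
  have hwc : ContinuousOn w I := by
    rw [hw2]
    exact hd1.continuousOn_derivWithin uniqueDiffOn_I le_rfl
  have hP1 : IsPrim F F' := isPrim_of_hasDerivWithinAt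
    (fun t ht => (hF.differentiableOn (by norm_num) t ht).hasDerivWithinAt) hd1.continuousOn
  have hP2 : IsPrim F' w := isPrim_of_hasDerivWithinAt
    (fun t ht => hw2 ▸ (hd1.differentiableOn (by norm_num) t ht).hasDerivWithinAt) hwc
  -- The boundary values of this second primitive are arbitrary.
  obtain ⟨W, W', hW, hW', -, -⟩ := exists_isPrim_isPrim (intervalIntegrable_H₀ g) 0 0
  have hweak := (isWeakDeriv_iff hfF (ae_eq_refl _)).1 hw
  obtain ⟨c, d, hcd⟩ := exists_affine_of_forall_deriv_deriv_test (h := fun t => w t - W t)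
    (hwc.sub hW.continuousOn) (by
      intro φ hφ
      have hi : ∀ u : ℝ → ℂ, ContinuousOn u I →
          Integrable (fun t => deriv (deriv φ) t • u t) μI := fun u hu =>
        (hφ.deriv.deriv.contDiff.continuous.continuousOn.smul hu).integrableOn_compact isCompact_Icc
      simp only [smul_sub]
      rw [integral_sub (hi _ hwc) (hi _ hW.continuousOn)]
      have e1 := hweak φ hφ
      have e2 : iteratedDeriv 4 φ = deriv (deriv (deriv (deriv φ))) := by
        simp only [iteratedDeriv_succ, iteratedDeriv_zero]
      rw [e2, hP1.integral_deriv_test hφ.deriv.deriv.deriv,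
        hP2.integral_deriv_test hφ.deriv.deriv] at e1
      rw [hW.integral_deriv_test hφ.deriv, hW'.integral_deriv_test hφ]
      linear_combination e1)
  have hP3 : IsPrim w fun t => W' t + d := by
    refine (hW.add (isPrim_const_add_mul c d)).congr fun t ht => ?_
    have := hcd ht
    beta_reduce at this ⊢
    linear_combination this
  have hP4 : IsPrim (fun t => W' t + d) g := by
    have := hW'.add (isPrim_const_add_mul d 0)
    simpa using this
  -- The boundary conditions replace `w(0)` and `w(π)` by `-a F'(0)` and `a F'(π)`, and the boundary
  -- terms become the coordinates of `a A f`.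
  have hrel : ∀ k, coeff g k = ((k : ℂ) + 1) ^ 4 * coeff f k
      + (a : ℂ) * slopeDist (F' 0) (F' Real.pi) k := by
    intro k
    rw [coeff_of_ae_eq (ae_eq_refl g), coeff_of_ae_eq hfF,
      sinBasis_coeff_fourth hP1 hP2 hP3 hP4 h0 hpi k, hbc0, hbcpi, slopeDist_eq]
    simp only [Complex.real_smul]
    ring
  refine ⟨?_, F' 0, F' Real.pi, ⟨F, hfF, hF.of_le (by norm_num), rfl, rfl⟩, hrel⟩
  refine mem_dirSubmodule_of_relation (C := |a| * (√(2 / Real.pi) * (‖F' 0‖ + ‖F' Real.pi‖)))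
    (by linarith) (fun k => ?_) hrel
  rw [norm_mul, Complex.norm_real, Real.norm_eq_abs, mul_assoc]
  exact mul_le_mul_of_nonneg_left (norm_slopeDist_le _ _ k) (abs_nonneg a)

/-- Two boundary value problems, `w'' = g` with the values of `w` dictated by the slopes of `f`,
then `F'' = w` with `F` zero at both ends, produce a function with the same sine coefficients as
`f`. -/
theorem perturbedOp_subset_fourthOp {a ε : ℝ} : perturbedOp a ε ⊆ fourthOp a := by
  rintro ⟨f, g⟩ ⟨-, p, q, hslope, hrel⟩
  dsimp only at hslope hrel
  obtain ⟨w, w', hw, hw', hw0, hwpi⟩ :=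
    exists_isPrim_isPrim (intervalIntegrable_H₀ g) (-(a : ℂ) * p) ((a : ℂ) * q)
  have hwi : IntervalIntegrable w volume 0 Real.pi :=
    ContinuousOn.intervalIntegrable (by rw [uIcc_eq_I]; exact hw.continuousOn)
  obtain ⟨F, F', hF, hF', hF0, hFpi⟩ := exists_isPrim_isPrim hwi 0 0
  have hcoef : ∀ u : ℝ → ℂ, ∀ hu : ContinuousOn u I,
      ((memLp_of_continuousOn hu).toLp u : H₀) =ᵐ[μI] u := fun u hu => MemLp.coeFn_toLp _
  have hfF : f =ᵐ[μI] F := by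
    have e : f = (memLp_of_continuousOn hF.continuousOn).toLp F := by
      refine coeff_injective (funext fun k => ?_)
      have h1 := sinBasis_coeff_fourth hF hF' hw hw' hF0 hFpi k
      rw [← coeff_of_ae_eq (hcoef F hF.continuousOn), ← coeff_of_ae_eq (ae_eq_refl g), hrel k,
        slopeDist_eq, hw0, hwpi] at h1
      have hk : ((k : ℂ) + 1) ^ 4 ≠ 0 := pow_ne_zero _ (Nat.cast_add_one_ne_zero k)
      refine mul_left_cancel₀ hk ?_
      simp only [Complex.real_smul] at h1
      linear_combination h1
    rw [e]
    exact hcoef F hF.continuousOn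
  have hd0 : ∀ t ∈ I, HasDerivWithinAt F (F' t) I t := fun t ht =>
    hF.hasDerivWithinAt hF'.continuousOn ht
  have hd1 : ∀ t ∈ I, HasDerivWithinAt F' (w t) I t := fun t ht =>
    hF'.hasDerivWithinAt hw.continuousOn ht
  have e0 : EqOn (derivWithin F I) F' I := fun t ht =>
    (hd0 t ht).derivWithin (uniqueDiffOn_I t ht)
  have e1 : EqOn (derivWithin F' I) w I := fun t ht =>
    (hd1 t ht).derivWithin (uniqueDiffOn_I t ht)
  have hC1 : ContDiffOn ℝ 1 F' I := by
    rw [show (1 : WithTop ℕ∞) = 0 + 1 from rfl, contDiffOn_succ_iff_derivWithin uniqueDiffOn_I]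
    exact ⟨fun t ht => (hd1 t ht).differentiableWithinAt, by simp,
      contDiffOn_zero.2 (hw.continuousOn.congr e1)⟩
  have hC2 : ContDiffOn ℝ 2 F I := by
    rw [show (2 : WithTop ℕ∞) = 1 + 1 from rfl, contDiffOn_succ_iff_derivWithin uniqueDiffOn_I]
    exact ⟨fun t ht => (hd0 t ht).differentiableWithinAt, by simp, hC1.congr e0⟩
  have h2 : EqOn (iteratedDerivWithin 2 F I) w I := fun t ht => by
    rw [show (2 : ℕ) = 1 + 1 from rfl, iteratedDerivWithin_succ,
      derivWithin_congr (f := F') (fun s hs => by rw [iteratedDerivWithin_one, e0 hs])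
        (by rw [iteratedDerivWithin_one, e0 ht]), e1 ht]
  obtain ⟨hp, hq⟩ := hslope.eq hfF hF.continuousOn
  have d0 : ∀ φ, IsTest φ → ∀ u : ℝ → ℂ,
      ∫ t, iteratedDeriv 0 φ t • u t ∂μI = (-1 : ℂ) ^ 0 * ∫ t, φ t • u t ∂μI := by
    intro φ _ u
    simp [iteratedDeriv_zero]
  have hweak4 : IsWeakDeriv 4 f g := by
    refine (isWeakDeriv_iff hfF (ae_eq_refl g)).2 fun φ hφ => ?_
    refine hF.integral_iteratedDeriv_succ (fun φ hφ => ?_) hφ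
    refine hF'.integral_iteratedDeriv_succ (fun φ hφ => ?_) hφ
    refine hw.integral_iteratedDeriv_succ (fun φ hφ => ?_) hφ
    exact hw'.integral_iteratedDeriv_succ (fun φ hφ => d0 φ hφ g) hφ
  refine ⟨fun j hj => ?_, ⟨F, hfF, hC2, hF0, hFpi, ?_, ?_⟩, hweak4⟩
  · interval_cases j
    · exact ⟨f, (isWeakDeriv_iff (ae_eq_refl _) (ae_eq_refl _)).2 fun φ hφ => d0 φ hφ f⟩
    · refine ⟨_, (isWeakDeriv_iff hfF (hcoef F' hF'.continuousOn)).2 fun φ hφ => ?_⟩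
      exact hF.integral_iteratedDeriv_succ (fun φ hφ => d0 φ hφ F') hφ
    · refine ⟨_, (isWeakDeriv_iff hfF (hcoef w hw.continuousOn)).2 fun φ hφ => ?_⟩
      refine hF.integral_iteratedDeriv_succ (fun φ hφ => ?_) hφ
      exact hF'.integral_iteratedDeriv_succ (fun φ hφ => d0 φ hφ w) hφ
    · refine ⟨_, (isWeakDeriv_iff hfF (hcoef w' hw'.continuousOn)).2 fun φ hφ => ?_⟩
      refine hF.integral_iteratedDeriv_succ (fun φ hφ => ?_) hφ
      refine hF'.integral_iteratedDeriv_succ (fun φ hφ => ?_) hφ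
      exact hw.integral_iteratedDeriv_succ (fun φ hφ => d0 φ hφ w') hφ
    · exact ⟨g, hweak4⟩
  · rw [h2 zero_mem_I, hw0, ← hp]
  · rw [h2 pi_mem_I, hwpi, ← hq]

/-- Splitting `k + 1` as `(k + 1)^(1 - s) (k + 1)^s` gives a product of two square-summable
sequences. -/
theorem summable_of_mem_dirSubmodule {s : ℝ} (hs : 3 / 2 < s) {u : ℕ → ℂ}
    (hu : u ∈ dirSubmodule s) : Summable fun k : ℕ => ((k : ℝ) + 1) * ‖u k‖ := by
  have h1 := (summable_mul_of_memℓp (memℓp_succ_rpow (s := 1 - s) (by linarith)) hu).norm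
  refine h1.congr fun k => ?_
  have h0 : (0 : ℝ) < (k : ℝ) + 1 := by positivity
  rw [norm_mul, norm_smul, Complex.norm_real, Real.norm_of_nonneg (by positivity),
    Real.norm_of_nonneg (by positivity), ← mul_assoc, ← Real.rpow_add h0]
  norm_num

/-- A sine series with `∑ k |u_k| < ∞` is `C¹`, and may be differentiated term by term. -/
theorem hasEndSlopes_of_summable {f : H₀}
    (hf : Summable fun k : ℕ => ((k : ℝ) + 1) * ‖coeff f k‖) :
    HasEndSlopes f (∑' k, deriv (sinBasis k) 0 • coeff f k)
      (∑' k, deriv (sinBasis k) Real.pi • coeff f k) := by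
  set u := coeff f with hu
  have hbound : Summable fun k : ℕ => √(2 / Real.pi) * (((k : ℝ) + 1) * ‖u k‖) := hf.mul_left _
  have hb0 : ∀ (k : ℕ) (t : ℝ), ‖sinBasis k t • u k‖ ≤ √(2 / Real.pi) * (((k : ℝ) + 1) * ‖u k‖) := by
    intro k t
    rw [norm_smul]
    refine (mul_le_mul_of_nonneg_right (abs_sinBasis_le k t) (norm_nonneg _)).trans ?_
    refine mul_le_mul_of_nonneg_left ?_ (Real.sqrt_nonneg _)
    nlinarith [norm_nonneg (u k), Nat.cast_nonneg (α := ℝ) k]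
  have hb1 : ∀ (k : ℕ) (t : ℝ),
      ‖deriv (sinBasis k) t • u k‖ ≤ √(2 / Real.pi) * (((k : ℝ) + 1) * ‖u k‖) := by
    intro k t
    rw [deriv_sinBasis, norm_smul, norm_mul, norm_mul, Real.norm_of_nonneg (Real.sqrt_nonneg _),
      Real.norm_of_nonneg (by positivity : (0 : ℝ) ≤ (k : ℝ) + 1), mul_assoc, mul_assoc]
    refine mul_le_mul_of_nonneg_left (mul_le_mul_of_nonneg_left ?_ (by positivity))
      (Real.sqrt_nonneg _)
    exact mul_le_of_le_one_left (norm_nonneg _) (Real.abs_cos_le_one _)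
  have hd : ∀ (k : ℕ) (t : ℝ),
      HasDerivAt (fun t => sinBasis k t • u k) (deriv (sinBasis k) t • u k) t := fun k t =>
    ((contDiff_sinBasis k (n := 1)).differentiable one_ne_zero t).hasDerivAt.smul_const (u k)
  let F : ℝ → ℂ := fun t => ∑' k, sinBasis k t • u k
  have hF : ∀ t, HasDerivAt F (∑' k, deriv (sinBasis k) t • u k) t := fun t =>
    hasDerivAt_tsum hbound hd hb1
      (y₀ := 0) (Summable.of_norm_bounded hbound fun k => hb0 k 0) t
  have hFc : Continuous F := continuous_iff_continuousAt.2 fun t => (hF t).continuousAt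
  have hF1 : ContDiff ℝ 1 F := by
    rw [contDiff_one_iff_deriv]
    refine ⟨fun t => (hF t).differentiableAt, ?_⟩
    rw [funext fun t => (hF t).deriv]
    refine continuous_tsum (fun k => ?_) hbound hb1
    rw [deriv_sinBasis]
    fun_prop
  have hfF : f =ᵐ[μI] F := by
    have e : f = (memLp_of_continuousOn hFc.continuousOn).toLp F := by
      refine coeff_injective (funext fun j => ?_)
      rw [coeff_of_ae_eq (MemLp.coeFn_toLp _), ← integral_μI_eq]
      have h1 : ∀ t, sinBasis j t • F t = ∑' k, sinBasis j t • (sinBasis k t • u k) := fun t =>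
        (tsum_const_smul'' _).symm
      simp only [h1]
      have hint : ∀ k, Integrable (fun t => sinBasis j t • (sinBasis k t • u k)) μI := fun k =>
        (((continuous_sinBasis j).smul ((continuous_sinBasis k).smul
          continuous_const)).continuousOn).integrableOn_compact isCompact_Icc
      have hs : Summable fun k => ∫ t, ‖sinBasis j t • (sinBasis k t • u k)‖ ∂μI := by
        refine Summable.of_nonneg_of_le (fun k => integral_nonneg fun _ => norm_nonneg _)
          (fun k => ?_) (hbound.mul_left (∫ _, √(2 / Real.pi) ∂μI))
        rw [← integral_mul_const]
        refine integral_mono (hint k).norm (integrable_const _) fun t => ?_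
        beta_reduce
        rw [norm_smul]
        exact mul_le_mul (abs_sinBasis_le j t) (hb0 k t) (norm_nonneg _) (Real.sqrt_nonneg _)
      rw [← (hasSum_integral_of_summable_integral_norm hint hs).tsum_eq]
      have h2 : ∀ k, ∫ t, sinBasis j t • (sinBasis k t • u k) ∂μI = if k = j then u j else 0 := by
        intro k
        simp only [smul_smul]
        rw [integral_smul_const, integral_Icc_eq_integral_Ioc,
          ← intervalIntegral.integral_of_le Real.pi_pos.le, integral_sinBasis_mul]
        by_cases h : j = k
        · simp [h]
        · simp [h, Ne.symm h]
      simp only [h2, tsum_ite_eq]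
      rfl
    rw [e]
    exact MemLp.coeFn_toLp _
  have hdw : ∀ t ∈ I, derivWithin F I t = ∑' k, deriv (sinBasis k) t • u k := fun t ht =>
    (hF t).hasDerivWithinAt.derivWithin (uniqueDiffOn_I t ht)
  exact ⟨F, hfF, hF1.contDiffOn, hdw 0 zero_mem_I, hdw Real.pi pi_mem_I⟩

theorem deriv_sinBasis_zero (k : ℕ) : deriv (sinBasis k) 0 = √(2 / Real.pi) * (k + 1) := by
  rw [deriv_sinBasis]; simp

theorem deriv_sinBasis_pi (k : ℕ) :
    deriv (sinBasis k) Real.pi = √(2 / Real.pi) * ((k + 1) * (-1) ^ (k + 1)) := by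
  have := Real.cos_nat_mul_pi (k + 1)
  push_cast at this
  rw [deriv_sinBasis]
  simp only [this]

theorem parFreq_add (k : ℕ) : (parFreq 0 k : ℂ) + parFreq 1 k = k + 1 := by
  rw [parFreq, parFreq]
  rcases Nat.mod_two_eq_zero_or_one k with h | h <;> simp [h]

theorem parFreq_sub (k : ℕ) : (parFreq 1 k : ℂ) - parFreq 0 k = (k + 1) * (-1) ^ (k + 1) := by
  rw [parFreq, parFreq, pow_succ]
  rcases Nat.mod_two_eq_zero_or_one k with h | h
  · simp [h, Even.neg_one_pow (Nat.even_iff.2 h)]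
  · simp [h, Odd.neg_one_pow (Nat.odd_iff.2 h)]

/-- The perturbation `a A` in sine coordinates, split by parity. -/
theorem slopeDist_eq_parFreq {u : ℕ → ℂ} (hu : Summable fun k : ℕ => ((k : ℝ) + 1) * ‖u k‖)
    (k : ℕ) : slopeDist (∑' m, deriv (sinBasis m) 0 • u m) (∑' m, deriv (sinBasis m) Real.pi • u m) k
      = -((4 / Real.pi : ℝ) : ℂ) * ∑ i, (parFreq i k : ℂ) * ∑' m, (parFreq i m : ℂ) * u m := by
  set s : Fin 2 → ℂ := fun i => ∑' m, (parFreq i m : ℂ) * u m with hs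
  have hsum : ∀ i, HasSum (fun m => (parFreq i m : ℂ) * u m) (s i) := fun i => by
    refine Summable.hasSum (Summable.of_norm_bounded hu fun k => ?_)
    rw [norm_mul, Complex.norm_real, Real.norm_of_nonneg (parFreq_nonneg i k)]
    exact mul_le_mul_of_nonneg_right (parFreq_le i k) (norm_nonneg _)
  have hp : ∑' m, deriv (sinBasis m) 0 • u m = √(2 / Real.pi) * (s 0 + s 1) := by
    rw [← (((hsum 0).add (hsum 1)).mul_left (√(2 / Real.pi) : ℂ)).tsum_eq]
    refine tsum_congr fun m => ?_
    rw [deriv_sinBasis_zero, Complex.real_smul, ← add_mul, parFreq_add]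
    push_cast
    ring
  have hq : ∑' m, deriv (sinBasis m) Real.pi • u m = √(2 / Real.pi) * (s 1 - s 0) := by
    rw [← (((hsum 1).sub (hsum 0)).mul_left (√(2 / Real.pi) : ℂ)).tsum_eq]
    refine tsum_congr fun m => ?_
    rw [deriv_sinBasis_pi, Complex.real_smul, ← sub_mul, parFreq_sub]
    push_cast
    ring
  have e3 : (√(2 / Real.pi) : ℂ) * √(2 / Real.pi) = 2 / Real.pi := by
    rw [← Complex.ofReal_mul, Real.mul_self_sqrt (by positivity)]
    push_cast
    rfl
  rw [slopeDist_eq, hp, hq, deriv_sinBasis_zero, deriv_sinBasis_pi, Fin.sum_univ_two,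
    Complex.real_smul, Complex.real_smul]
  -- The mixed terms of `(p₀ + p₁)(s₀ + s₁) + (p₁ - p₀)(s₁ - s₀)` cancel, leaving `2 (p₀ s₀ + p₁
  -- s₁)`. With the factor `2/π` from the normalization, this gives `4/π`.
  change _ = -((4 / Real.pi : ℝ) : ℂ) * ((parFreq 0 k : ℂ) * s 0 + (parFreq 1 k : ℂ) * s 1)
  have e1 := parFreq_add k
  have e2 := parFreq_sub k
  push_cast
  rw [← e2, ← e1]
  linear_combination (-2 : ℂ) * ((parFreq 0 k : ℂ) * s 0 + (parFreq 1 k : ℂ) * s 1) * e3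

/-- The weaker domain condition `∑ (k + 1) |f_k| < ∞` already gives `f` slopes at the end points.
The relation between `f` and `g` then improves it to membership in `H₀^(3/2 + ε)` for every `ε < 1`.
-/
theorem perturbedOp_eq_opGraph {a ε : ℝ} (hε : 0 < ε) (hε' : ε < 1) :
    perturbedOp a ε = opGraph sineBasis (4 * a / Real.pi) := by
  have hrel : ∀ f : H₀, (Summable fun k : ℕ => ((k : ℝ) + 1) * ‖coeff f k‖) → ∀ k,
      (a : ℂ) * slopeDist (∑' m, deriv (sinBasis m) 0 • coeff f m)
        (∑' m, deriv (sinBasis m) Real.pi • coeff f m) k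
      = -(((4 * a / Real.pi : ℝ) : ℂ) * ∑ i, (parFreq i k : ℂ)
        * ∑' m, (parFreq i m : ℂ) * coeff f m) := by
    intro f hf k
    rw [slopeDist_eq_parFreq hf]
    push_cast
    ring
  have hbi : ∀ k : ℕ, (biEig k : ℂ) = ((k : ℂ) + 1) ^ 4 := fun k => by
    rw [biEig]; push_cast; rfl
  ext ⟨f, g⟩
  simp only [perturbedOp, opGraph, mem_ofPred_eq, repr_sineBasis, hbi]
  constructor
  · rintro ⟨h1, p, q, hpq, h2⟩
    have hs := summable_of_mem_dirSubmodule (by linarith) h1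
    have hsl := hasEndSlopes_of_summable hs
    obtain ⟨F, hF, hF1, hFp, hFq⟩ := hsl
    obtain ⟨hp, hq⟩ := hpq.eq hF hF1.continuousOn
    refine ⟨hs, fun k => ?_⟩
    rw [h2 k, hp, hq, hFp, hFq, hrel f hs k]
    ring
  · rintro ⟨hs, h2⟩
    have h3 : ∀ k, coeff g k = ((k : ℂ) + 1) ^ 4 * coeff f k
        + (a : ℂ) * slopeDist (∑' m, deriv (sinBasis m) 0 • coeff f m)
          (∑' m, deriv (sinBasis m) Real.pi • coeff f m) k := fun k => by
      rw [h2 k, hrel f hs k]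
      ring
    refine ⟨?_, _, _, hasEndSlopes_of_summable hs, h3⟩
    refine mem_dirSubmodule_of_relation (C := |a| * (√(2 / Real.pi)
      * (‖∑' m, deriv (sinBasis m) 0 • coeff f m‖
        + ‖∑' m, deriv (sinBasis m) Real.pi • coeff f m‖))) (by linarith) (fun k => ?_) h3
    rw [norm_mul, Complex.norm_real, Real.norm_eq_abs, mul_assoc]
    exact mul_le_mul_of_nonneg_left (norm_slopeDist_le _ _ k) (abs_nonneg a)

end Operators

/-! ### The Dirichlet scale as images of multipliers on `L²` -/

section DirichletScale

theorem succ_rpow_mul_neg (k : ℕ) (s : ℝ) :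
    ((k : ℝ) + 1) ^ s * ((k : ℝ) + 1) ^ (-s) = 1 := by
  rw [← Real.rpow_add (by positivity), add_neg_cancel, Real.rpow_zero]

/-- `DirSob.toLp` as an isometric isomorphism. -/
def dirSobEquiv (s : ℝ) : DirSob s ≃ₗᵢ[ℂ] lp (fun _ : ℕ => ℂ) 2 where
  toLinearEquiv := LinearEquiv.ofBijective (DirSob.toLp s) ⟨DirSob.toLp_injective s, fun x => by
    have e : (fun k : ℕ => ((k : ℝ) + 1) ^ s • (((k : ℝ) + 1) ^ (-s) • x k)) = x := by
      funext k
      rw [smul_smul, succ_rpow_mul_neg, one_smul]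
    refine ⟨⟨fun k => ((k : ℝ) + 1) ^ (-s) • x k, ?_⟩, Subtype.ext e⟩
    have h := lp.memℓp x
    rw [← e] at h
    exact h⟩
  norm_map' _ := rfl

theorem dirSobEquiv_apply {s : ℝ} (u : DirSob s) (k : ℕ) :
    dirSobEquiv s u k = ((k : ℝ) + 1) ^ s • u.seq k := rfl

instance (s : ℝ) : CompleteSpace (DirSob s) :=
  (dirSobEquiv s).toIsometryEquiv.completeSpace

/-- The operator `(-Δ₀) ^ (s/2)` on `L²([0, π])`, for `s ≤ 0`. -/
def sineScale (s : ℝ) : H₀ →L[ℂ] H₀ := diagOp sineBasis fun k => ((((k : ℝ) + 1) ^ s : ℝ) : ℂ)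

theorem bddSeq_succ_rpow {s : ℝ} (hs : s ≤ 0) :
    BddSeq fun k : ℕ => ((((k : ℝ) + 1) ^ s : ℝ) : ℂ) := by
  refine ⟨1, fun k => ?_⟩
  rw [Complex.norm_real, Real.norm_of_nonneg (by positivity)]
  exact Real.rpow_le_one_of_one_le_of_nonpos (by linarith [Nat.cast_nonneg (α := ℝ) k]) hs

theorem repr_sineScale {s : ℝ} (hs : s ≤ 0) (f : H₀) (k : ℕ) :
    sineBasis.repr (sineScale s f) k = ((k : ℝ) + 1) ^ s • sineBasis.repr f k := by
  rw [sineScale, repr_diagOp _ (bddSeq_succ_rpow hs), Complex.real_smul]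

theorem denseRange_sineScale {s : ℝ} (hs : s ≤ 0) : DenseRange (sineScale s) := by
  have h1 := Submodule.dense_iff_topologicalClosure_eq_top.2 sineBasis.dense_span
  refine h1.mono ?_
  rw [← ContinuousLinearMap.coe_coe, ← LinearMap.coe_range, SetLike.coe_subset_coe,
    Submodule.span_le]
  rintro _ ⟨k, rfl⟩
  have hk : ((((k : ℝ) + 1) ^ s : ℝ) : ℂ) ≠ 0 :=
    Complex.ofReal_ne_zero.2 (Real.rpow_pos_of_pos (by positivity) s).ne'
  refine ⟨(((((k : ℝ) + 1) ^ s : ℝ) : ℂ))⁻¹ • sineBasis k, ?_⟩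
  rw [ContinuousLinearMap.coe_coe, map_smul, sineScale, diagOp_basis _ (bddSeq_succ_rpow hs),
    smul_smul, inv_mul_cancel₀ hk, one_smul]

/-- The function with coefficients `u`, for `u ∈ H₀^s` and `s ≥ 0`, is `sineScale (-s) x` with
`‖x‖ = ‖u‖`. -/
theorem coeff_sineScale {s : ℝ} (hs : 0 ≤ s) (u : DirSob s) :
    coeff (sineScale (-s) (sineBasis.repr.symm (dirSobEquiv s u))) = u.seq := by
  funext k
  rw [← repr_sineBasis, repr_sineScale (by linarith), LinearIsometryEquiv.apply_symm_apply,
    dirSobEquiv_apply, smul_smul, mul_comm, succ_rpow_mul_neg, one_smul]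

theorem range_sineScale {s : ℝ} (hs : 0 ≤ s) :
    range (sineScale (-s)) = {f : H₀ | coeff f ∈ dirSubmodule s} := by
  ext f
  constructor
  · rintro ⟨x, rfl⟩
    have h := lp.memℓp (sineBasis.repr x)
    refine (congrArg (fun v : ℕ → ℂ => Memℓp v 2) (funext fun k => ?_)).mp h
    rw [← repr_sineBasis, repr_sineScale (by linarith), smul_smul, succ_rpow_mul_neg, one_smul]
  · exact fun hf => ⟨_, coeff_injective (coeff_sineScale hs ⟨coeff f, hf⟩)⟩

/-- The isometry of `L²([0, π])` onto `H₀^s` which divides the coefficients by `(k + 1) ^ s`. -/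
def sineDirSobEquiv (s : ℝ) : H₀ ≃ₗᵢ[ℂ] DirSob s := sineBasis.repr.trans (dirSobEquiv s).symm

/-- The embedding of `L²([0, π])` into `H₀^s`, for `s ≤ 0`. -/
def toDirSob (s : ℝ) : H₀ →L[ℂ] DirSob s :=
  (sineDirSobEquiv s).toContinuousLinearEquiv.toContinuousLinearMap.comp (sineScale s)

theorem toDirSob_apply (s : ℝ) (f : H₀) : toDirSob s f = sineDirSobEquiv s (sineScale s f) := rfl

theorem toDirSob_seq {s : ℝ} (hs : s ≤ 0) (f : H₀) : (toDirSob s f).seq = coeff f := by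
  have h : dirSobEquiv s (toDirSob s f) = sineBasis.repr (sineScale s f) := by
    rw [toDirSob_apply, sineDirSobEquiv, LinearIsometryEquiv.trans_apply,
      LinearIsometryEquiv.apply_symm_apply]
  funext k
  have hk : dirSobEquiv s (toDirSob s f) k = sineBasis.repr (sineScale s f) k := by rw [h]
  rw [dirSobEquiv_apply, repr_sineScale hs, repr_sineBasis] at hk
  exact smul_right_injective ℂ (Real.rpow_pos_of_pos (by positivity) s).ne' hk

theorem norm_toDirSob {s : ℝ} (f : H₀) : ‖toDirSob s f‖ = ‖sineScale s f‖ := by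
  rw [toDirSob_apply, LinearIsometryEquiv.norm_map]

theorem denseRange_toDirSob {s : ℝ} (hs : s ≤ 0) : DenseRange (toDirSob s) := by
  have h := (sineDirSobEquiv s).surjective.denseRange.comp (denseRange_sineScale hs)
    (sineDirSobEquiv s).continuous
  exact h

end DirichletScale

/-! ### The operator `A` between Sobolev spaces -/

section SlopeOperator

theorem exists_tsum_le_norm {s : ℝ} (hs : 3 / 2 < s) : ∃ C, 0 ≤ C ∧ ∀ u : DirSob s,
    ∑' k : ℕ, ((k : ℝ) + 1) * ‖u.seq k‖ ≤ C * ‖u‖ := by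
  have hw := memℓp_two_iff.1 (memℓp_succ_rpow (s := 1 - s) (by linarith))
  refine ⟨(∑' k : ℕ, ‖((((k : ℝ) + 1) ^ (1 - s) : ℝ) : ℂ)‖ ^ (2 : ℝ)) ^ (1 / (2 : ℝ)),
    Real.rpow_nonneg (tsum_nonneg fun k => by positivity) _, fun u => ?_⟩
  have hu := memℓp_two_iff.1 (lp.memℓp (dirSobEquiv s u))
  have h1 := Real.inner_le_Lp_mul_Lq_tsum_of_nonneg Real.HolderConjugate.two_two
    (fun k : ℕ => norm_nonneg ((((k : ℝ) + 1) ^ (1 - s) : ℝ) : ℂ))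
    (fun k => norm_nonneg (dirSobEquiv s u k)) (by simpa only [Real.rpow_two] using hw)
    (by simpa only [Real.rpow_two] using hu)
  have h2 : ‖u‖ = (∑' k, ‖dirSobEquiv s u k‖ ^ (2 : ℝ)) ^ (1 / (2 : ℝ)) := by
    rw [← (dirSobEquiv s).norm_map u, lp.norm_eq_tsum_rpow (by norm_num)]
    norm_num
  rw [h2]
  refine le_trans (le_of_eq (tsum_congr fun k => ?_)) h1
  have h0 : (0 : ℝ) < (k : ℝ) + 1 := by positivity
  rw [dirSobEquiv_apply, norm_smul, Complex.norm_real, Real.norm_of_nonneg (by positivity),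
    Real.norm_of_nonneg (by positivity), ← mul_assoc, ← Real.rpow_add h0, sub_add_cancel,
    Real.rpow_one]

theorem norm_deriv_sinBasis_le (k : ℕ) (t : ℝ) :
    ‖deriv (sinBasis k) t‖ ≤ √(2 / Real.pi) * ((k : ℝ) + 1) := by
  rw [deriv_sinBasis, norm_mul, norm_mul, Real.norm_of_nonneg (Real.sqrt_nonneg _),
    Real.norm_of_nonneg (by positivity : (0 : ℝ) ≤ (k : ℝ) + 1), ← mul_assoc]
  exact mul_le_of_le_one_right (by positivity) (Real.abs_cos_le_one _)

theorem norm_deriv_smul_le (u : ℕ → ℂ) (t : ℝ) (k : ℕ) :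
    ‖deriv (sinBasis k) t • u k‖ ≤ √(2 / Real.pi) * (((k : ℝ) + 1) * ‖u k‖) := by
  rw [norm_smul, ← mul_assoc]
  exact mul_le_mul_of_nonneg_right (norm_deriv_sinBasis_le k t) (norm_nonneg _)

/-- The derivative at `t` of the functions in `H₀^s`, for `s > 3/2`. -/
theorem exists_slope {s : ℝ} (hs : 3 / 2 < s) (t : ℝ) : ∃ D : DirSob s →L[ℂ] ℂ,
    ∀ u : DirSob s, D u = ∑' k, deriv (sinBasis k) t • u.seq k := by
  obtain ⟨C, hC, hbound⟩ := exists_tsum_le_norm hs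
  have hmaj : ∀ u : DirSob s, Summable fun k : ℕ =>
      √(2 / Real.pi) * (((k : ℝ) + 1) * ‖u.seq k‖) := fun u =>
    (summable_of_mem_dirSubmodule hs u.2).mul_left _
  have hsum : ∀ u : DirSob s, Summable fun k => deriv (sinBasis k) t • u.seq k := fun u =>
    Summable.of_norm_bounded (hmaj u) fun k => norm_deriv_smul_le _ t k
  refine ⟨LinearMap.mkContinuous
    { toFun := fun u => ∑' k, deriv (sinBasis k) t • u.seq k
      map_add' := fun u v => by
        rw [← (hsum u).tsum_add (hsum v)]
        exact tsum_congr fun k => smul_add _ _ _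
      map_smul' := fun c u => by
        rw [RingHom.id_apply, ← tsum_const_smul'']
        exact tsum_congr fun k => smul_comm (deriv (sinBasis k) t) c (u.seq k) } (√(2 / Real.pi) * C) fun u => ?_,
    fun u => rfl⟩
  refine (tsum_of_norm_bounded (hmaj u).hasSum fun k => norm_deriv_smul_le _ t k).trans ?_
  rw [tsum_mul_left, mul_assoc]
  exact mul_le_mul_of_nonneg_left (hbound u) (Real.sqrt_nonneg _)

theorem mem_dirSubmodule_of_norm_le {s C : ℝ} (hs : s < -(3 / 2)) {v : ℕ → ℂ}
    (h : ∀ k : ℕ, ‖v k‖ ≤ C * ((k : ℝ) + 1)) : v ∈ dirSubmodule s := by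
  refine memℓp_of_norm_le (memℓp_succ_rpow (s := s + 1) (by linarith)) (C := C) fun k => ?_
  have h0 : (0 : ℝ) < (k : ℝ) + 1 := by positivity
  rw [norm_smul, Complex.norm_real, Real.norm_of_nonneg (by positivity),
    Real.norm_of_nonneg (by positivity), Real.rpow_add_one h0.ne', mul_left_comm]
  exact mul_le_mul_of_nonneg_left (h k) (by positivity)

theorem exists_slopeDist {s : ℝ} (hs : s < -(3 / 2)) : ∃ B : ℂ × ℂ →L[ℂ] DirSob s,
    ∀ p, (B p).seq = slopeDist p.1 p.2 := by
  let B : ℂ × ℂ →ₗ[ℂ] DirSob s :=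
    { toFun := fun p =>
        ⟨slopeDist p.1 p.2, mem_dirSubmodule_of_norm_le hs (norm_slopeDist_le _ _)⟩
      map_add' := fun p q => Subtype.ext <| funext fun k => by
        change slopeDist _ _ k = slopeDist _ _ k + slopeDist _ _ k
        simp only [slopeDist, Prod.fst_add, Prod.snd_add]
        ring
      map_smul' := fun c p => Subtype.ext <| funext fun k => by
        change slopeDist _ _ k = c * slopeDist _ _ k
        simp only [slopeDist, Prod.smul_fst, Prod.smul_snd, smul_eq_mul]
        ring }
  exact ⟨B.toContinuousLinearMap, fun p => rfl⟩

/-- The operator factors through `ℂ²`: the two end slopes are bounded functionals on `H₀^s` for `s >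
3/2`, and the two derivatives of `δ` lie in `H₀^s` for `s < -3/2`. -/
theorem exists_slopeOperator {ε : ℝ} (hε : 0 < ε) :
    ∃ A : DirSob (3 / 2 + ε) →L[ℂ] DirSob (-(3 / 2) - ε),
      ∀ u : DirSob (3 / 2 + ε), ∃ f : H₀, coeff f = u.seq ∧
        ∃ p q : ℂ, HasEndSlopes f p q ∧ (A u).seq = slopeDist p q := by
  have hs : 3 / 2 < 3 / 2 + ε := by linarith
  obtain ⟨D₀, h₀⟩ := exists_slope hs 0
  obtain ⟨D₁, h₁⟩ := exists_slope hs Real.pi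
  obtain ⟨B, hB⟩ := exists_slopeDist (s := -(3 / 2) - ε) (by linarith)
  refine ⟨B.comp (D₀.prod D₁), fun u => ⟨_, coeff_sineScale (by linarith) u, D₀ u, D₁ u, ?_, hB _⟩⟩
  have hu := coeff_sineScale (by linarith) u
  have h := hasEndSlopes_of_summable (f := sineScale _ (sineBasis.repr.symm (dirSobEquiv _ u)))
    (by rw [hu]; exact summable_of_mem_dirSubmodule hs u.2)
  rw [h₀, h₁]
  rwa [hu] at h

end SlopeOperator

/-! ### From factorizations of operators to interpolation spaces -/

section Interpolation

/-- The space `X` has dense image both in the completion and, through `T`, in `Y`. The two seminorms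
it inherits are equivalent, so the identity of `X` extends to an isomorphism. -/
theorem exists_completion_equiv {X Y : Type*} [NormedAddCommGroup X] [NormedSpace ℂ X]
    [NormedAddCommGroup Y] [NormedSpace ℂ Y] [CompleteSpace Y] (J : X →L[ℂ] X) (T : X →L[ℂ] Y)
    (hT : DenseRange T) {c C : ℝ} (h1 : ∀ x, ‖T x‖ ≤ C * ‖J x‖) (h2 : ∀ x, ‖J x‖ ≤ c * ‖T x‖) :
    ∃ Φ : UniformSpace.Completion (NormedVia J) ≃L[ℂ] Y,
      ∀ x, Φ (NormedVia.of J x : UniformSpace.Completion (NormedVia J)) = T x := by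
  let e : NormedVia J ≃ₗ[ℂ] X := LinearEquiv.refl ℂ X
  let i : NormedVia J →ₗ[ℂ] UniformSpace.Completion (NormedVia J) :=
    (UniformSpace.Completion.toComplL (𝕜 := ℂ) (E := NormedVia J)).toLinearMap
  have hi : DenseRange i := UniformSpace.Completion.denseRange_coe
  have hn : ∀ x : NormedVia J, ‖i x‖ = ‖J (e x)‖ := fun x => UniformSpace.Completion.norm_coe x
  have h1' : ∃ C, ∀ x, ‖T.toLinearMap (e x)‖ ≤ C * ‖i x‖ :=
    ⟨C, fun x => by rw [hn]; exact h1 _⟩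
  have h2' : ∃ C, ∀ x, ‖i (e.symm x)‖ ≤ C * ‖T.toLinearMap x‖ :=
    ⟨c, fun x => by rw [hn, LinearEquiv.apply_symm_apply]; exact h2 x⟩
  exact ⟨e.extend i T.toLinearMap hi h1' hT h2',
    fun x => e.extend_eq i T.toLinearMap hi h1' hT h2' (NormedVia.of J x)⟩

variable {H : Type*} [NormedAddCommGroup H] [InnerProductSpace ℂ H]

theorem diagOp_injective {ι : Type*} (b : HilbertBasis ι ℂ H) {m : ι → ℂ} (hm : BddSeq m)
    (h0 : ∀ i, m i ≠ 0) : Function.Injective (diagOp b m) := by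
  refine fun x y h => ext_repr b fun i => ?_
  have hi := congrArg (fun z => b.repr z i) h
  simp only [repr_diagOp b hm] at hi
  exact mul_left_cancel₀ (h0 i) hi

/-- The comparison is known at one large `κ'`. Passing from `κ` to `κ'` in the eigenbasis, and from
`κ' + d` to `d` in the sine basis, perturbs the weights by bounded amounts and contributes the
factors `X` and `Y`. -/
theorem exists_isUnit_fracPow_of_gap [CompleteSpace H] (b : HilbertBasis ℕ ℂ H) {ι : Type*}
    {φ : HilbertBasis ι ℂ H} {l : ι → ℝ} {β κ₀ α κ δ : ℝ} (hκ₀ : 1 ≤ κ₀)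
    (hβ : ∀ κ, κ₀ ≤ κ → ∀ i, |β * kreinSum κ i| ≤ 1 / 2) (hl : ∀ i, -κ₀ < l i)
    (hφ : ∀ κ, κ₀ ≤ κ → ∀ i, kreinRes b β κ (φ i) = (((κ + l i)⁻¹ : ℝ) : ℂ) • φ i)
    (hδ : 0 < δ) (hκ : ∀ i, δ ≤ κ + l i) (hα : 0 ≤ α) (hα' : α < 5 / 8) :
    ∃ W : H →L[ℂ] H, IsUnit W ∧ diagOp φ (fun i => (((κ + l i) ^ (-α) : ℝ) : ℂ))
      = diagOp b (fun k => ((((k : ℝ) + 1) ^ (-(4 * α)) : ℝ) : ℂ)) * W := by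
  rcases hα.eq_or_lt with rfl | hα0
  · refine ⟨1, isUnit_one, ?_⟩
    simp [diagOp_one]
  obtain ⟨κ', hκ', W, hW, hWe⟩ := exists_isUnit_fracPow b hκ₀ hβ hl hφ hα0 hα'
  -- The lower bound `min δ 1` serves both weights, as `κ' + l i ≥ 1` by the choice `κ' ≥ κ₀ + 1`.
  obtain ⟨X, hX, hXe⟩ := exists_isUnit_diagOp_rpow φ (w := fun i => κ + l i)
    (w' := fun i => κ' + l i) (δ := min δ 1) (M := |κ - κ'|) (lt_min hδ one_pos)
    (fun i => (min_le_left _ _).trans (hκ i))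
    (fun i => (min_le_right _ _).trans (by linarith [hl i]))
    (fun i => by rw [add_sub_add_right_eq_sub]) hα
  obtain ⟨Y, hY, hYe⟩ := exists_isUnit_diagOp_rpow b (w := fun k => κ' + biEig k)
    (w' := biEig) (δ := 1) (M := κ') one_pos (fun k => by linarith [one_le_biEig k])
    one_le_biEig (fun k => by rw [add_sub_cancel_right, abs_of_nonneg (by linarith)]) hα
  refine ⟨Y * W * X, (hY.mul hW).mul hX, ?_⟩
  have he : ∀ k : ℕ, biEig k ^ (-α) = ((k : ℝ) + 1) ^ (-(4 * α)) := fun k => by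
    rw [biEig_eq_rpow, ← Real.rpow_mul (by positivity), mul_neg]
  rw [hXe, hWe, hYe, mul_assoc, mul_assoc, mul_assoc]
  simp only [he]

theorem range_mul_of_isUnit {X : Type*} [NormedAddCommGroup X] [NormedSpace ℂ X] {E W : X →L[ℂ] X}
    (hW : IsUnit W) : range (E * W) = range E := by
  obtain ⟨V, hV, -⟩ := isUnit_iff_exists.1 hW
  refine Subset.antisymm (by rintro _ ⟨x, rfl⟩; exact ⟨W x, rfl⟩) ?_
  rintro _ ⟨x, rfl⟩
  refine ⟨V x, ?_⟩
  change E ((W * V) x) = _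
  rw [hV, one_apply_eq_self]

theorem interpNorm_eq {X : Type*} [NormedAddCommGroup X] [NormedSpace ℂ X] {S : ℝ → X →L[ℂ] X}
    {κ α : ℝ} (h : Function.Injective (negPow S κ α)) (x : X) :
    interpNorm S κ α (negPow S κ α x) = ‖x‖ := by
  have : {r | ∃ y, negPow S κ α y = negPow S κ α x ∧ r = ‖y‖} = {‖x‖} := by
    ext r
    constructor
    · rintro ⟨y, hy, rfl⟩
      rw [h hy]; rfl
    · rintro rfl
      exact ⟨x, rfl, rfl⟩
  rw [interpNorm, this, csInf_singleton]

end Interpolation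

end InterpFourth

end

/-! ### The main theorem -/

open InterpFourth in
theorem proposition3p5 (a : ℝ) :
    -- `A f = f'(0) δ₀' + f'(π) δ_π'` is a well-defined bounded operator between the stated spaces
    (∀ ε : ℝ, 0 < ε → ∃ A : DirSob (3 / 2 + ε) →L[ℂ] DirSob (-(3 / 2) - ε),
      ∀ u : DirSob (3 / 2 + ε), ∃ f : H₀, coeff f = u.seq ∧
        ∃ p q : ℂ, HasEndSlopes f p q ∧ (A u).seq = slopeDist p q) ∧
    -- `Δ₀² + a A = ℒ_a`, as unbounded operators in `L²([0, π])`
    (∀ ε : ℝ, 0 < ε → ε < 1 → perturbedOp a ε = fourthOp a) ∧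
    -- they generate an analytic semigroup `S(τ) = exp (-τ ℒ_a)` on `L²([0, π])`
    ∃ S : ℝ → H₀ →L[ℂ] H₀, IsAnalyticSemigroup S ∧
      (∀ ε : ℝ, 0 < ε → ε < 1 → generator S = negOp (perturbedOp a ε)) ∧
      generator S = negOp (fourthOp a) ∧
      -- its interpolation spaces are those of the Dirichlet Laplacian, with equivalent norms
      (∃ κ : ℝ, IsAdmissibleShift S κ) ∧
      ∀ κ : ℝ, IsAdmissibleShift S κ →
        (∀ α : ℝ, 0 ≤ α → Function.Injective (negPow S κ α)) ∧
        (∀ α : ℝ, 0 ≤ α → α < 5 / 8 →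
          interpDomain S κ α = {f : H₀ | coeff f ∈ dirSubmodule (4 * α)} ∧
          ∃ c C : ℝ, 0 < c ∧ 0 < C ∧ ∀ (f : H₀) (u : DirSob (4 * α)), coeff f = u.seq →
            c * ‖u‖ ≤ interpNorm S κ α f ∧ interpNorm S κ α f ≤ C * ‖u‖) ∧
        (∀ α : ℝ, -(5 / 8) < α → α < 0 →
          ∃ Φ : InterpNeg S κ (-α) ≃L[ℂ] DirSob (4 * α),
            ∀ f : H₀, (Φ (InterpNeg.of S κ (-α) f)).seq = coeff f) := by
  have heq : ∀ ε : ℝ, 0 < ε → ε < 1 → perturbedOp a ε = fourthOp a := fun ε _ hε' =>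
    perturbedOp_subset_fourthOp.antisymm (fourthOp_subset_perturbedOp hε')
  refine ⟨fun ε => exists_slopeOperator, heq, ?_⟩
  obtain ⟨κ₀, hκ₀, hβ⟩ := exists_krein_bound (4 * a / Real.pi)
  obtain ⟨ι, φ, l, hl, hφ, hgraph⟩ := exists_opGraph_diagonal sineBasis hκ₀ hβ
  have hl' : ∀ i, -κ₀ ≤ l i := fun i => (hl i).le
  have hgen : generator (diagSemigroup φ l) = negOp (fourthOp a) := by
    -- Any `ε` between `0` and `1` serves here.
    rw [← heq (1 / 2) (by norm_num) (by norm_num),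
      perturbedOp_eq_opGraph (by norm_num) (by norm_num), hgraph, generator_diagSemigroup φ hl']
    ext p
    refine forall_congr' fun i => ?_
    change _ ↔ φ.repr (-p.2) i = _
    rw [map_neg, lp.coeFn_neg, Pi.neg_apply, neg_eq_iff_eq_neg, neg_mul]
  refine ⟨diagSemigroup φ l, isAnalyticSemigroup_diagSemigroup φ hl',
    fun ε h h' => by rw [heq ε h h', hgen], hgen, ⟨_, isAdmissibleShift_diagSemigroup φ hl'⟩,
    fun κ hκ => ?_⟩
  obtain ⟨δ, hδ, hgap⟩ := exists_gap_of_isAdmissibleShift φ hl' hκ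
  have hpow : ∀ α : ℝ, 0 ≤ α → negPow (diagSemigroup φ l) κ α
      = diagOp φ fun i => (((κ + l i) ^ (-α) : ℝ) : ℂ) := fun α hα =>
    negPow_diagSemigroup φ hl' hδ hgap hα
  have hinj : ∀ α : ℝ, 0 ≤ α → Function.Injective (negPow (diagSemigroup φ l) κ α) :=
    fun α hα => by
      rw [hpow α hα]
      exact diagOp_injective φ (bddSeq_rpow_neg hδ hgap hα) fun i =>
        Complex.ofReal_ne_zero.2 (Real.rpow_pos_of_pos (hδ.trans_le (hgap i)) _).ne'
  have hfac : ∀ α : ℝ, 0 ≤ α → α < 5 / 8 → ∃ W : H₀ →L[ℂ] H₀, IsUnit W ∧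
      negPow (diagSemigroup φ l) κ α = sineScale (-(4 * α)) * W := fun α hα hα' => by
    rw [hpow α hα]
    exact exists_isUnit_fracPow_of_gap sineBasis hκ₀ hβ hl hφ hδ hgap hα hα'
  refine ⟨hinj, fun α hα hα' => ?_, fun α hα hα' => ?_⟩
  · obtain ⟨W, hW, hWe⟩ := hfac α hα hα'
    have hs : 0 ≤ 4 * α := by linarith
    refine ⟨?_, ?_⟩
    · rw [interpDomain, hWe, range_mul_of_isUnit hW, range_sineScale hs]
    obtain ⟨V, hV, -⟩ := isUnit_iff_exists.1 hW
    have hVW : ∀ y, W (V y) = y := fun y => congrFun (congrArg DFunLike.coe hV) y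
    -- With `y` the vector representing `u`, the element `f` is the negative power applied to `V y`,
    -- where `V` inverts `W`; adding `1` makes the constants visibly positive.
    refine ⟨(‖W‖ + 1)⁻¹, ‖V‖ + 1, by positivity, by positivity, fun f u hfu => ?_⟩
    obtain ⟨y, hy⟩ : ∃ y, y = sineBasis.repr.symm (dirSobEquiv (4 * α) u) := ⟨_, rfl⟩
    have hyu : ‖y‖ = ‖u‖ := by
      rw [hy, LinearIsometryEquiv.norm_map, LinearIsometryEquiv.norm_map]
    have hf : f = negPow (diagSemigroup φ l) κ α (V y) := by
      rw [hWe]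
      change f = sineScale _ (W (V y))
      rw [hVW, hy]
      exact coeff_injective (hfu.trans (coeff_sineScale hs u).symm)
    rw [hf, interpNorm_eq (hinj α hα), ← hyu]
    refine ⟨?_, (V.le_opNorm y).trans (by gcongr; linarith)⟩
    rw [inv_mul_le_iff₀ (by positivity)]
    calc ‖y‖ = ‖W (V y)‖ := by rw [hVW]
      _ ≤ ‖W‖ * ‖V y‖ := W.le_opNorm _
      _ ≤ (‖W‖ + 1) * ‖V y‖ := by gcongr; linarith
  · have hs : 4 * α ≤ 0 := by linarith
    obtain ⟨W, hW, hWe⟩ := hfac (-α) (by linarith) (by linarith)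
    rw [mul_neg, neg_neg] at hWe
    -- Both powers are self-adjoint, so taking adjoints moves the invertible factor to the left,
    -- where it changes norms only by bounded factors.
    have hadj : negPow (diagSemigroup φ l) κ (-α) = star W * sineScale (4 * α) := by
      have h1 : star (negPow (diagSemigroup φ l) κ (-α)) = negPow (diagSemigroup φ l) κ (-α) := by
        rw [hpow _ (by linarith)]
        exact adjoint_diagOp φ (bddSeq_rpow_neg hδ hgap (by linarith))
      have h2 : star (sineScale (4 * α)) = sineScale (4 * α) :=
        adjoint_diagOp sineBasis (bddSeq_succ_rpow hs)
      rw [← h1, hWe, star_mul, h2]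
    obtain ⟨V, -, hV⟩ := isUnit_iff_exists.1 hW.star
    have hVW : ∀ y, V (star W y) = y := fun y => congrFun (congrArg DFunLike.coe hV) y
    obtain ⟨Φ, hΦ⟩ := exists_completion_equiv (negPow (diagSemigroup φ l) κ (-α))
      (toDirSob (4 * α)) (denseRange_toDirSob hs) (C := ‖V‖) (c := ‖star W‖)
      (fun x => by
        rw [norm_toDirSob, hadj]
        exact (congrArg norm (hVW _)).symm.le.trans (V.le_opNorm _))
      (fun x => by
        rw [norm_toDirSob, hadj]
        exact (star W).le_opNorm _)
    exact ⟨Φ, fun f => (congrArg DirSob.seq (hΦ f)).trans (toDirSob_seq hs f)⟩
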